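/- Let $\hbar>0$, $q=e^{\pi i\hbar}$, $q^\vee=e^{\pi i/\hbar}$. **The algebra $\mathbf L$.** Let $T_q$ be the quantum torus algebra, generated over $\mathbb Z[q,q^{-1}]$ (with $q$ a formal variable) by $X^{\pm1},Y^{\pm1}$ subject to $q^{-1}XY=qYX$. Let $\gamma$ be the $\mathbb Z[q,q^{-1}]$-linear automorphism of its skew field of fractions with $\gamma(X)=Y^{-1}$, $\gamma(Y)=(1+qY)X$. On $\mathbb Z^2$ put $\gamma_a(a,b)=(\max(a,0)-b,\,a)$. The quantum canonical map $\mathbb I$ on $\mathbb Z^2$ is determined by $\mathbb I(a,b)=q^{-ab}X^aY^b$ for $a\le 0\le b$ and by $\gamma(\mathbb I(\gamma_a(p)))=\mathbb I(p)$. Let $\mathbb L_q$ be the $\mathbb Z[q,q^{-1}]$-span of the values of $\mathbb I$; it is contained in $T_q$ and preserved by $\gamma$. Put $\mathbf L=\mathbb L_q\otimes_{\mathbb Z}\mathbb L_{q^\vee}$, and let $\gamma$ act on $\mathbf L$ through its action on both factors. Let $*$ be the antiautomorphism of $T_q\otimes T_{q^\vee}$ with $*q=q^{-1}$ and $*q^\vee=(q^\vee)^{-1}$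 that fixes the generators $X,Y$ of both factors. **The operators.** $T_q\otimes T_{q^\vee}$ acts on functions of a complex variable: the formal $q,q^\vee$ act as the numbers above, and $$\widehat Xf(z)=f(z+2\pi i\hbar),\quad \widehat Yf(z)=e^zf(z),\quad \widehat X^\vee f(z)=f(z+2\pi i),\quad \widehat Y^\vee f(z)=e^{z/\hbar}f(z).$$ Let $W\subset L^2(\mathbb R)$ be the space of finite $\mathbb C$-linear combinations of the functions $e^{-ax^2/2+bx}P(x)$ with $a>0$, $b\in\mathbb C$ and $P$ a complex polynomial; its elements are identified with their entire continuations. **The operator $K$.** For real $x$ let $$\Phi^\hbar(x)=\exp\Bigl(-\frac14\int_\Omega\frac{e^{-ipx}}{\sinh(\pi p)\sinh(\pi\hbar p)}\frac{dp}{p}\Bigr),$$ where $\Omega$ is the real line from $-\infty$ to $+\infty$ with the segment $[-r,r]$ replaced by the half circle of radius $r$ in the upper half plane, $0<r<\min(1,1/\hbar)$. For $w\in W$ and $z\in\mathbb C$ let $$Kw(z)=\int_{-\infty}^{\infty}w(x)\,\Phi^\hbar(x)\,\exp\Bigl(\frac{-xz}{2\pi i\hbar}\Bigr)dx .$$ **Proposition.**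 Let $A\in\mathbf L$ and $w\in W$. Then $\widehat{\gamma(A)}w\in W$, the integral for $Kw(z)$ converges absolutely for every $z\in\mathbb C$, $Kw$ is an entire function, and $$K\,\widehat{\gamma(A)}\,w=\widehat A\,K w$$ as entire functions. Therefore the restriction of $\widehat AKw$ to $\mathbb R$ lies in $L^2(\mathbb R)$. Moreover the relation holds in the sense of duality with $W$: $(K\widehat{\gamma(A)}w,v)=(Kw,\widehat{*A}\,v)$ for all $v\in W$, where $(f,g)=\int_{\mathbb R}f\,\overline g\,dx$. -/

import Mathlib

namespace QuantumPentagon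

section Torus

/-- The generators `X`, `X⁻¹`, `Y`, `Y⁻¹`. -/
inductive Gen
  | X
  | Xinv
  | Y
  | Yinv

variable {R : Type} [CommRing R]

/-- The defining relations: the generators are invertible and `q⁻¹ X Y = q Y X`. -/
inductive TorusRel (q : Rˣ) : FreeAlgebra R Gen → FreeAlgebra R Gen → Prop
  | X_mul_Xinv : TorusRel q (FreeAlgebra.ι R Gen.X * FreeAlgebra.ι R Gen.Xinv) 1
  | Xinv_mul_X : TorusRel q (FreeAlgebra.ι R Gen.Xinv * FreeAlgebra.ι R Gen.X) 1
  | Y_mul_Yinv : TorusRel q (FreeAlgebra.ι R Gen.Y * FreeAlgebra.ι R Gen.Yinv) 1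
  | Yinv_mul_Y : TorusRel q (FreeAlgebra.ι R Gen.Yinv * FreeAlgebra.ι R Gen.Y) 1
  | comm : TorusRel q
      (((q⁻¹ : Rˣ) : R) • (FreeAlgebra.ι R Gen.X * FreeAlgebra.ι R Gen.Y))
      ((q : R) • (FreeAlgebra.ι R Gen.Y * FreeAlgebra.ι R Gen.X))

/-- The two dimensional quantum torus algebra over `R` with parameter `q`. -/
abbrev QTorus (q : Rˣ) : Type := RingQuot (TorusRel q)

namespace QTorus

variable (q : Rˣ)

/-- The class of a generator. -/
noncomputable def gen (g : Gen) : QTorus q :=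
  RingQuot.mkAlgHom R (TorusRel q) (FreeAlgebra.ι R g)

/-- The invertible element `X`. -/
noncomputable def X : (QTorus q)ˣ where
  val := gen q Gen.X
  inv := gen q Gen.Xinv
  val_inv := by
    simpa [gen] using RingQuot.mkAlgHom_rel R (TorusRel.X_mul_Xinv (q := q))
  inv_val := by
    simpa [gen] using RingQuot.mkAlgHom_rel R (TorusRel.Xinv_mul_X (q := q))

/-- The invertible element `Y`. -/
noncomputable def Y : (QTorus q)ˣ where
  val := gen q Gen.Y
  inv := gen q Gen.Yinv
  val_inv := by
    simpa [gen] using RingQuot.mkAlgHom_rel R (TorusRel.Y_mul_Yinv (q := q))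
  inv_val := by
    simpa [gen] using RingQuot.mkAlgHom_rel R (TorusRel.Yinv_mul_Y (q := q))

theorem comm_rel : ((q⁻¹ : Rˣ) : R) • ((X q : QTorus q) * (Y q : QTorus q))
    = (q : R) • ((Y q : QTorus q) * (X q : QTorus q)) := by
  have h := RingQuot.mkAlgHom_rel R (TorusRel.comm (q := q))
  rw [map_smul, map_smul, map_mul, map_mul] at h
  exact h

variable {B : Type*} [Semiring B]

section AlgLift

variable [Algebra R B]

/-- The images of the generators under the map determined by two units. -/
def genImage (u v : Bˣ) : Gen → B
  | Gen.X => (u : B)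
  | Gen.Xinv => ((u⁻¹ : Bˣ) : B)
  | Gen.Y => (v : B)
  | Gen.Yinv => ((v⁻¹ : Bˣ) : B)

/-- The universal property of the quantum torus, for `R`-algebras. -/
noncomputable def lift (u v : Bˣ)
    (h : ((q⁻¹ : Rˣ) : R) • ((u : B) * (v : B)) = (q : R) • ((v : B) * (u : B))) :
    QTorus q →ₐ[R] B :=
  RingQuot.liftAlgHom R ⟨FreeAlgebra.lift R (genImage u v), by
    intro x y hxy
    cases hxy <;> simp [genImage]
    exact h⟩

variable {q}

theorem lift_gen (u v : Bˣ)
    (h : ((q⁻¹ : Rˣ) : R) • ((u : B) * (v : B)) = (q : R) • ((v : B) * (u : B))) (g : Gen) :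
    lift q u v h (gen q g) = genImage u v g := by
  simp [lift, gen]

@[simp] theorem lift_X (u v : Bˣ)
    (h : ((q⁻¹ : Rˣ) : R) • ((u : B) * (v : B)) = (q : R) • ((v : B) * (u : B))) :
    lift q u v h (X q : QTorus q) = u := lift_gen u v h Gen.X

@[simp] theorem lift_Y (u v : Bˣ)
    (h : ((q⁻¹ : Rˣ) : R) • ((u : B) * (v : B)) = (q : R) • ((v : B) * (u : B))) :
    lift q u v h (Y q : QTorus q) = v := lift_gen u v h Gen.Y

end AlgLift

/-- The universal property of the quantum torus, for rings `B` with a homomorphism from `R`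
whose image is central. -/
noncomputable def liftRing (f : R →+* B) (hf : ∀ r b, f r * b = b * f r) (u v : Bˣ)
    (h : f ((q⁻¹ : Rˣ) : R) * ((u : B) * (v : B)) = f (q : R) * ((v : B) * (u : B))) :
    QTorus q →+* B :=
  letI : Algebra R B := f.toAlgebra' hf
  (lift q u v (by rw [Algebra.smul_def, Algebra.smul_def]; exact h)).toRingHom

theorem liftRing_X (f : R →+* B) (hf : ∀ r b, f r * b = b * f r) (u v : Bˣ)
    (h : f ((q⁻¹ : Rˣ) : R) * ((u : B) * (v : B)) = f (q : R) * ((v : B) * (u : B))) :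
    liftRing q f hf u v h (X q : QTorus q) = u := by
  let _ : Algebra R B := f.toAlgebra' hf
  exact lift_X u v (by rw [Algebra.smul_def, Algebra.smul_def]; exact h)

theorem liftRing_Y (f : R →+* B) (hf : ∀ r b, f r * b = b * f r) (u v : Bˣ)
    (h : f ((q⁻¹ : Rˣ) : R) * ((u : B) * (v : B)) = f (q : R) * ((v : B) * (u : B))) :
    liftRing q f hf u v h (Y q : QTorus q) = v := by
  let _ : Algebra R B := f.toAlgebra' hf
  exact lift_Y u v (by rw [Algebra.smul_def, Algebra.smul_def]; exact h)

theorem liftRing_algebraMap (f : R →+* B) (hf : ∀ r b, f r * b = b * f r) (u v : Bˣ)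
    (h : f ((q⁻¹ : Rˣ) : R) * ((u : B) * (v : B)) = f (q : R) * ((v : B) * (u : B))) (r : R) :
    liftRing q f hf u v h (algebraMap R (QTorus q) r) = f r := by
  let _ : Algebra R B := f.toAlgebra' hf
  exact (lift q u v (by rw [Algebra.smul_def, Algebra.smul_def]; exact h)).commutes r

/-! ### The monomial basis -/

/-- The monomial `X ^ a * Y ^ b`. -/
noncomputable def mon (p : ℤ × ℤ) : (QTorus q)ˣ := X q ^ p.1 * Y q ^ p.2

/-- The cocycle of the multiplication of monomials. -/
def coc (p r : ℤ × ℤ) : Rˣ := (q ^ (2 : ℤ)) ^ (-(p.2 * r.1))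

theorem zpow_comm_zpow {G : Type*} [Group G] (c u v : G) (hu : Commute c u) (hv : Commute c v)
    (h : u * v = c * (v * u)) (m n : ℤ) : v ^ n * u ^ m = c ^ (-(n * m)) * (u ^ m * v ^ n) := by
  have h1 : u * v * u⁻¹ = c * v := by rw [h]; group
  have h2 : u * v ^ n * u⁻¹ = c ^ n * v ^ n := by
    rw [← conj_zpow, h1, hv.mul_zpow]
  have h3 : v ^ (-n) * u * (v ^ (-n))⁻¹ = c ^ n * u := by
    have : u * v ^ n = c ^ n * v ^ n * u := by rw [← h2]; group
    have h4 : Commute (c ^ n) (v ^ (-n)) := hv.zpow_zpow n (-n)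
    calc v ^ (-n) * u * (v ^ (-n))⁻¹ = v ^ (-n) * (u * v ^ n) := by group
      _ = (v ^ (-n) * c ^ n) * v ^ n * u := by rw [this]; group
      _ = c ^ n * u := by rw [← h4.eq]; group
  have h5 : v ^ (-n) * u ^ m * (v ^ (-n))⁻¹ = c ^ (n * m) * u ^ m := by
    rw [← conj_zpow, h3, (hu.zpow_left n).mul_zpow, ← zpow_mul]
  have h6 : Commute (c ^ (n * m)) (v ^ n) := hv.zpow_zpow _ n
  have h7 : u ^ m * v ^ n = c ^ (n * m) * (v ^ n * u ^ m) := by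
    calc u ^ m * v ^ n = v ^ n * (v ^ (-n) * u ^ m * (v ^ (-n))⁻¹) := by group
      _ = (v ^ n * c ^ (n * m)) * u ^ m := by rw [h5]; group
      _ = _ := by rw [← h6.eq]; group
  rw [h7]; group

theorem coe_map_algebraMap (c : Rˣ) :
    ((Units.map (algebraMap R (QTorus q)).toMonoidHom c : (QTorus q)ˣ) : QTorus q)
      = algebraMap R (QTorus q) (c : R) := rfl

theorem commute_map (c : Rˣ) (u : (QTorus q)ˣ) :
    Commute (Units.map (algebraMap R (QTorus q)).toMonoidHom c) u := by
  apply Units.ext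
  simp only [Units.val_mul, coe_map_algebraMap]
  exact Algebra.commutes _ _

theorem mon_mul_unit (p r : ℤ × ℤ) : mon q p * mon q r
    = Units.map (algebraMap R (QTorus q)).toMonoidHom (coc q p r) * mon q (p + r) := by
  have key := zpow_comm_zpow (Units.map (algebraMap R (QTorus q)).toMonoidHom (q ^ (2 : ℤ)))
    (X q) (Y q) (commute_map q _ _) (commute_map q _ _) (by
      apply Units.ext
      have := comm_rel q
      simp only [Units.val_mul, coe_map_algebraMap]
      have h2 := congrArg (fun t => (q : R) • t) this
      simp only [smul_smul, Units.mul_inv, one_smul] at h2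
      rw [h2, Algebra.smul_def]
      congr 2
      rw [zpow_two]; rfl) r.1 p.2
  have hc := commute_map q (coc q p r) (X q ^ p.1)
  unfold mon
  calc X q ^ p.1 * Y q ^ p.2 * (X q ^ r.1 * Y q ^ r.2)
      = X q ^ p.1 * (Y q ^ p.2 * X q ^ r.1) * Y q ^ r.2 := by group
    _ = (X q ^ p.1 * Units.map (algebraMap R (QTorus q)).toMonoidHom (coc q p r))
          * (X q ^ r.1 * Y q ^ p.2) * Y q ^ r.2 := by
        rw [key, ← map_zpow]
        simp only [mul_assoc, coc]
    _ = _ := by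
        rw [← hc.eq, Prod.fst_add, Prod.snd_add, zpow_add, zpow_add]; group

theorem mon_mul (p r : ℤ × ℤ) : (mon q p : QTorus q) * (mon q r : QTorus q)
    = (coc q p r : R) • (mon q (p + r) : QTorus q) := by
  rw [← Units.val_mul, mon_mul_unit, Units.val_mul, coe_map_algebraMap, Algebra.smul_def]

theorem mon_zero : (mon q 0 : QTorus q) = 1 := by simp [mon]

theorem gen_eq_mon (g : Gen) : ∃ p, gen q g = (mon q p : QTorus q) := by
  cases g
  · exact ⟨(1, 0), by simp [mon, X]⟩
  · exact ⟨(-1, 0), by simp [mon, X]⟩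
  · exact ⟨(0, 1), by simp [mon, Y]⟩
  · exact ⟨(0, -1), by simp [mon, Y]⟩

theorem span_mon : Submodule.span R (Set.range fun p => (mon q p : QTorus q)) = ⊤ := by
  set S := Submodule.span R (Set.range fun p => (mon q p : QTorus q)) with hS
  have hmem : ∀ p, (mon q p : QTorus q) ∈ S := fun p => Submodule.subset_span ⟨p, rfl⟩
  have hmul : ∀ x ∈ S, ∀ y ∈ S, x * y ∈ S := by
    intro x hx y hy
    induction hx using Submodule.span_induction with
    | mem x hx =>
      obtain ⟨p, rfl⟩ := hx
      induction hy using Submodule.span_induction with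
      | mem y hy =>
        obtain ⟨r, rfl⟩ := hy
        simp only [mon_mul]
        exact S.smul_mem _ (hmem _)
      | zero => simp
      | add y z _ _ h1 h2 => rw [mul_add]; exact S.add_mem h1 h2
      | smul c y _ h1 => rw [mul_smul_comm]; exact S.smul_mem _ h1
    | zero => simp
    | add x z _ _ h1 h2 => rw [add_mul]; exact S.add_mem h1 h2
    | smul c x _ h1 => rw [smul_mul_assoc]; exact S.smul_mem _ h1
  rw [eq_top_iff]
  rintro t -
  obtain ⟨t, rfl⟩ := RingQuot.mkAlgHom_surjective R (TorusRel q) t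
  induction t using FreeAlgebra.induction with
  | grade0 r =>
    rw [AlgHom.commutes, Algebra.algebraMap_eq_smul_one, ← mon_zero]
    exact S.smul_mem _ (hmem _)
  | grade1 g =>
    obtain ⟨p, hp⟩ := gen_eq_mon q g
    change gen q g ∈ S
    rw [hp]; exact hmem p
  | mul a b ha hb => rw [map_mul]; exact hmul _ ha _ hb
  | add a b ha hb => rw [map_add]; exact S.add_mem ha hb

/-- The operator of left multiplication by a monomial, on coordinates. -/
noncomputable def leftOp (p : ℤ × ℤ) : Module.End R (ℤ × ℤ →₀ R) :=
  Finsupp.linearCombination R fun r => Finsupp.single (p + r) (coc q p r : R)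

theorem leftOp_single (p r : ℤ × ℤ) (c : R) :
    leftOp q p (Finsupp.single r c) = Finsupp.single (p + r) (c * coc q p r) := by
  simp [leftOp]

theorem leftOp_mul (p s : ℤ × ℤ) :
    leftOp q p * leftOp q s = (coc q p s : R) • leftOp q (p + s) := by
  refine Finsupp.lhom_ext fun r c => ?_
  rw [Module.End.mul_apply, leftOp_single, leftOp_single, LinearMap.smul_apply, leftOp_single,
    Finsupp.smul_single, add_assoc]
  congr 1
  have : coc q s r * coc q p (s + r) = coc q p s * coc q (p + s) r := by
    simp only [coc, ← zpow_add]
    congr 1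
    simp only [Prod.fst_add, Prod.snd_add]
    ring
  have h2 := congrArg (Units.val) this
  simp only [Units.val_mul] at h2
  rw [smul_eq_mul, mul_assoc, h2]; ring

theorem leftOp_zero : leftOp q 0 = 1 := by
  refine Finsupp.lhom_ext fun r c => ?_
  rw [leftOp_single]; simp [coc]

/-- Left multiplication by a power of one generator, as a unit. -/
noncomputable def leftUnit (p : ℤ × ℤ) (hp : p.1 * p.2 = 0) : (Module.End R (ℤ × ℤ →₀ R))ˣ where
  val := leftOp q p
  inv := leftOp q (-p)
  val_inv := by
    rw [leftOp_mul, add_neg_cancel, leftOp_zero]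
    simp [coc, mul_comm p.2, hp]
  inv_val := by
    rw [leftOp_mul, neg_add_cancel, leftOp_zero]
    simp [coc, mul_comm p.2, hp]

/-- Left multiplication by `X`. -/
noncomputable def leftX : (Module.End R (ℤ × ℤ →₀ R))ˣ := leftUnit q (1, 0) (by simp)

/-- Left multiplication by `Y`. -/
noncomputable def leftY : (Module.End R (ℤ × ℤ →₀ R))ˣ := leftUnit q (0, 1) (by simp)

theorem left_rel : ((q⁻¹ : Rˣ) : R) • ((leftX q : Module.End R (ℤ × ℤ →₀ R)) * leftY q)
    = (q : R) • ((leftY q : Module.End R (ℤ × ℤ →₀ R)) * leftX q) := by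
  change ((q⁻¹ : Rˣ) : R) • (leftOp q (1, 0) * leftOp q (0, 1))
    = (q : R) • (leftOp q (0, 1) * leftOp q (1, 0))
  rw [leftOp_mul, leftOp_mul, smul_smul, smul_smul, add_comm (1, 0) (0, 1), ← Units.val_mul,
    ← Units.val_mul]
  congr 2
  simp [coc, pow_two, mul_inv_rev]

/-- The left regular representation, on coordinates. -/
noncomputable def leftRep : QTorus q →ₐ[R] Module.End R (ℤ × ℤ →₀ R) :=
  lift q (leftX q) (leftY q) (left_rel q)

theorem leftUnit_X_zpow (n : ℤ) :
    leftX q ^ n = leftUnit q (n, 0) (by simp) := by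
  induction n with
  | zero => apply Units.ext; exact (leftOp_zero q).symm
  | succ n ih =>
    rw [zpow_add_one, ih]; apply Units.ext
    simp [leftX, leftUnit, leftOp_mul, coc]
  | pred n ih =>
    rw [zpow_sub_one, ih]; apply Units.ext
    simp [leftX, leftUnit, leftOp_mul, coc, sub_eq_add_neg]

theorem leftUnit_Y_zpow (n : ℤ) :
    leftY q ^ n = leftUnit q (0, n) (by simp) := by
  induction n with
  | zero => apply Units.ext; exact (leftOp_zero q).symm
  | succ n ih =>
    rw [zpow_add_one, ih]; apply Units.ext
    simp [leftY, leftUnit, leftOp_mul, coc]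
  | pred n ih =>
    rw [zpow_sub_one, ih]; apply Units.ext
    simp [leftY, leftUnit, leftOp_mul, coc, sub_eq_add_neg]

theorem leftRep_mon (p : ℤ × ℤ) : leftRep q (mon q p : QTorus q) = leftOp q p := by
  have hX : Units.map (leftRep q).toMonoidHom (X q) = leftX q :=
    Units.ext (lift_X (leftX q) (leftY q) (left_rel q))
  have hY : Units.map (leftRep q).toMonoidHom (Y q) = leftY q :=
    Units.ext (lift_Y (leftX q) (leftY q) (left_rel q))
  have : Units.map (leftRep q).toMonoidHom (mon q p)
      = leftUnit q (p.1, 0) (by simp) * leftUnit q (0, p.2) (by simp) := by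
    rw [mon, map_mul, map_zpow, map_zpow, hX, hY, leftUnit_X_zpow, leftUnit_Y_zpow]
  have h2 := congrArg Units.val this
  refine h2.trans ?_
  simp [leftUnit, leftOp_mul, coc]

/-- The coordinates of an element in the monomials `X ^ a * Y ^ b`. -/
noncomputable def coordsHom : QTorus q →ₗ[R] (ℤ × ℤ →₀ R) :=
  (LinearMap.applyₗ (Finsupp.single 0 1)) ∘ₗ (leftRep q).toLinearMap

theorem coordsHom_mon (p : ℤ × ℤ) : coordsHom q (mon q p : QTorus q) = Finsupp.single p 1 := by
  simp [coordsHom, leftRep_mon, leftOp_single, coc]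

/-- The elements of the quantum torus are the Laurent `q`-polynomials: the monomials
`X ^ a * Y ^ b` form a basis. -/
noncomputable def coords : QTorus q ≃ₗ[R] (ℤ × ℤ →₀ R) :=
  LinearEquiv.ofLinearMap (coordsHom q)
    (Finsupp.linearCombination R fun p => (mon q p : QTorus q))
    (by
      refine Finsupp.lhom_ext fun p c => ?_
      simp [coordsHom_mon])
    (by
      refine LinearMap.ext_on (span_mon q) ?_
      rintro _ ⟨p, rfl⟩
      simp [coordsHom_mon])

theorem coords_mon (p : ℤ × ℤ) : coords q (mon q p : QTorus q) = Finsupp.single p 1 :=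
  coordsHom_mon q p

theorem leftRep_eq (s : QTorus q) :
    leftRep q s = (coords q s).sum fun p c => c • leftOp q p := by
  conv_lhs => rw [← (coords q).symm_apply_apply s]
  change leftRep q (Finsupp.linearCombination R (fun p => (mon q p : QTorus q)) (coords q s)) = _
  rw [Finsupp.linearCombination_apply, Finsupp.sum, map_sum, Finsupp.sum]
  simp [leftRep_mon]

theorem coords_mul (s t : QTorus q) : coords q (s * t)
    = (coords q s).sum fun p c => c • leftOp q p (coords q t) := by
  have : coords q (s * t) = leftRep q s (coords q t) := by
    change leftRep q (s * t) _ = leftRep q s (leftRep q t _)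
    rw [map_mul]; rfl
  rw [this, leftRep_eq, Finsupp.sum, Finsupp.sum, LinearMap.sum_apply]
  rfl

theorem leftOp_apply (p w : ℤ × ℤ) (f : ℤ × ℤ →₀ R) :
    leftOp q p f w = f (w - p) * coc q p (w - p) := by
  induction f using Finsupp.induction_linear with
  | zero => simp
  | add f g hf hg => rw [map_add, Finsupp.add_apply, hf, hg, Finsupp.add_apply, add_mul]
  | single r c =>
    rw [leftOp_single, Finsupp.single_apply, Finsupp.single_apply]
    by_cases h : p + r = w
    · have : r = w - p := by rw [← h]; abel
      simp [this]
    · have : r ≠ w - p := by rintro rfl; exact h (by abel)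
      simp [h, this]

theorem coords_mul_apply (s t : QTorus q) (w : ℤ × ℤ) : coords q (s * t) w
    = (coords q s).sum fun p c => c * (coords q t (w - p) * coc q p (w - p)) := by
  rw [coords_mul, Finsupp.sum, Finsupp.sum, Finsupp.finsetSum_apply]
  simp [Finsupp.smul_apply, leftOp_apply]

/-! ### The skew field of fractions -/

theorem support_mul_subset (s t : QTorus q) (w : ℤ × ℤ) (h : coords q (s * t) w ≠ 0) :
    ∃ p ∈ (coords q s).support, w - p ∈ (coords q t).support := by
  rw [coords_mul_apply] at h
  obtain ⟨p, hp, hne⟩ := Finset.exists_ne_zero_of_sum_ne_zero h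
  refine ⟨p, hp, ?_⟩
  rw [Finsupp.mem_support_iff]
  intro h0
  exact hne (by simp [h0])

theorem exists_box (s : QTorus q) : ∃ M : ℕ, ∀ p ∈ (coords q s).support,
    p ∈ Finset.Icc (-(M : ℤ)) M ×ˢ Finset.Icc (-(M : ℤ)) M := by
  refine ⟨(coords q s).support.sup fun p => p.1.natAbs + p.2.natAbs, fun p hp => ?_⟩
  have := Finset.le_sup (f := fun p : ℤ × ℤ => p.1.natAbs + p.2.natAbs) hp
  simp only [Finset.mem_product, Finset.mem_Icc]
  omega

/-- The element with prescribed coefficients on a finite set of monomials. -/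
noncomputable def ofCoeffs (S : Finset (ℤ × ℤ)) : (S → R) →ₗ[R] QTorus q :=
  (coords q).symm.toLinearMap ∘ₗ
    (Finsupp.lmapDomain R R (Subtype.val : S → ℤ × ℤ)) ∘ₗ
      (Finsupp.linearEquivFunOnFinite R R S).symm.toLinearMap

theorem ofCoeffs_injective (S : Finset (ℤ × ℤ)) : Function.Injective (ofCoeffs q S) := by
  unfold ofCoeffs
  rw [LinearMap.coe_comp, LinearMap.coe_comp]
  exact (coords q).symm.injective.comp
    ((Finsupp.mapDomain_injective Subtype.val_injective).comp
      (Finsupp.linearEquivFunOnFinite R R S).symm.injective)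

theorem ofCoeffs_support (S : Finset (ℤ × ℤ)) (f : S → R) :
    ∀ p ∈ (coords q (ofCoeffs q S f)).support, p ∈ S := by
  intro p hp
  have : coords q (ofCoeffs q S f) = Finsupp.mapDomain (Subtype.val : S → ℤ × ℤ)
      ((Finsupp.linearEquivFunOnFinite R R S).symm f) := by
    simp [ofCoeffs, Finsupp.lmapDomain]
  rw [this] at hp
  have h2 := Finsupp.mapDomain_support hp
  obtain ⟨x, -, rfl⟩ := Finset.mem_image.mp h2
  exact x.2

/-! ### The element `(1 + q Y) X` -/

/-- The element `(1 + q Y) X`. -/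
noncomputable def flipY : QTorus q := (1 + (q : R) • (Y q : QTorus q)) * (X q : QTorus q)

/-- The span of the monomials `X ^ i * Y ^ j'` with `j < j'`. -/
def above (i j : ℤ) : Submodule R (QTorus q) :=
  Submodule.span R {t | ∃ j', j < j' ∧ t = (mon q (i, j') : QTorus q)}

theorem flipY_eq : flipY q = (mon q (1, 0) : QTorus q)
    + ((q⁻¹ : Rˣ) : R) • (mon q (1, 1) : QTorus q) := by
  have h := comm_rel q
  simp only [flipY, mon, zpow_one, zpow_zero, mul_one, add_mul, one_mul, smul_mul_assoc,
    Units.val_mul]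
  rw [← h]

theorem mon_mul_flipY (i j : ℤ) : ∃ c d : Rˣ, (mon q (i, j) : QTorus q) * flipY q
    = (c : R) • (mon q (i + 1, j) : QTorus q) + (d : R) • (mon q (i + 1, j + 1) : QTorus q) := by
  refine ⟨coc q (i, j) (1, 0), q⁻¹ * coc q (i, j) (1, 1), ?_⟩
  rw [flipY_eq, mul_add, mul_smul_comm, mon_mul, mon_mul, smul_smul, Units.val_mul]
  simp

theorem above_mul_flipY (i j : ℤ) (t : QTorus q) (ht : t ∈ above q i j) :
    t * flipY q ∈ above q (i + 1) j := by
  induction ht using Submodule.span_induction with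
  | mem x hx =>
    obtain ⟨j', hj, rfl⟩ := hx
    obtain ⟨c, d, h⟩ := mon_mul_flipY q i j'
    rw [h]
    refine Submodule.add_mem _ (Submodule.smul_mem _ _ (Submodule.subset_span ⟨j', hj, rfl⟩))
      (Submodule.smul_mem _ _ (Submodule.subset_span ⟨j' + 1, by omega, rfl⟩))
  | zero => simp
  | add x z _ _ h1 h2 => rw [add_mul]; exact Submodule.add_mem _ h1 h2
  | smul c x _ h1 => rw [smul_mul_assoc]; exact Submodule.smul_mem _ _ h1

theorem mon_mul_flipY_pow (j : ℤ) (n : ℕ) : ∃ c : Rˣ, ∃ z ∈ above q n j,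
    (mon q (0, j) : QTorus q) * flipY q ^ n = (c : R) • (mon q (n, j) : QTorus q) + z := by
  induction n with
  | zero => exact ⟨1, 0, Submodule.zero_mem _, by simp⟩
  | succ n ih =>
    obtain ⟨c, z, hz, h⟩ := ih
    obtain ⟨c', d', h'⟩ := mon_mul_flipY q n j
    refine ⟨c * c', ((c * d' : Rˣ) : R) • (mon q ((n : ℤ) + 1, j + 1) : QTorus q) + z * flipY q,
      Submodule.add_mem _ (Submodule.smul_mem _ _ (Submodule.subset_span ⟨j + 1, by omega, ?_⟩))
        ?_, ?_⟩
    · push_cast; rfl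
    · have := above_mul_flipY q _ _ _ hz
      push_cast; exact this
    · rw [pow_succ, ← mul_assoc, h, add_mul, smul_mul_assoc, h', smul_add, smul_smul, smul_smul]
      push_cast
      rw [add_assoc]

theorem coords_above (i j : ℤ) (t : QTorus q) (ht : t ∈ above q i j) (w : ℤ × ℤ)
    (hw : coords q t w ≠ 0) : w.1 = i ∧ j < w.2 := by
  by_contra hcon
  apply hw
  clear hw
  induction ht using Submodule.span_induction with
  | mem x hx =>
    obtain ⟨j', hj, rfl⟩ := hx
    rw [coords_mon, Finsupp.single_apply, if_neg]
    rintro rfl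
    exact hcon ⟨rfl, hj⟩
  | zero => simp
  | add x z _ _ h1 h2 => rw [map_add, Finsupp.add_apply, h1, h2, add_zero]
  | smul c x _ h1 => rw [map_smul, Finsupp.smul_apply, h1, smul_zero]

theorem flipY_rel : ((q⁻¹ : Rˣ) : R) • (flipY q * (Y q : QTorus q))
    = (q : R) • ((Y q : QTorus q) * flipY q) := by
  have h := comm_rel q
  have hY : (1 + (q : R) • (Y q : QTorus q)) * (Y q : QTorus q)
      = (Y q : QTorus q) * (1 + (q : R) • (Y q : QTorus q)) := by
    simp [add_mul, mul_add]
  rw [flipY, mul_assoc, ← mul_smul_comm, h, mul_smul_comm, ← mul_assoc, hY, mul_assoc]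

theorem flipY_Xinv : flipY q * ((X q)⁻¹ : (QTorus q)ˣ) = 1 + (q : R) • (Y q : QTorus q) := by
  rw [flipY, mul_assoc, Units.mul_inv, mul_one]

variable [IsDomain R]

instance : Nontrivial (QTorus q) := (coords q).toEquiv.nontrivial

instance : NoZeroDivisors (QTorus q) where
  eq_zero_or_eq_zero_of_mul_eq_zero := by
    intro s t hst
    by_contra hcon
    rw [not_or] at hcon
    have hs : (coords q s).support.Nonempty := by
      rw [Finsupp.support_nonempty_iff]
      exact fun h => hcon.1 ((coords q).map_eq_zero_iff.mp h)
    have ht : (coords q t).support.Nonempty := by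
      rw [Finsupp.support_nonempty_iff]
      exact fun h => hcon.2 ((coords q).map_eq_zero_iff.mp h)
    obtain ⟨a, ha, b, hb, hu⟩ := UniqueSums.uniqueAdd_of_nonempty hs ht
    have h0 : coords q (s * t) (a + b) = 0 := by rw [hst]; simp
    rw [coords_mul_apply, Finsupp.sum, Finset.sum_eq_single a] at h0
    · rw [add_sub_cancel_left] at h0
      simp only [mul_eq_zero, Units.ne_zero, or_false] at h0
      rcases h0 with h0 | h0
      · exact (Finsupp.mem_support_iff.mp ha) h0
      · exact (Finsupp.mem_support_iff.mp hb) h0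
    · intro p hp hpa
      by_cases hz : a + b - p ∈ (coords q t).support
      · exact absurd (hu hp hz (by abel)).1 hpa
      · rw [Finsupp.notMem_support_iff.mp hz]; simp
    · intro h; exact absurd ha h

/-- The left Ore condition, by counting dimensions. -/
theorem ore_condition (r : QTorus q) (s : nonZeroDivisors (QTorus q)) :
    ∃ (r' : QTorus q) (s' : nonZeroDivisors (QTorus q)), (s' : QTorus q) * r = r' * s := by
  classical
  obtain ⟨M₁, hM₁⟩ := exists_box q r
  obtain ⟨M₂, hM₂⟩ := exists_box q (s : QTorus q)
  set M := max M₁ M₂ with hM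
  set N : ℤ := 10 * M + 10 with hN
  set S : Finset (ℤ × ℤ) := Finset.Icc 0 N ×ˢ Finset.Icc 0 N with hS
  set S' : Finset (ℤ × ℤ) := Finset.Icc (-(M : ℤ)) (N + M) ×ˢ Finset.Icc (-(M : ℤ)) (N + M)
    with hS'
  have hbox : ∀ (f : S → R) (t : QTorus q) (w : ℤ × ℤ),
      (∀ p ∈ (coords q t).support, p ∈ Finset.Icc (-(M : ℤ)) M ×ˢ Finset.Icc (-(M : ℤ)) M) →
      w ∉ S' → coords q (ofCoeffs q S f * t) w = 0 := by
    intro f t w ht hw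
    by_contra hne
    obtain ⟨p, hp, hp'⟩ := support_mul_subset q _ _ _ hne
    have h1 := ofCoeffs_support q S f p hp
    have h2 := ht _ hp'
    apply hw
    simp only [hS, hS', Finset.mem_product, Finset.mem_Icc, Prod.fst_sub, Prod.snd_sub] at *
    omega
  have hr : ∀ p ∈ (coords q r).support,
      p ∈ Finset.Icc (-(M : ℤ)) M ×ˢ Finset.Icc (-(M : ℤ)) M := by
    intro p hp
    have := hM₁ p hp
    simp only [Finset.mem_product, Finset.mem_Icc] at *
    omega
  have hs : ∀ p ∈ (coords q (s : QTorus q)).support,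
      p ∈ Finset.Icc (-(M : ℤ)) M ×ˢ Finset.Icc (-(M : ℤ)) M := by
    intro p hp
    have := hM₂ p hp
    simp only [Finset.mem_product, Finset.mem_Icc] at *
    omega
  let Ψ : (S ⊕ S → R) →ₗ[R] QTorus q :=
    LinearMap.mulRight R r ∘ₗ ofCoeffs q S ∘ₗ LinearMap.funLeft R R Sum.inl
      - LinearMap.mulRight R (s : QTorus q) ∘ₗ ofCoeffs q S ∘ₗ LinearMap.funLeft R R Sum.inr
  let Ψ' : (S ⊕ S → R) →ₗ[R] (S' → R) :=
    LinearMap.funLeft R R (Subtype.val : S' → ℤ × ℤ) ∘ₗ Finsupp.lcoeFun ∘ₗ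
      (coords q).toLinearMap ∘ₗ Ψ
  have hninj : ¬ Function.Injective Ψ' := by
    intro hinj
    have hc := card_le_of_injective R Ψ' hinj
    simp only [Fintype.card_sum, Fintype.card_coe, hS, hS', Finset.card_product,
      Int.card_Icc] at hc
    have e1 : (N + 1 - 0).toNat = 10 * M + 11 := by omega
    have e2 : (N + M + 1 - -(M : ℤ)).toNat = 12 * M + 11 := by omega
    rw [e1, e2] at hc
    nlinarith
  rw [← LinearMap.ker_eq_bot, LinearMap.ker_eq_bot', not_forall] at hninj
  obtain ⟨g, hg⟩ := hninj
  rw [Classical.not_imp] at hg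
  obtain ⟨hg0, hg1⟩ := hg
  have hΨ : Ψ g = 0 := by
    apply (coords q).map_eq_zero_iff.mp
    ext w
    by_cases hw : w ∈ S'
    · exact congrFun hg0 ⟨w, hw⟩
    · simp only [Ψ, LinearMap.sub_apply, LinearMap.comp_apply, map_sub, Finsupp.sub_apply,
        LinearMap.mulRight_apply]
      rw [hbox _ _ _ hr hw, hbox _ _ _ hs hw]; simp
  set s' := ofCoeffs q S (LinearMap.funLeft R R Sum.inl g) with hs'
  set r' := ofCoeffs q S (LinearMap.funLeft R R Sum.inr g) with hr'
  have heq : s' * r = r' * s := by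
    have : Ψ g = s' * r - r' * s := rfl
    rw [← sub_eq_zero, ← this, hΨ]
  have hne : s' ≠ 0 := by
    intro h0
    have h1 : r' = 0 := by
      rw [h0, zero_mul] at heq
      rcases mul_eq_zero.mp heq.symm with h | h
      · exact h
      · exact absurd h (nonZeroDivisors.coe_ne_zero s)
    apply hg1
    have i0 : LinearMap.funLeft R R Sum.inl g = 0 :=
      ofCoeffs_injective q S (by rw [map_zero]; exact h0)
    have i1 : LinearMap.funLeft R R Sum.inr g = 0 :=
      ofCoeffs_injective q S (by rw [map_zero]; exact h1)
    ext x
    cases x with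
    | inl x => exact congrFun i0 x
    | inr x => exact congrFun i1 x
  exact ⟨r', ⟨s', mem_nonZeroDivisors_of_ne_zero hne⟩, heq⟩

noncomputable instance oreSet : OreLocalization.OreSet (nonZeroDivisors (QTorus q)) :=
  (OreLocalization.nonempty_oreSet_iff_of_noZeroDivisors.mpr (ore_condition q)).some

/-- The fraction field (a skew field) of the quantum torus algebra. -/
abbrev Frac : Type := OreLocalization (nonZeroDivisors (QTorus q)) (QTorus q)

/-- The embedding of the quantum torus algebra in its fraction field. -/
noncomputable def toFrac : QTorus q →ₐ[R] Frac q where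
  __ := OreLocalization.numeratorRingHom
  commutes' _ := rfl

theorem toFrac_injective : Function.Injective (toFrac q) :=
  OreLocalization.numeratorHom_inj inf_le_left

theorem toFrac_ne_zero {t : QTorus q} (ht : t ≠ 0) : toFrac q t ≠ 0 := by
  rw [← map_zero (toFrac q)]
  exact (toFrac_injective q).ne ht

theorem flipY_ne_zero : flipY q ≠ 0 := by
  intro h
  obtain ⟨c, z, hz, h1⟩ := mon_mul_flipY_pow q 0 1
  rw [pow_one, h, mul_zero] at h1
  have h2 := congrArg (fun t => coords q t (1, 0)) h1
  have h3 : coords q z (1, 0) = 0 := by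
    by_contra hne
    have := (coords_above q _ _ z hz _ hne).2
    simp at this
  simp [coords_mon, h3] at h2
  exact c.ne_zero h2.symm

/-- The image of `X`, as a unit of the fraction field. -/
noncomputable def fX : (Frac q)ˣ := Units.map (toFrac q).toMonoidHom (X q)

/-- The image of `Y`, as a unit of the fraction field. -/
noncomputable def fY : (Frac q)ˣ := Units.map (toFrac q).toMonoidHom (Y q)

/-- The element `(1 + q Y) X`, as a unit of the fraction field. -/
noncomputable def fFlip : (Frac q)ˣ := Units.mk0 (toFrac q (flipY q)) (toFrac_ne_zero q (flipY_ne_zero q))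

theorem fY_val : (fY q : Frac q) = toFrac q (Y q : QTorus q) := rfl

theorem fX_val : (fX q : Frac q) = toFrac q (X q : QTorus q) := rfl

theorem fFlip_val : (fFlip q : Frac q) = toFrac q (flipY q) := rfl

theorem gamma_rel : ((q⁻¹ : Rˣ) : R) • ((((fY q)⁻¹ : (Frac q)ˣ) : Frac q) * (fFlip q : Frac q))
    = (q : R) • ((fFlip q : Frac q) * (((fY q)⁻¹ : (Frac q)ˣ) : Frac q)) := by
  have h := congrArg (toFrac q) (flipY_rel q)
  rw [map_smul, map_smul, map_mul, map_mul, ← fY_val, ← fFlip_val] at h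
  have h2 := congrArg (fun t => (((fY q)⁻¹ : (Frac q)ˣ) : Frac q) * t
    * (((fY q)⁻¹ : (Frac q)ˣ) : Frac q)) h
  simp only [mul_smul_comm, smul_mul_assoc, mul_assoc, Units.mul_inv, mul_one,
    Units.inv_mul_cancel_left] at h2
  exact h2

/-- The homomorphism from the quantum torus to its fraction field
with `X ↦ Y⁻¹` and `Y ↦ (1 + q Y) X`. -/
noncomputable def gammaTorus : QTorus q →ₐ[R] Frac q :=
  lift q (fY q)⁻¹ (fFlip q) (gamma_rel q)

theorem gammaTorus_X : gammaTorus q (X q : QTorus q) = (((fY q)⁻¹ : (Frac q)ˣ) : Frac q) :=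
  lift_X _ _ _

theorem gammaTorus_Y : gammaTorus q (Y q : QTorus q) = (fFlip q : Frac q) :=
  lift_Y _ _ _

theorem gammaTorus_mon (p : ℤ × ℤ) : gammaTorus q (mon q p : QTorus q)
    = (((fY q) ^ (-p.1) * (fFlip q) ^ p.2 : (Frac q)ˣ) : Frac q) := by
  have hX : Units.map (gammaTorus q).toMonoidHom (X q) = (fY q)⁻¹ := Units.ext (gammaTorus_X q)
  have hY : Units.map (gammaTorus q).toMonoidHom (Y q) = fFlip q := Units.ext (gammaTorus_Y q)
  have : Units.map (gammaTorus q).toMonoidHom (mon q p) = (fY q) ^ (-p.1) * (fFlip q) ^ p.2 := by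
    rw [mon, map_mul, map_zpow, map_zpow, hX, hY, inv_zpow, zpow_neg]
  exact congrArg Units.val this

theorem gammaTorus_mon_nat (a : ℤ) (n : ℕ) : gammaTorus q (mon q (a, n) : QTorus q)
    = toFrac q ((mon q (0, -a) : QTorus q) * flipY q ^ n) := by
  rw [gammaTorus_mon, map_mul, map_pow, ← fFlip_val, Units.val_mul, zpow_natCast,
    Units.val_pow_eq_pow_val]
  congr 1
  rw [mon, zpow_zero, one_mul, fY, ← map_zpow]
  rfl

theorem gammaTorus_injective : Function.Injective (gammaTorus q) := by
  classical
  rw [injective_iff_map_eq_zero]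
  intro F hF
  by_contra hne
  obtain ⟨M, hM⟩ := exists_box q F
  set G : QTorus q := F * (mon q (0, M) : QTorus q) with hG
  have hG0 : G ≠ 0 := mul_ne_zero hne (Units.ne_zero _)
  have hγG : gammaTorus q G = 0 := by rw [hG, map_mul, hF, zero_mul]
  have hpos : ∀ p ∈ (coords q G).support, 0 ≤ p.2 := by
    intro p hp
    obtain ⟨p', hp', h⟩ := support_mul_subset q _ _ _ (Finsupp.mem_support_iff.mp hp)
    rw [coords_mon, Finsupp.mem_support_iff, Finsupp.single_apply] at h
    have h1 : (0, (M : ℤ)) = p - p' := by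
      by_contra hh; rw [if_neg hh] at h; exact h rfl
    have h2 := hM p' hp'
    have h3 := congrArg Prod.snd h1
    simp only [Finset.mem_product, Finset.mem_Icc, Prod.snd_sub] at h2 h3
    omega
  have hsupp : (coords q G).support.Nonempty := by
    rw [Finsupp.support_nonempty_iff]
    exact fun h => hG0 ((coords q).map_eq_zero_iff.mp h)
  obtain ⟨p₀, hp₀, hmax⟩ := Finset.exists_max_image _ (fun p : ℤ × ℤ => p.1) hsupp
  have hexp : G = ∑ p ∈ (coords q G).support, coords q G p • (mon q p : QTorus q) := by
    conv_lhs => rw [← (coords q).symm_apply_apply G]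
    rfl
  set H : QTorus q := ∑ p ∈ (coords q G).support,
    coords q G p • ((mon q (0, -p.1) : QTorus q) * flipY q ^ p.2.toNat) with hH
  have hγH : gammaTorus q G = toFrac q H := by
    conv_lhs => rw [hexp]
    rw [hH, map_sum, map_sum]
    refine Finset.sum_congr rfl fun p hp => ?_
    rw [map_smul, map_smul, ← gammaTorus_mon_nat, Int.toNat_of_nonneg (hpos p hp)]
  have hH0 : H = 0 := by
    apply toFrac_injective q
    rw [← hγH, hγG, map_zero]
  have hcoef : coords q H (p₀.2, -p₀.1) = 0 := by rw [hH0]; simp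
  rw [hH, map_sum, Finsupp.finsetSum_apply, Finset.sum_eq_single p₀] at hcoef
  · obtain ⟨c, z, hz, h⟩ := mon_mul_flipY_pow q (-p₀.1) p₀.2.toNat
    have hz0 : coords q z (p₀.2, -p₀.1) = 0 := by
      by_contra hne
      have := (coords_above q _ _ z hz _ hne).2
      simp at this
    rw [h, Int.toNat_of_nonneg (hpos p₀ hp₀)] at hcoef
    simp only [map_smul, map_add, Finsupp.smul_apply, Finsupp.add_apply, hz0, coords_mon,
      Finsupp.single_eq_same, smul_eq_mul, mul_one, add_zero, mul_eq_zero, Units.ne_zero,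
      or_false] at hcoef
    exact (Finsupp.mem_support_iff.mp hp₀) hcoef
  · intro p hp hpne
    obtain ⟨c, z, hz, h⟩ := mon_mul_flipY_pow q (-p.1) p.2.toNat
    have hle := hmax p hp
    have hp0 := hpos p hp
    have hz0 : coords q z (p₀.2, -p₀.1) = 0 := by
      by_contra hne
      have := (coords_above q _ _ z hz _ hne).2
      simp only at this
      omega
    rw [h, map_smul, Finsupp.smul_apply, map_add, Finsupp.add_apply, hz0, map_smul,
      Finsupp.smul_apply, coords_mon, Finsupp.single_apply, if_neg]
    · simp
    · intro heq
      rw [Prod.mk.injEq] at heq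
      apply hpne
      ext <;> omega
  · intro h; exact absurd hp₀ h

theorem gammaTorus_ne_zero (s : nonZeroDivisors (QTorus q)) :
    gammaTorus q (s : QTorus q) ≠ 0 := by
  rw [← map_zero (gammaTorus q)]
  exact (gammaTorus_injective q).ne (nonZeroDivisors.coe_ne_zero s)

/-- The images of the denominators under `gammaTorus`, as units. -/
noncomputable def gammaDenom : nonZeroDivisors (QTorus q) →* (Frac q)ˣ where
  toFun s := Units.mk0 (gammaTorus q (s : QTorus q)) (gammaTorus_ne_zero q s)
  map_one' := by apply Units.ext; simp
  map_mul' s t := by apply Units.ext; simp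

/-- The homomorphism `γ` of the fraction field with `X ↦ Y⁻¹` and `Y ↦ (1 + q Y) X`. -/
noncomputable def gamma : Frac q →ₐ[R] Frac q where
  __ := OreLocalization.universalHom (gammaTorus q).toRingHom (gammaDenom q) (fun _ => rfl)
  commutes' r := by
    refine (OreLocalization.universalHom_commutes (gammaTorus q).toRingHom (gammaDenom q)
      (fun _ => rfl) (r := algebraMap R (QTorus q) r)).trans ?_
    exact (gammaTorus q).commutes r

theorem gamma_toFrac (t : QTorus q) : gamma q (toFrac q t) = gammaTorus q t :=
  OreLocalization.universalHom_commutes (gammaTorus q).toRingHom (gammaDenom q) (fun _ => rfl)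

theorem gamma_X : gamma q (toFrac q (X q : QTorus q)) = (toFrac q (Y q : QTorus q))⁻¹ := by
  rw [gamma_toFrac, gammaTorus_X, Units.val_inv_eq_inv_val, fY_val]

theorem gamma_Y : gamma q (toFrac q (Y q : QTorus q))
    = (1 + (q : R) • toFrac q (Y q : QTorus q)) * toFrac q (X q : QTorus q) := by
  rw [gamma_toFrac, gammaTorus_Y, fFlip_val, flipY, map_mul, map_add, map_one, map_smul]

/-! ### The canonical basis and the algebra `𝕃_q` -/

/-- The action of `γ` on the tropical points, `(a, b) ↦ (max (a, 0) - b, a)`. -/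
def tropGamma (p : ℤ × ℤ) : ℤ × ℤ := (max p.1 0 - p.2, p.1)

/-- `IsCanonical q p F` says that `F` is the value at the tropical point `p` of the quantum
canonical map `𝕀`. This map is determined by its values `q ^ (-a b) X ^ a Y ^ b` on the first cone
`a ≤ 0 ≤ b` and by its equivariance `γ (𝕀 (tropGamma p)) = 𝕀 p`. -/
inductive IsCanonical : ℤ × ℤ → Frac q → Prop
  | cone (a b : ℤ) (ha : a ≤ 0) (hb : 0 ≤ b) : IsCanonical (a, b)
      (((q ^ (-(a * b)) : Rˣ) : R)
        • (toFrac q (X q : QTorus q) ^ a * toFrac q (Y q : QTorus q) ^ b))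
  | step (p : ℤ × ℤ) (F : Frac q) (h : IsCanonical (tropGamma p) F) : IsCanonical p (gamma q F)

/-- The space `𝕃_q` spanned over `R` by the values of the quantum canonical map. -/
noncomputable def canonicalSpan : Submodule R (Frac q) := Submodule.span R {F | ∃ p, IsCanonical q p F}

theorem tropGamma_surjective (p : ℤ × ℤ) : ∃ r, tropGamma r = p :=
  ⟨(p.2, max p.2 0 - p.1), by ext <;> simp [tropGamma]⟩

theorem gamma_mem_canonicalSpan (F : Frac q) (hF : F ∈ canonicalSpan q) :
    (gamma q).toLinearMap F ∈ canonicalSpan q := by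
  induction hF using Submodule.span_induction with
  | mem x hx =>
    obtain ⟨p, hp⟩ := hx
    obtain ⟨r, rfl⟩ := tropGamma_surjective p
    exact Submodule.subset_span ⟨r, IsCanonical.step r x hp⟩
  | zero => simp
  | add x z _ _ h1 h2 => rw [map_add]; exact Submodule.add_mem _ h1 h2
  | smul c x _ h1 => rw [map_smul]; exact Submodule.smul_mem _ _ h1

/-- The map `γ` on `𝕃_q`. -/
noncomputable def gammaSpan : canonicalSpan q →ₗ[R] canonicalSpan q :=
  (gamma q).toLinearMap.restrict (gamma_mem_canonicalSpan q)

/-! The elements of `𝕃_q` are Laurent `q`-polynomials: the five elements below are permuted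
cyclically by `γ`. -/

/-- The third of the five elements. -/
noncomputable def lau2 : QTorus q :=
  ((Y q)⁻¹ : (QTorus q)ˣ) + (q : R) • ((X q : QTorus q) * ((Y q)⁻¹ : (QTorus q)ˣ)) + X q

/-- The fourth of the five elements. -/
noncomputable def lau3 : QTorus q :=
  ((Y q)⁻¹ : (QTorus q)ˣ)
    + (q : R) • ((((Y q)⁻¹ : (QTorus q)ˣ) : QTorus q) * ((X q)⁻¹ : (QTorus q)ˣ))

/-- The algebra generated by the five elements. -/
def lauAlg : Subalgebra R (QTorus q) :=
  Algebra.adjoin R {(Y q : QTorus q), flipY q, lau2 q, lau3 q, (((X q)⁻¹ : (QTorus q)ˣ) : QTorus q)}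

theorem toFrac_inv (u : (QTorus q)ˣ) :
    toFrac q ((u⁻¹ : (QTorus q)ˣ) : QTorus q) = (toFrac q (u : QTorus q))⁻¹ := by
  have := Units.val_inv_eq_inv_val (Units.map (toFrac q).toMonoidHom u)
  exact this

theorem gamma_Xinv : gamma q (toFrac q ((X q)⁻¹ : (QTorus q)ˣ)) = toFrac q (Y q : QTorus q) := by
  rw [toFrac_inv, map_inv₀, gamma_X, inv_inv]

theorem gamma_Y' : gamma q (toFrac q (Y q : QTorus q)) = toFrac q (flipY q) := by
  rw [gamma_Y, flipY, map_mul, map_add, map_one, map_smul]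

theorem gamma_flipY : gamma q (toFrac q (flipY q)) = toFrac q (lau2 q) := by
  have h1 : gamma q (toFrac q (flipY q))
      = toFrac q ((1 + (q : R) • flipY q) * ((Y q)⁻¹ : (QTorus q)ˣ)) := by
    rw [flipY, map_mul, map_add, map_one, map_smul, map_mul, map_add, map_one, map_smul, gamma_Y',
      gamma_X, map_mul, map_add, map_one, map_smul, toFrac_inv]
    rfl
  rw [h1]
  congr 1
  have h2 : (Y q : QTorus q) * (X q : QTorus q) * (((Y q)⁻¹ : (QTorus q)ˣ) : QTorus q)
      = ((q⁻¹ * q⁻¹ : Rˣ) : R) • (X q : QTorus q) := by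
    have h := congrArg (fun t => ((q⁻¹ : Rˣ) : R) • t * (((Y q)⁻¹ : (QTorus q)ˣ) : QTorus q))
      (comm_rel q)
    simp only [smul_smul, smul_mul_assoc, Units.inv_mul, one_smul, Units.mul_inv_cancel_right] at h
    rw [← h, Units.val_mul]
  have hq : (q : R) * q * ((q⁻¹ * q⁻¹ : Rˣ) : R) = 1 := by
    rw [← Units.val_mul, ← Units.val_mul, mul_assoc, mul_inv_cancel_left, mul_inv_cancel,
      Units.val_one]
  rw [flipY, lau2, add_mul, one_mul, smul_mul_assoc, add_mul, add_mul, one_mul, smul_add, add_assoc,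
    smul_mul_assoc, smul_mul_assoc, h2, smul_smul, smul_smul, hq, one_smul]

theorem gamma_lau3 :
    gamma q (toFrac q (lau3 q)) = toFrac q (((X q)⁻¹ : (QTorus q)ˣ) : QTorus q) := by
  have hne := toFrac_ne_zero q (flipY_ne_zero q)
  rw [lau3, map_add, map_add, map_smul, map_smul, map_mul, map_mul, gamma_Xinv, toFrac_inv q (Y q),
    map_inv₀, gamma_Y', ← mul_smul_comm, ← mul_one_add, inv_mul_eq_iff_eq_mul₀ hne, ← map_mul,
    flipY_Xinv, map_add, map_one, map_smul]

theorem gamma_lau2 : gamma q (toFrac q (lau2 q)) = toFrac q (lau3 q) := by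
  have hne := toFrac_ne_zero q (flipY_ne_zero q)
  have hY : toFrac q (Y q : QTorus q) ≠ 0 := toFrac_ne_zero q (Units.ne_zero _)
  have hX : toFrac q (X q : QTorus q) ≠ 0 := toFrac_ne_zero q (Units.ne_zero _)
  have h1 : gamma q (toFrac q (lau2 q)) = (toFrac q (flipY q))⁻¹
      + (q : R) • ((toFrac q (Y q : QTorus q))⁻¹ * (toFrac q (flipY q))⁻¹)
      + (toFrac q (Y q : QTorus q))⁻¹ := by
    rw [lau2, map_add, map_add, map_add, map_add, map_smul, map_smul, map_mul, map_mul,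
      toFrac_inv, map_inv₀, gamma_Y', gamma_X]
  have h2 : (Y q : QTorus q) + (q : R) • 1
      = (q : R) • ((((X q)⁻¹ : (QTorus q)ˣ) : QTorus q) * flipY q) := by
    have h := congrArg (fun t => (q : R) • ((((X q)⁻¹ : (QTorus q)ˣ) : QTorus q) * t)) (comm_rel q)
    simp only [mul_smul_comm, smul_smul, Units.mul_inv, one_smul, Units.inv_mul_cancel_left] at h
    rw [flipY, add_mul, one_mul, mul_add, Units.inv_mul, smul_add,
      smul_mul_assoc, mul_smul_comm, smul_smul, ← h, add_comm]
  have h3 : toFrac q (Y q : QTorus q) + (q : R) • 1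
      = (q : R) • ((toFrac q (X q : QTorus q))⁻¹ * toFrac q (flipY q)) := by
    have h := congrArg (toFrac q) h2
    rwa [map_add, map_smul, map_one, map_smul, map_mul, toFrac_inv] at h
  have h4 : (toFrac q (flipY q))⁻¹
      + (q : R) • ((toFrac q (Y q : QTorus q))⁻¹ * (toFrac q (flipY q))⁻¹)
      = (toFrac q (Y q : QTorus q))⁻¹ * (toFrac q (Y q : QTorus q) + (q : R) • 1)
        * (toFrac q (flipY q))⁻¹ := by
    rw [mul_add, inv_mul_cancel₀ hY, add_mul, one_mul, mul_smul_comm, mul_one, smul_mul_assoc]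
  rw [h1, h4, h3, lau3, map_add, map_smul, map_mul, toFrac_inv, toFrac_inv, mul_smul_comm,
    smul_mul_assoc, ← mul_assoc, mul_assoc _ (toFrac q (flipY q)), mul_inv_cancel₀ hne, mul_one,
    add_comm]

theorem gamma_lauAlg (t : QTorus q) (ht : t ∈ lauAlg q) :
    ∃ t' ∈ lauAlg q, gamma q (toFrac q t) = toFrac q t' := by
  have hsub : ∀ x ∈ ({(Y q : QTorus q), flipY q, lau2 q, lau3 q,
      (((X q)⁻¹ : (QTorus q)ˣ) : QTorus q)} : Set (QTorus q)), x ∈ lauAlg q :=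
    fun x hx => Algebra.subset_adjoin hx
  induction ht using Algebra.adjoin_induction with
  | mem x hx =>
    simp only [Set.mem_insert_iff, Set.mem_singleton_iff] at hx
    rcases hx with rfl | rfl | rfl | rfl | rfl
    · exact ⟨_, hsub _ (by simp), gamma_Y' q⟩
    · exact ⟨_, hsub _ (by simp), gamma_flipY q⟩
    · exact ⟨_, hsub _ (by simp), gamma_lau2 q⟩
    · exact ⟨_, hsub _ (by simp), gamma_lau3 q⟩
    · exact ⟨_, hsub _ (by simp), gamma_Xinv q⟩
  | algebraMap r => exact ⟨algebraMap R _ r, Subalgebra.algebraMap_mem _ r, by simp⟩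
  | add x z _ _ h1 h2 =>
    obtain ⟨x', hx', h1⟩ := h1
    obtain ⟨z', hz', h2⟩ := h2
    exact ⟨x' + z', add_mem hx' hz', by simp only [map_add, h1, h2]⟩
  | mul x z _ _ h1 h2 =>
    obtain ⟨x', hx', h1⟩ := h1
    obtain ⟨z', hz', h2⟩ := h2
    exact ⟨x' * z', mul_mem hx' hz', by simp only [map_mul, h1, h2]⟩

theorem isCanonical_laurent (p : ℤ × ℤ) (F : Frac q) (h : IsCanonical q p F) :
    ∃ t ∈ lauAlg q, F = toFrac q t := by
  induction h with
  | cone a b ha hb =>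
    have hX : (((X q)⁻¹ : (QTorus q)ˣ) : QTorus q) ∈ lauAlg q :=
      Algebra.subset_adjoin (by simp)
    have hY : (Y q : QTorus q) ∈ lauAlg q := Algebra.subset_adjoin (by simp)
    refine ⟨_, Subalgebra.smul_mem _ (mul_mem (pow_mem hX a.natAbs) (pow_mem hY b.natAbs))
      ((q ^ (-(a * b)) : Rˣ) : R), ?_⟩
    rw [map_smul, map_mul, map_pow, map_pow, toFrac_inv, inv_pow, ← zpow_natCast, ← zpow_natCast,
      ← zpow_neg, Int.natCast_natAbs, Int.natCast_natAbs, abs_of_nonpos ha, abs_of_nonneg hb,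
      neg_neg]
  | step p F h ih =>
    obtain ⟨t, ht, rfl⟩ := ih
    obtain ⟨t', ht', h⟩ := gamma_lauAlg q t ht
    exact ⟨t', ht', h⟩

theorem canonicalSpan_le : canonicalSpan q ≤ LinearMap.range (toFrac q).toLinearMap := by
  refine Submodule.span_le.mpr ?_
  rintro F ⟨p, hp⟩
  obtain ⟨t, -, rfl⟩ := isCanonical_laurent q p F hp
  exact ⟨t, rfl⟩

/-- The elements of `𝕃_q`, viewed as Laurent `q`-polynomials. -/
noncomputable def laurent : canonicalSpan q →ₗ[R] QTorus q :=
  (LinearEquiv.ofInjective (toFrac q).toLinearMap (toFrac_injective q)).symm.toLinearMap ∘ₗ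
    Submodule.inclusion (canonicalSpan_le q)

theorem toFrac_laurent (F : canonicalSpan q) : toFrac q (laurent q F) = F := by
  have := (LinearEquiv.ofInjective (toFrac q).toLinearMap (toFrac_injective q)).apply_symm_apply
    (Submodule.inclusion (canonicalSpan_le q) F)
  exact congrArg Subtype.val this

end QTorus
end Torus

/-! ### The `∗`-algebra `𝐋` -/

/-- The ring `ℤ[q, q⁻¹]`. -/
abbrev Zq : Type := LaurentPolynomial ℤ

/-- The element `q` of `ℤ[q, q⁻¹]`. -/
noncomputable def qVar : Zqˣ where
  val := LaurentPolynomial.T 1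
  inv := LaurentPolynomial.T (-1)
  val_inv := by rw [← LaurentPolynomial.T_add]; simp
  inv_val := by rw [← LaurentPolynomial.T_add]; simp

/-- The quantum torus algebra `T_q` over `ℤ[q, q⁻¹]`. -/
abbrev Tq : Type := QTorus qVar

/-- The algebra `𝕃_q`. -/
abbrev Lq : Type := QTorus.canonicalSpan qVar

/-- The tensor product `𝐋` of `𝕃_q` and its second copy, whose parameter is `q^∨`. -/
abbrev LL : Type := TensorProduct ℤ Lq Lq

/-- The map `γ` on `𝐋`, acting by `γ` on each of the two factors. -/
noncomputable def gammaLL : LL →ₗ[ℤ] LL :=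
  TensorProduct.map ((QTorus.gammaSpan qVar).restrictScalars ℤ)
    ((QTorus.gammaSpan qVar).restrictScalars ℤ)

theorem gammaLL_tmul (F G : Lq) : gammaLL (TensorProduct.tmul ℤ F G)
    = TensorProduct.tmul ℤ (QTorus.gammaSpan qVar F) (QTorus.gammaSpan qVar G) := rfl

/-- The inclusion of `𝐋` in the tensor product of two quantum tori. -/
noncomputable def laurentLL : LL →ₗ[ℤ] TensorProduct ℤ Tq Tq :=
  TensorProduct.map ((QTorus.laurent qVar).restrictScalars ℤ)
    ((QTorus.laurent qVar).restrictScalars ℤ)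

theorem laurentLL_tmul (F G : Lq) : laurentLL (TensorProduct.tmul ℤ F G)
    = TensorProduct.tmul ℤ (QTorus.laurent qVar F) (QTorus.laurent qVar G) := rfl

/-- The homomorphism from `ℤ[q, q⁻¹]` to the opposite of `T_q` with `q ↦ q⁻¹`. -/
noncomputable def starScalar : Zq →+* Tqᵐᵒᵖ :=
  (algebraMap Zq Tqᵐᵒᵖ).comp (LaurentPolynomial.invert (R := ℤ) : Zq →+* Zq)

theorem starScalar_comm (r : Zq) (b : Tqᵐᵒᵖ) : starScalar r * b = b * starScalar r :=
  Algebra.commutes (LaurentPolynomial.invert r) b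

theorem star_rel :
    starScalar ((qVar⁻¹ : Zqˣ) : Zq)
      * (MulOpposite.op (QTorus.X qVar : Tq) * MulOpposite.op (QTorus.Y qVar : Tq))
    = starScalar (qVar : Zq)
      * (MulOpposite.op (QTorus.Y qVar : Tq) * MulOpposite.op (QTorus.X qVar : Tq)) := by
  have h1 : (LaurentPolynomial.invert (R := ℤ)) ((qVar⁻¹ : Zqˣ) : Zq) = (qVar : Zq) := by
    change LaurentPolynomial.invert (LaurentPolynomial.T (-1)) = LaurentPolynomial.T 1
    simp
  have h2 : (LaurentPolynomial.invert (R := ℤ)) (qVar : Zq) = ((qVar⁻¹ : Zqˣ) : Zq) := by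
    change LaurentPolynomial.invert (LaurentPolynomial.T 1) = LaurentPolynomial.T (-1)
    simp
  change algebraMap Zq Tqᵐᵒᵖ (LaurentPolynomial.invert ((qVar⁻¹ : Zqˣ) : Zq)) * _
    = algebraMap Zq Tqᵐᵒᵖ (LaurentPolynomial.invert (qVar : Zq)) * _
  rw [h1, h2, ← Algebra.smul_def, ← Algebra.smul_def, ← MulOpposite.op_mul, ← MulOpposite.op_mul,
    ← MulOpposite.op_smul, ← MulOpposite.op_smul, QTorus.comm_rel]

/-- The antiautomorphism `∗` of `T_q` with `∗q = q⁻¹`, `∗X = X`, `∗Y = Y`. -/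
noncomputable def starTq : Tq →+* Tqᵐᵒᵖ :=
  QTorus.liftRing qVar
    starScalar starScalar_comm
    (Units.opEquiv.symm (MulOpposite.op (QTorus.X qVar)))
    (Units.opEquiv.symm (MulOpposite.op (QTorus.Y qVar)))
    star_rel

theorem starTq_X : starTq (QTorus.X qVar : Tq) = MulOpposite.op (QTorus.X qVar : Tq) :=
  QTorus.liftRing_X _ _ _ _ _ _

theorem starTq_Y : starTq (QTorus.Y qVar : Tq) = MulOpposite.op (QTorus.Y qVar : Tq) :=
  QTorus.liftRing_Y _ _ _ _ _ _

/-- The antiautomorphism `∗` as an additive map of `T_q` to itself. -/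
noncomputable def starLin : Tq →ₗ[ℤ] Tq :=
  ((MulOpposite.opAddEquiv (α := Tq)).symm.toAddMonoidHom.comp
    starTq.toAddMonoidHom).toIntLinearMap

theorem starLin_apply (t : Tq) : starLin t = MulOpposite.unop (starTq t) := rfl

/-- The antiautomorphism `∗` of the tensor product of two quantum tori. -/
noncomputable def starTT : TensorProduct ℤ Tq Tq →ₗ[ℤ] TensorProduct ℤ Tq Tq :=
  TensorProduct.map starLin starLin

theorem starTT_tmul (F G : Tq) : starTT (TensorProduct.tmul ℤ F G)
    = TensorProduct.tmul ℤ (starLin F) (starLin G) := rfl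

/-! ### The operators -/

/-- The shift `f ↦ f (· + s)` of functions of a complex variable. -/
def shiftOp (s : ℂ) : (Module.End ℂ (ℂ → ℂ))ˣ where
  val := LinearMap.funLeft ℂ ℂ (fun z => z + s)
  inv := LinearMap.funLeft ℂ ℂ (fun z => z - s)
  val_inv := by ext f z; simp [LinearMap.funLeft]
  inv_val := by ext f z; simp [LinearMap.funLeft]

/-- Multiplication by `e ^ (t z)`. -/
noncomputable def expOp (t : ℂ) : (Module.End ℂ (ℂ → ℂ))ˣ where
  val := LinearMap.mulLeft ℂ (fun z => Complex.exp (t * z))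
  inv := LinearMap.mulLeft ℂ (fun z => Complex.exp (-(t * z)))
  val_inv := by ext f z; simp [← mul_assoc, ← Complex.exp_add]
  inv_val := by ext f z; simp [← mul_assoc, ← Complex.exp_add]

/-- The homomorphism from `ℤ[q, q⁻¹]` to the scalar operators with `q ↦ ζ`. -/
noncomputable def scalarRep (ζ : ℂˣ) : Zq →+* Module.End ℂ (ℂ → ℂ) :=
  (algebraMap ℂ (Module.End ℂ (ℂ → ℂ))).comp (LaurentPolynomial.eval₂ (Int.castRingHom ℂ) ζ)

theorem scalarRep_comm (ζ : ℂˣ) (r : Zq) (b : Module.End ℂ (ℂ → ℂ)) :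
    scalarRep ζ r * b = b * scalarRep ζ r := Algebra.commutes
      (LaurentPolynomial.eval₂ (Int.castRingHom ℂ) ζ r) b

theorem scalarRep_q (ζ : ℂˣ) : scalarRep ζ (qVar : Zq) = algebraMap ℂ _ (ζ : ℂ) := by
  change algebraMap ℂ _ (LaurentPolynomial.eval₂ (Int.castRingHom ℂ) ζ (LaurentPolynomial.T 1)) = _
  rw [LaurentPolynomial.eval₂_T]; simp

theorem scalarRep_qinv (ζ : ℂˣ) :
    scalarRep ζ ((qVar⁻¹ : Zqˣ) : Zq) = algebraMap ℂ _ ((ζ⁻¹ : ℂˣ) : ℂ) := by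
  change algebraMap ℂ _
    (LaurentPolynomial.eval₂ (Int.castRingHom ℂ) ζ (LaurentPolynomial.T (-1))) = _
  rw [LaurentPolynomial.eval₂_T]; simp

theorem rep_rel (ζ : ℂˣ) (s t : ℂ) (h : (ζ : ℂ) ^ 2 = Complex.exp (t * s)) :
    scalarRep ζ ((qVar⁻¹ : Zqˣ) : Zq)
        * ((shiftOp s : Module.End ℂ (ℂ → ℂ)) * (expOp t : Module.End ℂ (ℂ → ℂ)))
      = scalarRep ζ (qVar : Zq)
        * ((expOp t : Module.End ℂ (ℂ → ℂ)) * (shiftOp s : Module.End ℂ (ℂ → ℂ))) := by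
  rw [scalarRep_q, scalarRep_qinv, ← Algebra.smul_def, ← Algebra.smul_def]
  apply LinearMap.ext
  intro f
  funext z
  change ((ζ⁻¹ : ℂˣ) : ℂ) * (Complex.exp (t * (z + s)) * f (z + s))
    = (ζ : ℂ) * (Complex.exp (t * z) * f (z + s))
  have hz : (ζ : ℂ) ≠ 0 := ζ.ne_zero
  rw [mul_add, Complex.exp_add, ← h, Units.val_inv_eq_inv_val]
  field_simp

/-- The representation of `T_q` on functions of a complex variable in which `X` acts by the shift
by `s`, `Y` acts as multiplication by `e ^ (t z)`, and `q` acts as `ζ`. -/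
noncomputable def torusRep (ζ : ℂˣ) (s t : ℂ) (h : (ζ : ℂ) ^ 2 = Complex.exp (t * s)) :
    Tq →+* Module.End ℂ (ℂ → ℂ) :=
  QTorus.liftRing qVar (scalarRep ζ) (scalarRep_comm ζ) (shiftOp s) (expOp t)
    (rep_rel ζ s t h)

/-- The complex number `e ^ x` as a unit. -/
noncomputable def expUnit (x : ℂ) : ℂˣ := Units.mk0 (Complex.exp x) (Complex.exp_ne_zero x)

/-- The first representation: `X f (z) = f (z + 2 π i ħ)`, `Y f (z) = e ^ z f (z)`,
`q = e ^ (π i ħ)`. -/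
noncomputable def rep (ħ : ℝ) : Tq →+* Module.End ℂ (ℂ → ℂ) :=
  torusRep (expUnit (Real.pi * Complex.I * ħ)) (2 * Real.pi * Complex.I * ħ) 1 (by
    change Complex.exp _ ^ 2 = _
    rw [← Complex.exp_nat_mul]; congr 1; push_cast; ring)

/-- The second representation: `X f (z) = f (z + 2 π i)`, `Y f (z) = e ^ (z / ħ) f (z)`,
`q^∨ = e ^ (π i / ħ)`. -/
noncomputable def repDual (ħ : ℝ) : Tq →+* Module.End ℂ (ℂ → ℂ) :=
  torusRep (expUnit (Real.pi * Complex.I / ħ)) (2 * Real.pi * Complex.I) (1 / ħ) (by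
    change Complex.exp _ ^ 2 = _
    rw [← Complex.exp_nat_mul]; congr 1; push_cast; ring)

theorem rep_X (ħ : ℝ) (f : ℂ → ℂ) (z : ℂ) :
    rep ħ (QTorus.X qVar : Tq) f z = f (z + 2 * Real.pi * Complex.I * ħ) := by
  rw [rep, torusRep, QTorus.liftRing_X]; rfl

theorem rep_Y (ħ : ℝ) (f : ℂ → ℂ) (z : ℂ) :
    rep ħ (QTorus.Y qVar : Tq) f z = Complex.exp z * f z := by
  rw [rep, torusRep, QTorus.liftRing_Y]
  change Complex.exp (1 * z) * f z = _
  rw [one_mul]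

theorem repDual_X (ħ : ℝ) (f : ℂ → ℂ) (z : ℂ) :
    repDual ħ (QTorus.X qVar : Tq) f z = f (z + 2 * Real.pi * Complex.I) := by
  rw [repDual, torusRep, QTorus.liftRing_X]; rfl

theorem repDual_Y (ħ : ℝ) (f : ℂ → ℂ) (z : ℂ) :
    repDual ħ (QTorus.Y qVar : Tq) f z = Complex.exp (z / ħ) * f z := by
  rw [repDual, torusRep, QTorus.liftRing_Y]
  change Complex.exp (1 / (ħ : ℂ) * z) * f z = _
  rw [one_div_mul_eq_div]

/-- The action of the tensor product of the two quantum tori: `A₁ ⊗ A₂` acts as the composition of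
the operators of `A₁` and `A₂`. -/
noncomputable def opTT (ħ : ℝ) : TensorProduct ℤ Tq Tq →ₗ[ℤ] Module.End ℂ (ℂ → ℂ) :=
  LinearMap.mul' ℤ (Module.End ℂ (ℂ → ℂ)) ∘ₗ
    TensorProduct.map (rep ħ).toAddMonoidHom.toIntLinearMap
      (repDual ħ).toAddMonoidHom.toIntLinearMap

theorem opTT_tmul (ħ : ℝ) (F G : Tq) :
    opTT ħ (TensorProduct.tmul ℤ F G) = rep ħ F * repDual ħ G := rfl

/-- The operator of an element of `𝐋`. -/
noncomputable def hatOp (ħ : ℝ) (A : LL) : Module.End ℂ (ℂ → ℂ) := opTT ħ (laurentLL A)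

/-- The operator of `∗A`, for `A` in `𝐋`. -/
noncomputable def hatStarOp (ħ : ℝ) (A : LL) : Module.End ℂ (ℂ → ℂ) :=
  opTT ħ (starTT (laurentLL A))

/-- The space `W` of finite linear combinations of the functions `e ^ (-a x ^ 2 / 2 + b x) P(x)`,
each of which is identified with its entire continuation. -/
noncomputable def gaussW : Submodule ℂ (ℂ → ℂ) :=
  Submodule.span ℂ {f | ∃ (a : ℝ) (b : ℂ) (P : Polynomial ℂ), 0 < a ∧
    f = fun x => Complex.exp (-(a * x ^ 2) / 2 + b * x) * P.eval x}

/-! ### The quantum dilogarithm and the operator `K` -/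

/-- The integrand of the quantum dilogarithm. -/
noncomputable def dilogIntegrand (ħ : ℝ) (z p : ℂ) : ℂ :=
  Complex.exp (-(Complex.I * p * z)) / (Complex.sinh (Real.pi * p) * Complex.sinh (Real.pi * ħ * p))
    / p

/-- The integral of `g` along the path that runs on the real line from `-∞` to `-r`, then on the
half circle of radius `r` in the upper half plane from `-r` to `r`, and then on the real line
from `r` to `+∞`. -/
noncomputable def contourIntegral (r : ℝ) (g : ℂ → ℂ) : ℂ :=
  (∫ p : ℝ in Set.Iic (-r), g p)
    + (∫ θ : ℝ in Real.pi..0,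
        g (r * Complex.exp (θ * Complex.I)) * (r * Complex.exp (θ * Complex.I) * Complex.I))
    + ∫ p : ℝ in Set.Ici r, g p

/-- The quantum dilogarithm `Φ^ħ`, with half circle of radius `r`. The value does not depend on
`r` as long as `0 < r < min (1, 1 / ħ)`, when the origin is the only pole of the integrand in the
disc of radius `r`. The integral converges for `|Im z| < π (1 + ħ)`. -/
noncomputable def qDilog (ħ r : ℝ) (z : ℂ) : ℂ :=
  Complex.exp (-(1 / 4) * contourIntegral r (dilogIntegrand ħ z))

/-- The integrand of `K f (z)`. -/
noncomputable def kernelK (ħ r : ℝ) (f : ℂ → ℂ) (z : ℂ) (x : ℝ) : ℂ :=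
  f x * qDilog ħ r x * Complex.exp (-(x * z) / (2 * Real.pi * Complex.I * ħ))

/-- The function `K f`, for every complex value of its variable. -/
noncomputable def opK (ħ r : ℝ) (f : ℂ → ℂ) (z : ℂ) : ℂ := ∫ x : ℝ, kernelK ħ r f z x

end QuantumPentagon

/-!
The proof separates analysis from algebra.

*Algebra.* The space `W` is stable under both quantum tori. The relation `K γ(A) = A K` on `W` is
compatible with sums and products of `A`, so it is enough to treat each of the two quantum tori and
generators of it. For `A = X` and `A = X⁻¹` it is the behaviour of a Fourier type integral under
multiplication of `w` by an exponential (`opK_expOp`), and for `A = Y`, with `γ(Y) = (1 + q Y) X`, it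
is `expOp_opK`. No case is needed for `Y⁻¹`, for which `γ(Y⁻¹)` is not a Laurent polynomial: if `A` and
`γ(A)` are Laurent polynomials then `Y ^ n A` involves only nonnegative powers of `Y` for large `n`, so
`Y ^ n K γ(A) w = K γ(Y ^ n A) w = Y ^ n A K w`, and `Y` acts injectively on functions
(`opK_torusRep`).

*Analysis.* The relation for `Y` is the difference equation
`Φ(x + π i ħ) = (1 + e ^ x) Φ(x - π i ħ)`, or its dual with `ħ` replaced by `1` in the shift and
`e ^ x` by `e ^ (x / ħ)`. To use it, the line of integration is moved up by half of the shift in one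
integral and down in the other, which keeps it in the strip `|Im z| < π (1 + ħ)` where the contour
integral defining `Φ` converges. Moving the line requires that `Φ` grows at most exponentially in closed
substrips. As the half circle is in the upper half plane, `Φ` is bounded for `Re z ≤ 0`; for `Re z ≥ 0`
one uses the inversion relation: `Φ(z) Φ(-z)` is a constant times `e ^ (z ^ 2 / (4 π i ħ))`, by Cauchy's
formula on the circle (`exists_dilogExponent_add_neg`, `exists_norm_qDilog_le`).

In the quotient of two shifted values of `Φ` one hyperbolic sine cancels, and the difference equation
becomes `exp (-½ ∫ e ^ (-i p x) / (p sinh (π p)) dp) = 1 + e ^ x` along the contour. The logarithmic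
derivatives agree because the Fourier transform of `1 / sinh (π p)` is computable: subtract its value at
`x = 0` to remove the pole, then compare the lines `Im p = ½` and `Im p = -½`, on which the hyperbolic
sine becomes a hyperbolic cosine (`integral_expSubOneDivSinh`). Both sides tend to `1` as `x → -∞`, by
the Riemann–Lebesgue lemma (`exp_contourIntegral_one_sinh`).

Moving the line of integration also shows that `K w` decays exponentially on the real line, hence is
square integrable (`memLp_opK`). The duality statement moves the operators one generator at a time from
`K w`, which is bounded in horizontal strips, to `v`; the class of entire functions of at most
exponential growth in strips (`StripGrowth`) is stable under the quantum tori and pairs with `W`, and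
imaginary shifts are symmetric by Cauchy's theorem (`integral_hatOp_mul_conj`).
-/

namespace QuantumPentagon

open MeasureTheory Set Filter Topology
open Complex (I)
open scoped ComplexConjugate

/-! ### Integrals over horizontal lines -/

theorem integrable_exp_neg_mul_abs {c : ℝ} (hc : 0 < c) :
    Integrable fun x : ℝ => Real.exp (-c * |x|) := by
  rw [← integrableOn_univ, ← Iic_union_Ici (a := (0 : ℝ)), integrableOn_union]
  constructor
  · refine (integrableOn_exp_mul_Iic hc 0).congr_fun (fun x hx => ?_) measurableSet_Iic
    simp [abs_of_nonpos (mem_Iic.mp hx)]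
  · refine (((integrableOn_exp_mul_Ioi (neg_lt_zero.mpr hc) 0).congr_set_ae
      Ioi_ae_eq_Ici.symm).congr_fun (fun x hx => ?_) measurableSet_Ici)
    simp [abs_of_nonneg (mem_Ici.mp hx)]

theorem continuous_line (f : ℂ → ℂ) {U : Set ℂ} (hf : ContinuousOn f U) (v : ℝ)
    (hU : ∀ x : ℝ, (x + v * I : ℂ) ∈ U) : Continuous fun x : ℝ => f (x + v * I) :=
  hf.comp_continuous (by fun_prop) hU

theorem integrable_line {f : ℂ → ℂ} {U : Set ℂ} (hf : ContinuousOn f U) {v C c : ℝ}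
    (hc : 0 < c) (hU : ∀ x : ℝ, (x + v * I : ℂ) ∈ U)
    (hb : ∀ x : ℝ, ‖f (x + v * I)‖ ≤ C * Real.exp (-c * |x|)) :
    Integrable fun x : ℝ => f (x + v * I) :=
  ((integrable_exp_neg_mul_abs hc).const_mul C).mono'
    (continuous_line f hf v hU).aestronglyMeasurable (Eventually.of_forall hb)

/-- Cauchy's theorem for a horizontal strip. -/
theorem integral_line_shift {f : ℂ → ℂ} {y C c : ℝ} (hc : 0 < c)
    (hf : DifferentiableOn ℂ f {u | u.im ∈ uIcc 0 y})
    (hb : ∀ x v : ℝ, v ∈ uIcc 0 y → ‖f (x + v * I)‖ ≤ C * Real.exp (-c * |x|)) :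
    ∫ x : ℝ, f x = ∫ x : ℝ, f (x + y * I) := by
  have hint : ∀ v ∈ uIcc 0 y, Integrable fun x : ℝ => f (x + v * I) := fun v hv =>
    integrable_line hf.continuousOn hc (by simpa using hv) fun x => hb x v hv
  have h0 := hint 0 left_mem_uIcc
  have hy := hint y right_mem_uIcc
  have t0 := intervalIntegral_tendsto_integral h0 tendsto_neg_atTop_atBot tendsto_id
  have ty := intervalIntegral_tendsto_integral hy tendsto_neg_atTop_atBot tendsto_id
  have hrect : ∀ R : ℝ, (∫ x : ℝ in (-R)..R, f (x + (0 : ℝ) * I))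
      - (∫ x : ℝ in (-R)..R, f (x + y * I))
      = I • (∫ v : ℝ in (0)..y, f ((-R : ℝ) + v * I)) - I • (∫ v : ℝ in (0)..y, f (R + v * I)) := by
    intro R
    have := Complex.integral_boundary_rect_eq_zero_of_differentiableOn f (-R : ℝ) (R + y * I)
      (hf.mono (by
        rintro u hu
        have := hu.2
        simpa using this))
    simp only [Complex.ofReal_re, Complex.ofReal_im, Complex.add_re, Complex.add_im,
      Complex.mul_re, Complex.mul_im, Complex.I_re, Complex.I_im, mul_zero, mul_one, zero_add,
      add_zero, sub_self] at this
    linear_combination this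
  have hside : ∀ s : ℝ, |s| = 1 → Tendsto (fun R : ℝ => ∫ v : ℝ in (0)..y, f ((s * R : ℝ) + v * I))
      atTop (𝓝 0) := by
    intro s hs
    have h1 : Tendsto (fun R : ℝ => C * Real.exp (-c * |R|) * |y - 0|) atTop (𝓝 0) := by
      have h3 : Tendsto (fun R : ℝ => -(c * |R|)) atTop atBot :=
        tendsto_neg_atTop_atBot.comp (tendsto_abs_atTop_atTop.const_mul_atTop hc)
      have h2 : Tendsto (fun R : ℝ => Real.exp (-c * |R|)) atTop (𝓝 0) :=
        (Real.tendsto_exp_atBot.comp h3).congr fun R => by simp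
      simpa using (h2.const_mul C).mul_const |y - 0|
    refine squeeze_zero_norm (fun R => ?_) h1
    refine intervalIntegral.norm_integral_le_of_norm_le_const fun v hv => ?_
    refine (hb (s * R) v (uIoc_subset_uIcc hv)).trans_eq ?_
    rw [abs_mul, hs, one_mul]
  have e := tendsto_nhds_unique (t0.sub ty) (by
    have := ((hside (-1) (by simp)).const_smul I).sub ((hside 1 (by simp)).const_smul I)
    simp only [neg_mul, one_mul, smul_zero, sub_zero] at this
    refine this.congr fun R => ?_
    rw [id, hrect R])
  rw [sub_eq_zero] at e
  simpa using e

/-! ### Holomorphic dependence of exponential integrals on a parameter -/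

/-- Differentiation under the integral sign. The factor `1 + |p|` makes the bound dominate both the
integrand and its derivative. -/
theorem hasDerivAt_integral_exp {α : Type*} [MeasurableSpace α] {μ : Measure α} {p ψ : α → ℂ}
    {bound : α → ℝ} {U : Set ℂ} {z : ℂ} (hU : U ∈ 𝓝 z) (hp : AEStronglyMeasurable p μ)
    (hψ : AEStronglyMeasurable ψ μ) (hbound : Integrable bound μ)
    (hb : ∀ᵐ a ∂μ, ∀ z ∈ U, ‖Complex.exp (-(I * p a * z)) * ψ a‖ * (1 + ‖p a‖) ≤ bound a) :
    Integrable (fun a => Complex.exp (-(I * p a * z)) * ψ a) μ ∧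
    Integrable (fun a => Complex.exp (-(I * p a * z)) * (-(I * p a) * ψ a)) μ ∧
    HasDerivAt (fun z => ∫ a, Complex.exp (-(I * p a * z)) * ψ a ∂μ)
      (∫ a, Complex.exp (-(I * p a * z)) * (-(I * p a) * ψ a) ∂μ) z := by
  have hm : ∀ z : ℂ, AEStronglyMeasurable (fun a => Complex.exp (-(I * p a * z))) μ := fun z =>
    (by fun_prop : Continuous fun u : ℂ => Complex.exp (-(I * u * z))).comp_aestronglyMeasurable hp
  have hint : Integrable (fun a => Complex.exp (-(I * p a * z)) * ψ a) μ := by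
    refine hbound.mono' ((hm z).mul hψ) (hb.mono fun a ha => ?_)
    refine le_trans ?_ (ha z (mem_of_mem_nhds hU))
    exact le_mul_of_one_le_right (norm_nonneg _) (by linarith [norm_nonneg (p a)])
  refine ⟨hint, hasDerivAt_integral_of_dominated_loc_of_deriv_le
    (F := fun z a => Complex.exp (-(I * p a * z)) * ψ a)
    (F' := fun z a => Complex.exp (-(I * p a * z)) * (-(I * p a) * ψ a)) hU
    (Eventually.of_forall fun z => (hm z).mul hψ) hint
    ((hm z).mul ((hp.const_mul I).neg.mul hψ)) (bound := bound) (hb.mono fun a ha u hu => ?_)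
    hbound (Eventually.of_forall fun a u _ => ?_)⟩
  · refine le_trans (le_of_eq ?_) ((mul_le_mul_of_nonneg_left
      (by linarith : ‖p a‖ ≤ 1 + ‖p a‖) (norm_nonneg _)).trans (ha u hu))
    simp only [norm_mul, norm_neg, Complex.norm_I, one_mul]
    ring
  · have h1 : HasDerivAt (fun z : ℂ => -(I * p a * z)) (-(I * p a)) u := by
      simpa [mul_assoc] using (hasDerivAt_id' u).const_mul (-(I * p a))
    exact (h1.cexp.mul_const (ψ a)).congr_deriv (by ring)

/-! ### Integrals along the contour -/

theorem norm_exp_neg_I_mul (p z : ℂ) :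
    ‖Complex.exp (-(I * p * z))‖ = Real.exp (p.re * z.im + p.im * z.re) := by
  rw [Complex.norm_exp]
  congr 1
  simp [Complex.mul_re, Complex.mul_im]

theorem one_add_le_mul_exp {δ t : ℝ} (hδ : 0 < δ) (ht : 0 ≤ t) :
    1 + t ≤ (1 + 1 / δ) * Real.exp (δ * t) := by
  have h1 : 1 ≤ Real.exp (δ * t) := Real.one_le_exp (by positivity)
  have h2 : t ≤ 1 / δ * Real.exp (δ * t) := by
    rw [one_div, ← div_eq_inv_mul, le_div_iff₀ hδ]
    linarith [Real.add_one_le_exp (δ * t)]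
  linarith

/-- The points of the real line outside `(-r, r)`, together with the whole circle of radius `r`. -/
def contourSet (r : ℝ) : Set ℂ := {p | (p.im = 0 ∧ r ≤ |p.re|) ∨ ‖p‖ = r}

theorem ofReal_mem_contourSet {r x : ℝ} (hx : r ≤ |x|) : (x : ℂ) ∈ contourSet r :=
  Or.inl ⟨by simp, by simpa using hx⟩

theorem norm_arc {r : ℝ} (hr : 0 < r) (θ : ℝ) : ‖(r * Complex.exp (θ * I) : ℂ)‖ = r := by
  rw [norm_mul, Complex.norm_exp_ofReal_mul_I, mul_one, Complex.norm_real, Real.norm_of_nonneg hr.le]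

theorem arc_mem_contourSet {r : ℝ} (hr : 0 < r) (θ : ℝ) :
    (r * Complex.exp (θ * I) : ℂ) ∈ contourSet r := Or.inr (norm_arc hr θ)

/-- A function on the contour which decays like `e ^ (-b |p|)` on the real line. -/
structure IsContourWeight (r b : ℝ) (φ : ℂ → ℂ) : Prop where
  continuousOn : ContinuousOn φ (contourSet r)
  decay : ∃ C, ∀ x : ℝ, r ≤ |x| → ‖φ x‖ ≤ C * Real.exp (-b * |x|)

namespace IsContourWeight

variable {r b : ℝ} {φ : ℂ → ℂ}

theorem nonneg_bound (hφ : IsContourWeight r b φ) :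
    ∃ C, 0 ≤ C ∧ ∀ x : ℝ, r ≤ |x| → ‖φ x‖ ≤ C * Real.exp (-b * |x|) := by
  obtain ⟨C, hC⟩ := hφ.decay
  exact ⟨max C 0, le_max_right _ _, fun x hx => (hC x hx).trans
    (mul_le_mul_of_nonneg_right (le_max_left _ _) (Real.exp_pos _).le)⟩

theorem continuous_arc (hr : 0 < r) (hφ : IsContourWeight r b φ) :
    Continuous fun θ : ℝ => φ (r * Complex.exp (θ * I)) :=
  hφ.continuousOn.comp_continuous (by fun_prop) fun θ => arc_mem_contourSet hr θ

theorem arc_bound (hr : 0 < r) (hφ : IsContourWeight r b φ) :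
    ∃ C, 0 ≤ C ∧ ∀ θ ∈ Icc 0 Real.pi, ‖φ (r * Complex.exp (θ * I))‖ ≤ C := by
  obtain ⟨C, hC⟩ := isCompact_Icc.exists_bound_of_continuousOn (hφ.continuous_arc hr).continuousOn
  exact ⟨max C 0, le_max_right _ _, fun θ hθ => (hC θ hθ).trans (le_max_left _ _)⟩

theorem aestronglyMeasurable (hφ : IsContourWeight r b φ) {S : Set ℝ} (hS : MeasurableSet S)
    (hSr : ∀ x ∈ S, r ≤ |x|) :
    AEStronglyMeasurable (fun x : ℝ => φ x) (volume.restrict S) :=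
  (hφ.continuousOn.comp (by fun_prop) fun x hx =>
    ofReal_mem_contourSet (hSr x hx)).aestronglyMeasurable hS

theorem line_bound {C b' : ℝ}
    (hC : ∀ x : ℝ, r ≤ |x| → ‖φ x‖ ≤ C * Real.exp (-b * |x|)) {x : ℝ} (hx : r ≤ |x|) {z : ℂ}
    (hz : |z.im| ≤ b') :
    ‖Complex.exp (-(I * x * z)) * φ x‖ ≤ C * Real.exp (-(b - b') * |x|) := by
  rw [norm_mul, norm_exp_neg_I_mul]
  have h1 : x * z.im ≤ b' * |x| := by
    calc x * z.im ≤ |x * z.im| := le_abs_self _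
      _ = |z.im| * |x| := by rw [abs_mul, mul_comm]
      _ ≤ b' * |x| := mul_le_mul_of_nonneg_right hz (abs_nonneg _)
  calc _ ≤ Real.exp (b' * |x|) * (C * Real.exp (-b * |x|)) := by
        refine mul_le_mul (Real.exp_le_exp.mpr (by simpa using h1)) (hC x hx) (norm_nonneg _)
          (Real.exp_pos _).le
    _ = C * Real.exp (-(b - b') * |x|) := by
        rw [mul_left_comm, ← Real.exp_add]; ring_nf

/-- The contribution of a part `S` of the real line. Half of the gap between `b` and `|Im z|` absorbs
the polynomial factor of the derivative. -/
theorem hasDerivAt_line (hφ : IsContourWeight r b φ) {S : Set ℝ} (hS : MeasurableSet S)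
    (hSr : ∀ x ∈ S, r ≤ |x|) {z : ℂ} (hz : |z.im| < b) :
    IntegrableOn (fun x : ℝ => Complex.exp (-(I * x * z)) * φ x) S ∧
    IntegrableOn (fun x : ℝ => Complex.exp (-(I * x * z)) * (-(I * x) * φ x)) S ∧
    HasDerivAt (fun z => ∫ x : ℝ in S, Complex.exp (-(I * x * z)) * φ x)
      (∫ x : ℝ in S, Complex.exp (-(I * x * z)) * (-(I * x) * φ x)) z := by
  obtain ⟨C, hC0, hC⟩ := hφ.nonneg_bound
  obtain ⟨b', hb1, hb2⟩ := exists_between hz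
  set δ := (b - b') / 2 with hδ
  have hδ0 : 0 < δ := by simp only [hδ]; linarith
  refine hasDerivAt_integral_exp (p := fun x : ℝ => (x : ℂ)) (ψ := fun x : ℝ => φ x)
    (bound := fun x => C * (1 + 1 / δ) * Real.exp (-δ * |x|))
    (U := {z | |z.im| < b'})
    ((isOpen_lt (by fun_prop) continuous_const).mem_nhds hb1)
    (by fun_prop) (hφ.aestronglyMeasurable hS hSr)
    (((integrable_exp_neg_mul_abs hδ0).const_mul _).integrableOn)
    ((ae_restrict_iff' hS).mpr (Eventually.of_forall fun x hx u hu => ?_))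
  have h1 := line_bound hC (hSr x hx) (z := u) (le_of_lt hu)
  calc _ ≤ C * Real.exp (-(b - b') * |x|) * ((1 + 1 / δ) * Real.exp (δ * |x|)) := by
        refine mul_le_mul h1 ?_ (by positivity) (by positivity)
        rw [Complex.norm_real, Real.norm_eq_abs]
        exact one_add_le_mul_exp hδ0 (abs_nonneg x)
    _ = C * (1 + 1 / δ) * (Real.exp (-(b - b') * |x|) * Real.exp (δ * |x|)) := by ring
    _ = _ := by rw [← Real.exp_add, hδ]; ring_nf

theorem hasDerivAt_arc (hr : 0 < r) (hφ : IsContourWeight r b φ) (z : ℂ) :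
    HasDerivAt (fun z => ∫ θ : ℝ in Real.pi..0,
        (Complex.exp (-(I * (r * Complex.exp (θ * I)) * z)) * φ (r * Complex.exp (θ * I)))
          * (r * Complex.exp (θ * I) * I))
      (∫ θ : ℝ in Real.pi..0,
        (Complex.exp (-(I * (r * Complex.exp (θ * I)) * z))
          * (-(I * (r * Complex.exp (θ * I))) * φ (r * Complex.exp (θ * I))))
          * (r * Complex.exp (θ * I) * I)) z := by
  obtain ⟨C, hC0, hC⟩ := hφ.arc_bound hr
  have hφc := hφ.continuous_arc hr
  have key := (hasDerivAt_integral_exp (μ := volume.restrict (Ioc 0 Real.pi))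
    (p := fun θ : ℝ => (r * Complex.exp (θ * I) : ℂ))
    (ψ := fun θ : ℝ => φ (r * Complex.exp (θ * I)) * (r * Complex.exp (θ * I) * I))
    (bound := fun _ => Real.exp (r * (‖z‖ + 1)) * (C * r) * (1 + r))
    (U := Metric.ball z 1) (z := z) (Metric.ball_mem_nhds z one_pos)
    (by fun_prop) (hφc.mul (by fun_prop)).aestronglyMeasurable (integrable_const _)
    ((ae_restrict_iff' measurableSet_Ioc).mpr (Eventually.of_forall fun θ hθ u hu => ?_))).2.2.neg
  · simp only [intervalIntegral.integral_of_ge Real.pi_pos.le, mul_assoc] at key ⊢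
    exact key
  · rw [norm_arc hr]
    refine mul_le_mul_of_nonneg_right ?_ (by positivity)
    rw [norm_mul, norm_mul, norm_mul _ I, norm_arc hr, Complex.norm_I, mul_one]
    refine mul_le_mul ?_ (mul_le_mul_of_nonneg_right (hC θ ⟨hθ.1.le, hθ.2⟩) hr.le) (by positivity)
      (Real.exp_pos _).le
    refine (Complex.norm_exp_le_exp_norm _).trans (Real.exp_le_exp.mpr ?_)
    rw [norm_neg, norm_mul, norm_mul, norm_arc hr, Complex.norm_I, one_mul]
    refine mul_le_mul_of_nonneg_left ?_ hr.le
    have h2 : ‖u - z‖ < 1 := by rwa [← dist_eq_norm]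
    linarith [norm_sub_norm_le u z]

theorem le_abs_of_mem_Iic (hr : 0 < r) : ∀ x ∈ Iic (-r), r ≤ |x| := fun x hx => by
  have : x ≤ -r := hx
  rw [abs_of_neg (by linarith)]; linarith

theorem le_abs_of_mem_Ici : ∀ x ∈ Ici r, r ≤ |x| := fun x hx => le_trans hx (le_abs_self x)

/-- The contour integral of `e ^ (-i p z) φ(p)` is holomorphic in the strip `|Im z| < b`. -/
theorem hasDerivAt (hr : 0 < r) (hφ : IsContourWeight r b φ) {z : ℂ} (hz : |z.im| < b) :
    HasDerivAt (fun z => contourIntegral r fun p => Complex.exp (-(I * p * z)) * φ p)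
      (contourIntegral r fun p => Complex.exp (-(I * p * z)) * (-(I * p) * φ p)) z :=
  ((hφ.hasDerivAt_line measurableSet_Iic (le_abs_of_mem_Iic hr) hz).2.2.add
    (hφ.hasDerivAt_arc hr z)).add (hφ.hasDerivAt_line measurableSet_Ici le_abs_of_mem_Ici hz).2.2

/-- As the half circle lies in the upper half plane, the contour integral is bounded for
`Re z ≤ 0`. -/
theorem bounded (hr : 0 < r) (hφ : IsContourWeight r b φ) {b' : ℝ} (hb' : b' < b) :
    ∃ B, ∀ z : ℂ, z.re ≤ 0 → |z.im| ≤ b' →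
      ‖contourIntegral r fun p => Complex.exp (-(I * p * z)) * φ p‖ ≤ B := by
  obtain ⟨C, hC0, hC⟩ := hφ.nonneg_bound
  obtain ⟨D, hD0, hD⟩ := hφ.arc_bound hr
  have hi : ∀ S : Set ℝ, MeasurableSet S → (∀ x ∈ S, r ≤ |x|) → ∀ z : ℂ, |z.im| ≤ b' →
      ‖∫ x : ℝ in S, Complex.exp (-(I * x * z)) * φ x‖
        ≤ ∫ x : ℝ in S, C * Real.exp (-(b - b') * |x|) := fun S hS hSr z hz =>
    norm_integral_le_of_norm_le
      (((integrable_exp_neg_mul_abs (by linarith)).const_mul _).integrableOn)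
      ((ae_restrict_iff' hS).mpr (Eventually.of_forall fun x hx =>
        line_bound hC (hSr x hx) hz))
  refine ⟨(∫ x : ℝ in Iic (-r), C * Real.exp (-(b - b') * |x|))
    + Real.exp (r * b') * D * r * |0 - Real.pi|
    + ∫ x : ℝ in Ici r, C * Real.exp (-(b - b') * |x|), fun z hz hz' => ?_⟩
  refine (norm_add₃_le).trans (add_le_add_three
    (hi _ measurableSet_Iic (le_abs_of_mem_Iic hr) z hz') ?_
    (hi _ measurableSet_Ici le_abs_of_mem_Ici z hz'))
  refine intervalIntegral.norm_integral_le_of_norm_le_const fun θ hθ => ?_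
  rw [uIoc_of_ge Real.pi_pos.le] at hθ
  rw [norm_mul, norm_mul, norm_mul _ I, norm_arc hr, Complex.norm_I, mul_one, norm_exp_neg_I_mul]
  refine mul_le_mul_of_nonneg_right (mul_le_mul (Real.exp_le_exp.mpr ?_) (hD θ ⟨hθ.1.le, hθ.2⟩)
    (norm_nonneg _) (Real.exp_pos _).le) hr.le
  have hre : (r * Complex.exp (θ * I) : ℂ).re = r * Real.cos θ := by
    rw [Complex.re_ofReal_mul, Complex.exp_ofReal_mul_I_re]
  have him : (r * Complex.exp (θ * I) : ℂ).im = r * Real.sin θ := by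
    rw [Complex.im_ofReal_mul, Complex.exp_ofReal_mul_I_im]
  have h1 : r * Real.sin θ * z.re ≤ 0 := mul_nonpos_of_nonneg_of_nonpos
    (mul_nonneg hr.le (Real.sin_nonneg_of_nonneg_of_le_pi hθ.1.le hθ.2)) hz
  have h2 : Real.cos θ * z.im ≤ b' := by
    calc Real.cos θ * z.im ≤ |Real.cos θ * z.im| := le_abs_self _
      _ = |Real.cos θ| * |z.im| := abs_mul _ _
      _ ≤ 1 * |z.im| := mul_le_mul_of_nonneg_right (Real.abs_cos_le_one θ) (abs_nonneg _)
      _ ≤ b' := by linarith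
  have h3 := mul_le_mul_of_nonneg_left h2 hr.le
  rw [hre, him]
  linarith

end IsContourWeight

/-- All three pieces of the contour integral of `g` converge absolutely. -/
structure ContourIntegrable (r : ℝ) (g : ℂ → ℂ) : Prop where
  left : IntegrableOn (fun x : ℝ => g x) (Iic (-r))
  arc : IntervalIntegrable (fun θ : ℝ =>
    g (r * Complex.exp (θ * I)) * (r * Complex.exp (θ * I) * I)) volume Real.pi 0
  right : IntegrableOn (fun x : ℝ => g x) (Ici r)

namespace ContourIntegrable

variable {r : ℝ} {g h : ℂ → ℂ}

theorem integral_add (hg : ContourIntegrable r g) (hh : ContourIntegrable r h) :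
    contourIntegral r (fun p => g p + h p) = contourIntegral r g + contourIntegral r h := by
  unfold contourIntegral
  simp only [add_mul]
  rw [MeasureTheory.integral_add hg.left hh.left, MeasureTheory.integral_add hg.right hh.right,
    intervalIntegral.integral_add hg.arc hh.arc]
  ring

theorem integral_sub (hg : ContourIntegrable r g) (hh : ContourIntegrable r h) :
    contourIntegral r (fun p => g p - h p) = contourIntegral r g - contourIntegral r h := by
  unfold contourIntegral
  simp only [sub_mul]
  rw [MeasureTheory.integral_sub hg.left hh.left, MeasureTheory.integral_sub hg.right hh.right,
    intervalIntegral.integral_sub hg.arc hh.arc]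
  ring

end ContourIntegrable

theorem contourIntegral_const_mul (r : ℝ) (c : ℂ) (g : ℂ → ℂ) :
    contourIntegral r (fun p => c * g p) = c * contourIntegral r g := by
  unfold contourIntegral
  simp only [mul_assoc c]
  rw [integral_const_mul, integral_const_mul, intervalIntegral.integral_const_mul]
  ring

theorem contourIntegral_congr {r : ℝ} (hr : 0 < r) {g h : ℂ → ℂ}
    (hgh : ∀ p ∈ contourSet r, g p = h p) : contourIntegral r g = contourIntegral r h := by
  unfold contourIntegral
  rw [setIntegral_congr_fun measurableSet_Iic fun (x : ℝ) hx => hgh x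
      (ofReal_mem_contourSet (IsContourWeight.le_abs_of_mem_Iic hr x hx)),
    setIntegral_congr_fun measurableSet_Ici fun (x : ℝ) hx => hgh x
      (ofReal_mem_contourSet (IsContourWeight.le_abs_of_mem_Ici x hx))]
  simp only [hgh _ (arc_mem_contourSet hr _)]

theorem ne_zero_of_mem_contourSet {r : ℝ} (hr : 0 < r) {p : ℂ} (hp : p ∈ contourSet r) :
    p ≠ 0 := by
  rintro rfl
  rcases hp with ⟨-, h⟩ | h <;> simp at h <;> linarith

/-- For an odd function the two half lines cancel, and the half circle contributes half of the
full circle, which it follows clockwise. -/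
theorem contourIntegral_of_odd {r : ℝ} (hr : 0 < r) {g : ℂ → ℂ} (hg : ∀ p, g (-p) = -g p)
    (hc : ContinuousOn g (Metric.sphere 0 r)) :
    contourIntegral r g = -(1 / 2) * ∮ p in C(0, r), g p := by
  have h1 : ∫ x : ℝ in Iic (-r), g x = -∫ x : ℝ in Ici r, g x := by
    have := integral_comp_neg_Iic (-r) fun x : ℝ => g x
    rw [neg_neg] at this
    rw [integral_Ici_eq_integral_Ioi, ← this, ← integral_neg]
    simp [hg]
  have hcont : Continuous fun θ : ℝ => g (r * Complex.exp (θ * I)) * (r * Complex.exp (θ * I) * I) :=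
    (hc.comp_continuous (by fun_prop) fun θ => by simp [norm_arc hr, -Complex.norm_mul]).mul
      (by fun_prop)
  have h2 : ∮ p in C(0, r), g p = ∫ θ : ℝ in (0)..2 * Real.pi,
      g (r * Complex.exp (θ * I)) * (r * Complex.exp (θ * I) * I) := by
    simp [circleIntegral, circleMap, mul_comm]
  have h3 : ∫ θ : ℝ in Real.pi..2 * Real.pi,
        g (r * Complex.exp (θ * I)) * (r * Complex.exp (θ * I) * I)
      = ∫ θ : ℝ in (0)..Real.pi,
        g (r * Complex.exp (θ * I)) * (r * Complex.exp (θ * I) * I) := by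
    have := intervalIntegral.integral_comp_add_right (a := 0) (b := Real.pi) (fun θ : ℝ =>
      g (r * Complex.exp (θ * I)) * (r * Complex.exp (θ * I) * I)) Real.pi
    rw [zero_add, ← two_mul] at this
    rw [← this]
    refine intervalIntegral.integral_congr fun θ _ => ?_
    have : (r * Complex.exp ((θ + Real.pi : ℝ) * I) : ℂ) = -(r * Complex.exp (θ * I)) := by
      rw [Complex.ofReal_add, add_mul, Complex.exp_add, Complex.exp_pi_mul_I]; ring
    simp only [this, hg]
    ring
  have h4 := intervalIntegral.integral_add_adjacent_intervals
    (hcont.intervalIntegrable (μ := volume) 0 Real.pi)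
    (hcont.intervalIntegrable (μ := volume) Real.pi (2 * Real.pi))
  rw [h3] at h4
  rw [contourIntegral, h1, h2, ← h4, intervalIntegral.integral_symm 0 Real.pi]
  ring

/-- If `g` has no singularity in the disc then the contour can be replaced by the real line. -/
theorem contourIntegral_of_differentiableOn_ball {r : ℝ} (hr : 0 < r) (hr₁ : r < 1) {g : ℂ → ℂ}
    (hg : DifferentiableOn ℂ g (Metric.ball 0 1)) (hi : Integrable fun x : ℝ => g x) :
    contourIntegral r g = ∫ x : ℝ, g x := by
  obtain ⟨F, hF⟩ := hg.isExactOn_ball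
  have harc : ∫ θ : ℝ in Real.pi..0, g (r * Complex.exp (θ * I)) * (r * Complex.exp (θ * I) * I)
      = F r - F (-r) := by
    have hd : ∀ θ ∈ uIcc Real.pi 0, HasDerivAt (fun θ : ℝ => F (r * Complex.exp (θ * I)))
        (g (r * Complex.exp (θ * I)) * (r * Complex.exp (θ * I) * I)) θ := by
      intro θ _
      have h1 : HasDerivAt (fun θ : ℝ => (r * Complex.exp (θ * I) : ℂ))
          (r * Complex.exp (θ * I) * I) θ := by
        have := (((hasDerivAt_id (θ : ℂ)).mul_const I).cexp.const_mul (r : ℂ)).comp_ofReal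
        simpa [mul_assoc] using this
      refine (hF _ ?_).comp θ h1
      simpa [norm_arc hr, -Complex.norm_mul] using hr₁
    have hc : Continuous fun θ : ℝ =>
        g (r * Complex.exp (θ * I)) * (r * Complex.exp (θ * I) * I) :=
      (hg.continuousOn.comp_continuous (by fun_prop) fun θ => by
        simpa [norm_arc hr, -Complex.norm_mul] using hr₁).mul (by fun_prop)
    rw [intervalIntegral.integral_eq_sub_of_hasDerivAt hd (hc.intervalIntegrable _ _)]
    simp [Complex.exp_pi_mul_I]
  have hseg : ∫ x : ℝ in (-r)..r, g x = F r - F (-r) := by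
    rw [intervalIntegral.integral_eq_sub_of_hasDerivAt (f := fun x : ℝ => F x)
      (fun x hx => (hF x ?_).comp_ofReal) hi.intervalIntegrable]
    · simp
    · rw [uIcc_of_le (by linarith)] at hx
      simpa [abs_lt] using ⟨by linarith [hx.1], by linarith [hx.2]⟩
  rw [contourIntegral, harc, ← hseg, integral_Ici_eq_integral_Ioi,
    ← intervalIntegral.integral_Iic_sub_Iic hi.integrableOn hi.integrableOn, add_sub_cancel]
  exact intervalIntegral.integral_Iic_add_Ioi hi.integrableOn hi.integrableOn

namespace IsContourWeight

variable {r b : ℝ} {φ : ℂ → ℂ}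

theorem contourIntegrable (hr : 0 < r) (hφ : IsContourWeight r b φ) {z : ℂ} (hz : |z.im| < b) :
    ContourIntegrable r fun p => Complex.exp (-(I * p * z)) * φ p where
  left := (hφ.hasDerivAt_line measurableSet_Iic (le_abs_of_mem_Iic hr) hz).1
  right := (hφ.hasDerivAt_line measurableSet_Ici le_abs_of_mem_Ici hz).1
  arc := by
    have hφc := hφ.continuous_arc hr
    have hP : Continuous fun θ : ℝ => (r * Complex.exp (θ * I) : ℂ) := by fun_prop
    exact ((((by fun_prop : Continuous fun p : ℂ => Complex.exp (-(I * p * z))).comp hP).mul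
      hφc).mul (hP.mul_const I)).intervalIntegrable _ _

theorem mul {b' : ℝ} {ψ : ℂ → ℂ} (hφ : IsContourWeight r b φ) (hψ : IsContourWeight r b' ψ) :
    IsContourWeight r (b + b') fun p => φ p * ψ p where
  continuousOn := hφ.continuousOn.mul hψ.continuousOn
  decay := by
    obtain ⟨C, hC0, hC⟩ := hφ.nonneg_bound
    obtain ⟨D, hD0, hD⟩ := hψ.nonneg_bound
    refine ⟨C * D, fun x hx => ?_⟩
    rw [norm_mul]
    refine (mul_le_mul (hC x hx) (hD x hx) (norm_nonneg _) (by positivity)).trans_eq ?_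
    rw [neg_add, add_mul, Real.exp_add]; ring

theorem inv_self (hr : 0 < r) : IsContourWeight r 0 fun p => p⁻¹ where
  continuousOn := continuousOn_inv₀.mono fun _ hp => ne_zero_of_mem_contourSet hr hp
  decay := ⟨r⁻¹, fun x hx => by
    simpa using inv_anti₀ hr hx⟩

/-- The Riemann–Lebesgue lemma on the half lines, and exponential decay on the open half circle. -/
theorem tendsto_atBot (hr : 0 < r) (hφ : IsContourWeight r b φ) :
    Tendsto (fun x : ℝ => contourIntegral r fun p => Complex.exp (-(I * p * x)) * φ p)
      atBot (𝓝 0) := by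
  have hline : ∀ S : Set ℝ, MeasurableSet S →
      Tendsto (fun x : ℝ => ∫ p : ℝ in S, Complex.exp (-(I * p * x)) * φ p) atBot (𝓝 0) := by
    intro S hS
    have hRL := Real.tendsto_integral_exp_smul_cocompact (indicator S fun p : ℝ => φ p)
    have hw : Tendsto (fun x : ℝ => x / (2 * Real.pi)) atBot (cocompact ℝ) :=
      (tendsto_id.atBot_div_const (by positivity)).mono_right atBot_le_cocompact
    refine (hRL.comp hw).congr fun x => ?_
    rw [← integral_indicator hS]
    refine integral_congr_ae (Eventually.of_forall fun p => ?_)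
    by_cases hp : p ∈ S
    · simp only [indicator_of_mem hp, Circle.smul_def, Real.fourierChar_apply, smul_eq_mul]
      congr 2
      have : (Real.pi : ℂ) ≠ 0 := by exact_mod_cast Real.pi_ne_zero
      push_cast
      field_simp
    · simp [indicator_of_notMem hp]
  have harc : Tendsto (fun x : ℝ => ∫ θ : ℝ in Real.pi..0,
      (Complex.exp (-(I * (r * Complex.exp (θ * I)) * x)) * φ (r * Complex.exp (θ * I)))
        * (r * Complex.exp (θ * I) * I)) atBot (𝓝 0) := by
    obtain ⟨C, hC0, hC⟩ := hφ.arc_bound hr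
    have hφc := hφ.continuous_arc hr
    have hP : Continuous fun θ : ℝ => (r * Complex.exp (θ * I) : ℂ) := by fun_prop
    have hnorm : ∀ x θ : ℝ, ‖(Complex.exp (-(I * (r * Complex.exp (θ * I)) * x))
        * φ (r * Complex.exp (θ * I))) * (r * Complex.exp (θ * I) * I)‖
        = Real.exp (r * Real.sin θ * x) * ‖φ (r * Complex.exp (θ * I))‖ * r := by
      intro x θ
      rw [norm_mul, norm_mul, norm_mul _ I, norm_arc hr, Complex.norm_I, mul_one,
        norm_exp_neg_I_mul, Complex.im_ofReal_mul, Complex.exp_ofReal_mul_I_im]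
      simp
    have key := tendsto_integral_filter_of_dominated_convergence (l := atBot)
      (μ := volume.restrict (Ioo 0 Real.pi))
      (F := fun (x θ : ℝ) => (Complex.exp (-(I * (r * Complex.exp (θ * I)) * x))
        * φ (r * Complex.exp (θ * I))) * (r * Complex.exp (θ * I) * I))
      (f := fun _ => 0) (fun _ => C * r)
      (Eventually.of_forall fun x =>
        ((((by fun_prop : Continuous fun p : ℂ => Complex.exp (-(I * p * x))).comp hP).mul
          hφc).mul (hP.mul_const I)).aestronglyMeasurable)
      ((eventually_le_atBot 0).mono fun x hx => (ae_restrict_iff' measurableSet_Ioo).mpr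
        (Eventually.of_forall fun θ hθ => ?_))
      (integrable_const _)
      ((ae_restrict_iff' measurableSet_Ioo).mpr (Eventually.of_forall fun θ hθ => ?_))
    · rw [integral_zero] at key
      have := key.neg
      rw [neg_zero] at this
      refine this.congr fun x => ?_
      rw [intervalIntegral.integral_of_ge Real.pi_pos.le, integral_Ioc_eq_integral_Ioo]
    · rw [hnorm]
      have hs := Real.sin_nonneg_of_nonneg_of_le_pi hθ.1.le hθ.2.le
      have h1 : Real.exp (r * Real.sin θ * x) ≤ 1 := Real.exp_le_one_iff.mpr
        (mul_nonpos_of_nonneg_of_nonpos (by positivity) hx)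
      have h2 := mul_le_mul h1 (hC θ ⟨hθ.1.le, hθ.2.le⟩) (norm_nonneg _) zero_le_one
      rw [one_mul] at h2
      exact mul_le_mul_of_nonneg_right h2 hr.le
    · rw [tendsto_zero_iff_norm_tendsto_zero]
      simp only [hnorm]
      have hs := Real.sin_pos_of_pos_of_lt_pi hθ.1 hθ.2
      have h1 : Tendsto (fun x : ℝ => Real.exp (r * Real.sin θ * x)) atBot (𝓝 0) :=
        Real.tendsto_exp_atBot.comp (tendsto_id.const_mul_atBot (by positivity))
      simpa using (h1.mul_const ‖φ (r * Complex.exp (θ * I))‖).mul_const r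
  simpa [contourIntegral] using ((hline _ measurableSet_Iic).add harc).add (hline _ measurableSet_Ici)

end IsContourWeight

/-! ### The Fourier transform of the reciprocal of the hyperbolic sine -/

theorem sinh_ne_zero_of_abs_im_lt {u : ℂ} (hu : u ≠ 0) (hi : |u.im| < Real.pi) :
    Complex.sinh u ≠ 0 := by
  intro h
  have h1 : Complex.sin (u * I) = 0 := by rw [Complex.sin_mul_I, h, zero_mul]
  obtain ⟨n, hn⟩ := Complex.sin_eq_zero_iff.mp h1
  have hre := congrArg Complex.re hn
  have him := congrArg Complex.im hn
  simp at hre him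
  have hn0 : n = 0 := by
    by_contra hne
    have h2 : (1 : ℝ) ≤ |(n : ℝ)| := by exact_mod_cast Int.one_le_abs hne
    have h3 : |u.im| = |(n : ℝ)| * Real.pi := by
      rw [← abs_neg, hre, abs_mul, abs_of_pos Real.pi_pos]
    nlinarith [Real.pi_pos]
  subst hn0
  apply hu
  apply Complex.ext <;> simp [him]
  simpa using hre

/-- Away from the imaginary axis, `|sinh u|` is at least a multiple of `e ^ |Re u|`. -/
theorem exists_le_norm_sinh {t : ℝ} (ht : 0 < t) :
    ∃ κ : ℝ, 0 < κ ∧ ∀ u : ℂ, t ≤ |u.re| → κ * Real.exp |u.re| ≤ ‖Complex.sinh u‖ := by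
  have hlt : Real.exp (-(2 * t)) < 1 := Real.exp_lt_one_iff.mpr (by linarith)
  refine ⟨(1 - Real.exp (-(2 * t))) / 2, by linarith, fun u hu => ?_⟩
  have h1 : ‖Complex.sinh u‖ = ‖Complex.exp u - Complex.exp (-u)‖ / 2 := by
    rw [Complex.sinh, norm_div]; simp
  have h2 : Real.exp |u.re| - Real.exp (-|u.re|) ≤ ‖Complex.exp u - Complex.exp (-u)‖ := by
    refine le_trans ?_ (abs_norm_sub_norm_le _ _)
    rw [Complex.norm_exp, Complex.norm_exp, Complex.neg_re]
    rcases abs_cases u.re with ⟨h, -⟩ | ⟨h, -⟩ <;> rw [h]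
    · exact le_abs_self _
    · rw [neg_neg]
      exact (le_abs_self _).trans_eq (abs_sub_comm _ _)
  have h3 : Real.exp (-|u.re|) ≤ Real.exp (-(2 * t)) * Real.exp |u.re| := by
    rw [← Real.exp_add]; exact Real.exp_le_exp.mpr (by linarith)
  rw [h1]; linarith

theorem isContourWeight_inv_sinh {r a : ℝ} (hr : 0 < r) (ha : 0 < a) (har : a * r < Real.pi) :
    IsContourWeight r a fun p => (Complex.sinh (a * p))⁻¹ where
  continuousOn := by
    refine ContinuousOn.inv₀ (by fun_prop) fun p hp => sinh_ne_zero_of_abs_im_lt ?_ ?_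
    · exact mul_ne_zero (by exact_mod_cast ha.ne') (ne_zero_of_mem_contourSet hr hp)
    · rw [Complex.im_ofReal_mul, abs_mul, abs_of_pos ha]
      rcases hp with ⟨h, -⟩ | h
      · simpa [h] using Real.pi_pos
      · refine lt_of_le_of_lt (mul_le_mul_of_nonneg_left ?_ ha.le) har
        rw [← h]; exact Complex.abs_im_le_norm p
  decay := by
    obtain ⟨κ, hκ, h⟩ := exists_le_norm_sinh (mul_pos ha hr)
    refine ⟨κ⁻¹, fun x hx => ?_⟩
    have hre : |((a : ℂ) * x).re| = a * |x| := by
      rw [Complex.re_ofReal_mul, Complex.ofReal_re, abs_mul, abs_of_pos ha]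
    have h1 := h (a * x) (by rw [hre]; exact mul_le_mul_of_nonneg_left hx ha.le)
    rw [hre] at h1
    rw [norm_inv, neg_mul, Real.exp_neg, ← mul_inv]
    exact inv_anti₀ (by positivity) h1

/-- The entire function `sinh (a p) / p`, with the value `a` at the origin. -/
noncomputable def sinhQuot (a : ℝ) : ℂ → ℂ := dslope (fun p : ℂ => Complex.sinh (a * p)) 0

theorem sinhQuot_of_ne (a : ℝ) {p : ℂ} (hp : p ≠ 0) :
    sinhQuot a p = Complex.sinh (a * p) / p := by
  rw [sinhQuot, dslope_of_ne _ hp, slope_def_field]; simp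

theorem sinhQuot_zero (a : ℝ) : sinhQuot a 0 = a := by
  rw [sinhQuot, dslope_same]
  have := ((hasDerivAt_id' (0 : ℂ)).const_mul (a : ℂ)).csinh
  simpa using this.deriv

theorem differentiable_dslope {f : ℂ → ℂ} (hf : Differentiable ℂ f) (c : ℂ) :
    Differentiable ℂ (dslope f c) := by
  rw [← differentiableOn_univ]
  exact (Complex.differentiableOn_dslope univ_mem).mpr hf.differentiableOn

theorem differentiable_sinhQuot (a : ℝ) : Differentiable ℂ (sinhQuot a) :=
  differentiable_dslope (by fun_prop) 0

theorem sinhQuot_ne_zero {a : ℝ} (ha : 0 < a) {p : ℂ} (hp : a * |p.im| < Real.pi) :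
    sinhQuot a p ≠ 0 := by
  have ha' : (a : ℂ) ≠ 0 := by exact_mod_cast ha.ne'
  by_cases h : p = 0
  · rw [h, sinhQuot_zero]; exact ha'
  · rw [sinhQuot_of_ne a h]
    refine div_ne_zero (sinh_ne_zero_of_abs_im_lt (mul_ne_zero ha' h) ?_) h
    rwa [Complex.im_ofReal_mul, abs_mul, abs_of_pos ha]

theorem inv_cosh_le (x : ℝ) : (Real.cosh x)⁻¹ ≤ 2 * Real.exp (-|x|) := by
  rw [← Real.cosh_abs, Real.cosh_eq, inv_div, Real.exp_neg |x|, ← div_eq_mul_inv]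
  exact div_le_div_of_nonneg_left (by norm_num) (Real.exp_pos _)
    (le_add_of_nonneg_right (inv_nonneg.mpr (Real.exp_pos _).le))

theorem integrable_inv_cosh : Integrable fun x : ℝ => (Real.cosh (Real.pi * x))⁻¹ := by
  refine ((integrable_exp_neg_mul_abs Real.pi_pos).const_mul 2).mono'
    (Continuous.aestronglyMeasurable ?_) (Eventually.of_forall fun x => ?_)
  · exact Continuous.inv₀ (by fun_prop) fun x => (Real.cosh_pos _).ne'
  · rw [Real.norm_of_nonneg (inv_nonneg.mpr (Real.cosh_pos _).le)]
    refine (inv_cosh_le _).trans_eq ?_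
    rw [abs_mul, abs_of_pos Real.pi_pos, neg_mul]

theorem integral_inv_cosh : ∫ x : ℝ, (Real.cosh (Real.pi * x))⁻¹ = 1 := by
  have hpi := Real.pi_pos
  have hd : ∀ x : ℝ, HasDerivAt (fun x => Real.pi⁻¹ * Real.arctan (Real.sinh (Real.pi * x)))
      (Real.cosh (Real.pi * x))⁻¹ x := by
    intro x
    have h1 := ((((hasDerivAt_id' x).const_mul Real.pi).sinh).arctan).const_mul Real.pi⁻¹
    refine h1.congr_deriv ?_
    have h2 := Real.cosh_sq (Real.pi * x)
    have h3 := (Real.cosh_pos (Real.pi * x)).ne'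
    rw [show 1 + Real.sinh (Real.pi * x) ^ 2 = Real.cosh (Real.pi * x) ^ 2 by rw [h2]; ring]
    field_simp
  have htop : Tendsto (fun x => Real.pi⁻¹ * Real.arctan (Real.sinh (Real.pi * x))) atTop
      (𝓝 (Real.pi⁻¹ * (Real.pi / 2))) := by
    refine Tendsto.const_mul _ ?_
    refine (Real.tendsto_arctan_atTop.mono_right nhdsWithin_le_nhds).comp
      (Real.sinhOrderIso.tendsto_atTop.comp (tendsto_id.const_mul_atTop hpi))
  have hbot : Tendsto (fun x => Real.pi⁻¹ * Real.arctan (Real.sinh (Real.pi * x))) atBot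
      (𝓝 (Real.pi⁻¹ * -(Real.pi / 2))) := by
    refine Tendsto.const_mul _ ?_
    refine (Real.tendsto_arctan_atBot.mono_right nhdsWithin_le_nhds).comp
      (Real.sinhOrderIso.tendsto_atBot.comp (tendsto_id.const_mul_atBot hpi))
  rw [integral_of_hasDerivAt_of_tendsto hd integrable_inv_cosh hbot htop]
  field_simp
  norm_num

/-- The function `(e ^ (-i p x) - 1) / sinh (π p)`, without its removable singularity. -/
noncomputable def expSubOneDivSinh (x : ℝ) (p : ℂ) : ℂ :=
  dslope (fun p : ℂ => Complex.exp (-(I * p * x))) 0 p / sinhQuot Real.pi p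

theorem expSubOneDivSinh_of_ne (x : ℝ) {p : ℂ} (hp : p ≠ 0) :
    expSubOneDivSinh x p = (Complex.exp (-(I * p * x)) - 1) * (Complex.sinh (Real.pi * p))⁻¹ := by
  rw [expSubOneDivSinh, dslope_of_ne _ hp, slope_def_field, sinhQuot_of_ne _ hp]
  simp only [sub_zero, mul_zero, zero_mul, neg_zero, Complex.exp_zero]
  rw [div_div_div_cancel_right₀ hp, div_eq_mul_inv]

theorem differentiableOn_expSubOneDivSinh (x : ℝ) :
    DifferentiableOn ℂ (expSubOneDivSinh x) {p | |p.im| < 1} := by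
  refine (differentiable_dslope (by fun_prop) 0).differentiableOn.div
    (differentiable_sinhQuot _).differentiableOn fun p hp => sinhQuot_ne_zero Real.pi_pos ?_
  have : |p.im| < 1 := hp
  nlinarith [Real.pi_pos]

/-- Near the origin the bound comes from compactness, elsewhere from the growth of `sinh`. -/
theorem expSubOneDivSinh_bound (x : ℝ) :
    ∃ C, ∀ t v : ℝ, |v| ≤ 1 / 2 →
      ‖expSubOneDivSinh x (t + v * I)‖ ≤ C * Real.exp (-Real.pi * |t|) := by
  have hpi := Real.pi_pos
  have hK : IsCompact ((Icc (-1 : ℝ) 1) ×ℂ (Icc (-(1 / 2) : ℝ) (1 / 2))) :=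
    isCompact_Icc.reProdIm isCompact_Icc
  obtain ⟨D, hD⟩ := hK.exists_bound_of_continuousOn
    ((differentiableOn_expSubOneDivSinh x).continuousOn.mono fun p hp => by
      have := hp.2
      simp only [mem_preimage, mem_Icc] at this
      change |p.im| < 1
      rw [abs_lt]; constructor <;> linarith)
  obtain ⟨κ, hκ, h⟩ := exists_le_norm_sinh hpi
  refine ⟨max (D * Real.exp Real.pi) ((Real.exp |x| + 1) * κ⁻¹), fun t v hv => ?_⟩
  rcases le_total |t| 1 with ht | ht
  · have h1 := hD (t + v * I) (by
      rw [abs_le] at ht hv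
      exact ⟨by simpa using ht, by simpa [-one_div] using hv⟩)
    have hD0 : 0 ≤ D := (norm_nonneg _).trans h1
    calc _ ≤ D := h1
      _ ≤ D * (Real.exp Real.pi * Real.exp (-Real.pi * |t|)) := by
        rw [← Real.exp_add]
        exact le_mul_of_one_le_right hD0 (Real.one_le_exp (by nlinarith))
      _ = D * Real.exp Real.pi * Real.exp (-Real.pi * |t|) := by ring
      _ ≤ _ := mul_le_mul_of_nonneg_right (le_max_left _ _) (Real.exp_pos _).le
  · have hne : (t + v * I : ℂ) ≠ 0 := by
      intro h0
      have := congrArg Complex.re h0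
      simp at this
      rw [this] at ht; norm_num at ht
    have hre : |((Real.pi : ℂ) * (t + v * I)).re| = Real.pi * |t| := by
      rw [Complex.re_ofReal_mul]; simp [abs_mul, abs_of_pos hpi]
    have h1 := h (Real.pi * (t + v * I)) (by rw [hre]; nlinarith)
    rw [hre] at h1
    rw [expSubOneDivSinh_of_ne x hne, norm_mul, norm_inv]
    refine le_trans (mul_le_mul (?_ : _ ≤ Real.exp |x| + 1) (inv_anti₀ (by positivity) h1)
      (inv_nonneg.mpr (norm_nonneg _)) (by positivity)) ?_
    · refine (norm_sub_le _ _).trans (add_le_add ?_ (by simp))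
      rw [norm_exp_neg_I_mul]
      refine Real.exp_le_exp.mpr ?_
      simp only [Complex.add_im, Complex.ofReal_im, Complex.mul_im, Complex.ofReal_re,
        Complex.I_im, mul_one, Complex.I_re, mul_zero, add_zero, zero_add]
      calc v * x ≤ |v * x| := le_abs_self _
        _ = |v| * |x| := abs_mul _ _
        _ ≤ 1 * |x| := mul_le_mul_of_nonneg_right (by linarith) (abs_nonneg _)
        _ = |x| := one_mul _
    · rw [mul_inv, ← Real.exp_neg, ← mul_assoc, neg_mul]
      exact mul_le_mul_of_nonneg_right (le_max_right _ _) (Real.exp_pos _).le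

/-- The integral over the line `Im p = s / 2` with `s = ±1`, where `sinh (π p)` is
`s i cosh (π Re p)`. -/
theorem integral_expSubOneDivSinh_shift (x s : ℝ) (hs : |s| = 1) :
    ∫ t : ℝ, expSubOneDivSinh x t = -(s * I) * (Complex.exp (s * x / 2)
      * (∫ t : ℝ, Complex.exp (-(I * t * x)) * ((Real.cosh (Real.pi * t))⁻¹ : ℝ)) - 1) := by
  obtain ⟨C, hC⟩ := expSubOneDivSinh_bound x
  have hv : ∀ v ∈ uIcc 0 (s / 2), |v| ≤ 1 / 2 := by
    intro v hv
    have := abs_sub_left_of_mem_uIcc hv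
    rw [sub_zero, sub_zero, abs_div, hs] at this
    simpa using this
  rw [integral_line_shift Real.pi_pos (y := s / 2) (C := C)
    ((differentiableOn_expSubOneDivSinh x).mono fun p hp => by
      have := hv _ hp
      change |p.im| < 1
      linarith) fun t v hv' => hC t v (hv v hv')]
  have hi : Integrable fun t : ℝ => ((Real.cosh (Real.pi * t))⁻¹ : ℝ) := integrable_inv_cosh
  have hic : Integrable fun t : ℝ => (((Real.cosh (Real.pi * t))⁻¹ : ℝ) : ℂ) := hi.ofReal
  have hi2 : Integrable fun t : ℝ =>
      Complex.exp (-(I * t * x)) * (((Real.cosh (Real.pi * t))⁻¹ : ℝ) : ℂ) := by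
    refine hic.bdd_mul (c := 1) (Continuous.aestronglyMeasurable (by fun_prop))
      (Eventually.of_forall fun t => ?_)
    rw [norm_exp_neg_I_mul]; simp
  have h1 : (∫ t : ℝ, (((Real.cosh (Real.pi * t))⁻¹ : ℝ) : ℂ)) = 1 := by
    rw [integral_complex_ofReal, integral_inv_cosh]; simp
  rw [← h1, ← integral_const_mul, ← integral_sub (hi2.const_mul _) hic, ← integral_const_mul]
  refine integral_congr_ae (Eventually.of_forall fun t => ?_)
  have hne : ((t : ℂ) + (s / 2 : ℝ) * I) ≠ 0 := by
    intro h0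
    have := congrArg Complex.im h0
    simp at this
    rw [this] at hs; simp at hs
  have hsinh : Complex.sinh (Real.pi * (t + (s / 2 : ℝ) * I))
      = s * I * (Real.cosh (Real.pi * t) : ℝ) := by
    have e1 : (Real.pi * (t + (s / 2 : ℝ) * I) : ℂ)
        = (Real.pi * t : ℝ) + (s * (Real.pi / 2) : ℝ) * I := by push_cast; ring
    rw [e1, Complex.sinh_add, Complex.cosh_mul_I, Complex.sinh_mul_I, ← Complex.ofReal_cos,
      ← Complex.ofReal_sin]
    have hs' : s = 1 ∨ s = -1 := eq_or_eq_neg_of_abs_eq hs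
    rcases hs' with rfl | rfl <;> simp [mul_comm]
  have hexp : Complex.exp (-(I * (t + (s / 2 : ℝ) * I) * x))
      = Complex.exp (s * x / 2) * Complex.exp (-(I * t * x)) := by
    rw [← Complex.exp_add]
    congr 1
    push_cast
    linear_combination (-(s * x / 2 : ℂ)) * Complex.I_mul_I
  have hsi : (s * I : ℂ)⁻¹ = -(s * I) := by
    have hs' : s = 1 ∨ s = -1 := eq_or_eq_neg_of_abs_eq hs
    rcases hs' with rfl | rfl <;> simp
  simp only
  rw [expSubOneDivSinh_of_ne x hne, hexp, hsinh, mul_inv, hsi]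
  push_cast
  ring

/-- The two lines `Im p = ±1 / 2` give two expressions of the integral through the Fourier transform
of `1 / cosh (π p)`, and together they determine both. -/
theorem integral_expSubOneDivSinh (x : ℝ) :
    ∫ t : ℝ, expSubOneDivSinh x t
      = I - 2 * I * (Complex.exp x / (1 + Complex.exp x)) := by
  have h1 := integral_expSubOneDivSinh_shift x 1 (by simp)
  have h2 := integral_expSubOneDivSinh_shift x (-1) (by simp)
  set A := ∫ t : ℝ, Complex.exp (-(I * t * x)) * ((Real.cosh (Real.pi * t))⁻¹ : ℝ)
  set K := ∫ t : ℝ, expSubOneDivSinh x t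
  set E := Complex.exp (x / 2) with hE
  have hE0 : E ≠ 0 := Complex.exp_ne_zero _
  have e1 : Complex.exp ((1 : ℝ) * x / 2) = E := by simp [hE]
  have e2 : Complex.exp ((-1 : ℝ) * x / 2) = E⁻¹ := by
    rw [hE, ← Complex.exp_neg]; congr 1; push_cast; ring
  have e3 : Complex.exp x = E ^ 2 := by
    rw [hE, ← Complex.exp_nat_mul]; congr 1; push_cast; ring
  have hne : 1 + E ^ 2 ≠ 0 := by
    rw [← e3, ← Complex.ofReal_exp]
    exact_mod_cast (by positivity : (0 : ℝ) < 1 + Real.exp x).ne'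
  rw [e1] at h1
  rw [e2] at h2
  -- Equating the two expressions gives the Fourier transform of the reciprocal hyperbolic cosine.
  have hA : A * (1 + E ^ 2) = 2 * E := by
    have h3 := h1.symm.trans h2
    field_simp at h3
    push_cast at h3
    linear_combination -h3
  rw [e3, h1]
  field_simp
  push_cast
  linear_combination -hA * E

/-- By oddness this is half of a residue. -/
theorem contourIntegral_inv_sinh {r : ℝ} (hr : 0 < r) (hr₁ : r < 1) :
    contourIntegral r (fun p => (Complex.sinh (Real.pi * p))⁻¹) = -I := by
  have hpi := Real.pi_pos
  have hW := isContourWeight_inv_sinh hr hpi (by nlinarith : Real.pi * r < Real.pi)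
  rw [contourIntegral_of_odd hr (fun p => by rw [mul_neg, Complex.sinh_neg, inv_neg])
    (hW.continuousOn.mono fun p hp => Or.inr (by simpa using hp))]
  have h1 : ∮ p in C(0, r), (Complex.sinh (Real.pi * p))⁻¹
      = ∮ p in C(0, r), (p - 0)⁻¹ • (sinhQuot Real.pi p)⁻¹ := by
    refine circleIntegral.integral_congr hr.le fun p hp => ?_
    have hp0 : p ≠ 0 := by
      rintro rfl
      simp at hp; exact hr.ne hp
    rw [sinhQuot_of_ne _ hp0, sub_zero, inv_div, smul_eq_mul]
    field_simp
  have hd : ∀ p : ℂ, ‖p‖ ≤ r → DifferentiableAt ℂ (fun p => (sinhQuot Real.pi p)⁻¹) p := by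
    intro p hp
    refine ((differentiable_sinhQuot _) p).inv (sinhQuot_ne_zero hpi ?_)
    have := Complex.abs_im_le_norm p
    nlinarith
  rw [h1, Complex.circleIntegral_sub_center_inv_smul_of_differentiable_on_off_countable hr
    countable_empty
    (fun p hp => (hd p (by simpa using hp)).continuousAt.continuousWithinAt)
    fun p hp => hd p (le_of_lt (by simpa using hp.1)), sinhQuot_zero]
  have : (Real.pi : ℂ) ≠ 0 := by exact_mod_cast hpi.ne'
  rw [smul_eq_mul]
  field_simp

/-- The Fourier transform of `1 / sinh (π p)` along the contour. -/
theorem contourIntegral_exp_mul_inv_sinh {r : ℝ} (hr : 0 < r) (hr₁ : r < 1) (x : ℝ) :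
    contourIntegral r (fun p => Complex.exp (-(I * p * x)) * (Complex.sinh (Real.pi * p))⁻¹)
      = -(2 * I) * (Complex.exp x / (1 + Complex.exp x)) := by
  have hpi := Real.pi_pos
  have hW := isContourWeight_inv_sinh hr hpi (by nlinarith : Real.pi * r < Real.pi)
  have hx := hW.contourIntegrable hr (z := x) (by simpa using hpi)
  have h0 := hW.contourIntegrable hr (z := 0) (by simpa using hpi)
  simp only [mul_zero, neg_zero, Complex.exp_zero, one_mul] at h0
  obtain ⟨C, hC⟩ := expSubOneDivSinh_bound x
  have hseg : contourIntegral r (expSubOneDivSinh x) = ∫ t : ℝ, expSubOneDivSinh x t := by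
    refine contourIntegral_of_differentiableOn_ball hr hr₁
      ((differentiableOn_expSubOneDivSinh x).mono fun p hp => ?_) ?_
    · exact (Complex.abs_im_le_norm p).trans_lt (by simpa using hp)
    · simpa using integrable_line (v := 0) (differentiableOn_expSubOneDivSinh x).continuousOn hpi
        (by simp) fun t => hC t 0 (by simp)
  have hsplit := hx.integral_sub h0
  rw [contourIntegral_congr hr (h := expSubOneDivSinh x) fun p hp => by
      rw [expSubOneDivSinh_of_ne x (ne_zero_of_mem_contourSet hr hp)]; ring,
    contourIntegral_inv_sinh hr hr₁, hseg, integral_expSubOneDivSinh] at hsplit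
  linear_combination -hsplit

/-- The exponential of the contour integral with one hyperbolic sine: its logarithmic derivative
is a Fourier transform of `1 / sinh`, and its limit at `-∞` is `1`. -/
theorem exp_contourIntegral_one_sinh {r : ℝ} (hr : 0 < r) (hr₁ : r < 1) (x : ℝ) :
    Complex.exp (-(1 / 2) * contourIntegral r (fun p => Complex.exp (-(I * p * x))
      * ((Complex.sinh (Real.pi * p))⁻¹ * p⁻¹))) = 1 + Complex.exp x := by
  have hpi := Real.pi_pos
  have hW := (isContourWeight_inv_sinh hr hpi (by nlinarith : Real.pi * r < Real.pi)).mul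
    (IsContourWeight.inv_self hr)
  rw [add_zero] at hW
  set J : ℂ → ℂ := fun z => contourIntegral r (fun p => Complex.exp (-(I * p * z))
      * ((Complex.sinh (Real.pi * p))⁻¹ * p⁻¹)) with hJ
  have hne : ∀ x : ℝ, 1 + Complex.exp x ≠ 0 := fun x => by
    rw [← Complex.ofReal_exp]
    exact_mod_cast (by positivity : (0 : ℝ) < 1 + Real.exp x).ne'
  have hJ' : ∀ x : ℝ, HasDerivAt J (-(2 * (Complex.exp x / (1 + Complex.exp x)))) x := by
    intro x
    refine (hW.hasDerivAt hr (z := x) (by simpa using hpi)).congr_deriv ?_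
    rw [contourIntegral_congr hr (h := fun p => -I * (Complex.exp (-(I * p * x))
      * (Complex.sinh (Real.pi * p))⁻¹)) fun p hp => by
        have := ne_zero_of_mem_contourSet hr hp
        field_simp, contourIntegral_const_mul, contourIntegral_exp_mul_inv_sinh hr hr₁]
    linear_combination (2 * (Complex.exp x / (1 + Complex.exp x))) * Complex.I_mul_I
  -- The quotient of the two sides is constant, and tends to `1` at `-∞`.
  set H : ℝ → ℂ := fun x => Complex.exp (-(1 / 2) * J x) * (1 + Complex.exp x)⁻¹ with hH
  have hH' : ∀ x, HasDerivAt H 0 x := by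
    intro x
    have h1 : HasDerivAt (fun z : ℂ => Complex.exp (-(1 / 2) * J z)) _ (x : ℂ) :=
      ((hJ' x).const_mul (-(1 / 2))).cexp
    have h2 : HasDerivAt (fun z : ℂ => (1 + Complex.exp z)⁻¹) _ (x : ℂ) :=
      ((Complex.hasDerivAt_exp (x : ℂ)).const_add 1).inv (hne x)
    refine (h1.mul h2).comp_ofReal.congr_deriv ?_
    have := hne x
    field_simp
    ring
  have hconst : ∀ y, H y = H x := fun y =>
    is_const_of_deriv_eq_zero (fun t => (hH' t).differentiableAt) (fun t => (hH' t).deriv) y x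
  have hlim : Tendsto H atBot (𝓝 (Complex.exp (-(1 / 2) * 0) * (1 + 0)⁻¹)) := by
    refine Tendsto.mul ?_ (Tendsto.inv₀ (Tendsto.const_add 1 ?_) (by simp))
    · exact (Complex.continuous_exp.tendsto _).comp ((hW.tendsto_atBot hr).const_mul _)
    · have := Complex.continuous_ofReal.tendsto (0 : ℝ)
      simpa [Function.comp_def] using this.comp Real.tendsto_exp_atBot
  have h1 : H x = 1 := by
    have := tendsto_nhds_unique (hlim.congr hconst) tendsto_const_nhds
    simpa using this.symm
  rw [hH] at h1
  simp only at h1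
  rwa [mul_inv_eq_one₀ (hne x)] at h1

theorem contourIntegral_comp_mul {r a : ℝ} (ha : 0 < a) (g : ℂ → ℂ) :
    contourIntegral r (fun p => a * g (a * p)) = contourIntegral (a * r) g := by
  have ha' : (a : ℂ) ≠ 0 := by exact_mod_cast ha.ne'
  have hright : ∀ (h : ℂ → ℂ) (s : ℝ),
      ∫ x : ℝ in Ici s, a * h (a * x) = ∫ x : ℝ in Ici (a * s), h x := by
    intro h s
    have := integral_comp_mul_left_Ioi (fun x : ℝ => h x) s ha
    simp only [Complex.ofReal_mul] at this
    rw [integral_Ici_eq_integral_Ioi, integral_Ici_eq_integral_Ioi, integral_const_mul, this,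
      Complex.real_smul, Complex.ofReal_inv, mul_inv_cancel_left₀ ha']
  have hneg : ∀ (h : ℂ → ℂ) (s : ℝ),
      ∫ x : ℝ in Iic (-s), h x = ∫ x : ℝ in Ici s, h (-x) := by
    intro h s
    have := integral_comp_neg_Iic (-s) fun x : ℝ => h (-x)
    rw [neg_neg] at this
    rw [integral_Ici_eq_integral_Ioi, ← this]
    simp
  unfold contourIntegral
  rw [hneg (fun p => a * g (a * p)) r, hneg g (a * r)]
  simp only [mul_neg]
  rw [hright g r, hright (fun p => g (-p)) r]
  congr 2
  refine intervalIntegral.integral_congr fun θ _ => ?_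
  push_cast
  simp only [mul_assoc]
  ring

theorem exp_contourIntegral_one_sinh_scaled {r a : ℝ} (hr : 0 < r) (ha : 0 < a) (har : a * r < 1)
    (x : ℝ) :
    Complex.exp (-(1 / 2) * contourIntegral r (fun p => Complex.exp (-(I * p * x))
      * ((Complex.sinh ((Real.pi * a : ℝ) * p))⁻¹ * p⁻¹))) = 1 + Complex.exp (x / a) := by
  have ha' : (a : ℂ) ≠ 0 := by exact_mod_cast ha.ne'
  have h := exp_contourIntegral_one_sinh (mul_pos ha hr) har (x / a)
  rw [← contourIntegral_comp_mul ha, Complex.ofReal_div] at h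
  rw [← h]
  congr 2
  refine contourIntegral_congr hr fun p hp => ?_
  have hp0 := ne_zero_of_mem_contourSet hr hp
  have e1 : I * (a * p) * (x / a) = I * p * x := by field_simp
  rw [e1]
  push_cast
  rw [mul_inv, mul_assoc (Real.pi : ℂ)]
  field_simp

/-! ### The quantum dilogarithm in its strip -/

/-- The factor of the integrand of the quantum dilogarithm that does not depend on `z`. -/
noncomputable def dilogWeight (ħ : ℝ) (p : ℂ) : ℂ :=
  (Complex.sinh (Real.pi * p))⁻¹ * (Complex.sinh ((Real.pi * ħ : ℝ) * p))⁻¹ * p⁻¹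

/-- The contour integral in the exponent of the quantum dilogarithm. -/
noncomputable def dilogExponent (ħ r : ℝ) (z : ℂ) : ℂ :=
  contourIntegral r fun p => Complex.exp (-(I * p * z)) * dilogWeight ħ p

theorem qDilog_eq (ħ r : ℝ) (z : ℂ) :
    qDilog ħ r z = Complex.exp (-(1 / 4) * dilogExponent ħ r z) := by
  rw [qDilog, dilogExponent]
  congr 3
  funext p
  rw [dilogIntegrand, dilogWeight, div_eq_mul_inv, div_eq_mul_inv, mul_inv]
  push_cast
  ring

theorem neg_dilogWeight (ħ : ℝ) (p : ℂ) : dilogWeight ħ (-p) = -dilogWeight ħ p := by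
  simp only [dilogWeight, mul_neg, Complex.sinh_neg, inv_neg]
  ring

section

variable {ħ r : ℝ}

theorem isContourWeight_dilogWeight (hħ : 0 < ħ) (hr : 0 < r) (hr₁ : r < 1) (hr₂ : ħ * r < 1) :
    IsContourWeight r (Real.pi + Real.pi * ħ) (dilogWeight ħ) := by
  have hpi := Real.pi_pos
  have h := ((isContourWeight_inv_sinh hr hpi (by nlinarith : Real.pi * r < Real.pi)).mul
    (isContourWeight_inv_sinh hr (mul_pos hpi hħ) (by
      rw [mul_assoc]; nlinarith : Real.pi * ħ * r < Real.pi))).mul (IsContourWeight.inv_self hr)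
  rwa [add_zero] at h

theorem differentiableOn_qDilog (hħ : 0 < ħ) (hr : 0 < r) (hr₁ : r < 1) (hr₂ : ħ * r < 1) :
    DifferentiableOn ℂ (qDilog ħ r) {z | |z.im| < Real.pi + Real.pi * ħ} := by
  intro z hz
  have h := ((isContourWeight_dilogWeight hħ hr hr₁ hr₂).hasDerivAt hr hz).differentiableAt
  have : qDilog ħ r = fun z => Complex.exp (-(1 / 4) * dilogExponent ħ r z) :=
    funext (qDilog_eq ħ r)
  rw [this]
  exact (h.const_mul _).cexp.differentiableWithinAt

/-- Cancelling one hyperbolic sine against `e ^ (β p) - e ^ (-β p)` turns a shift of the argument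
into a contour integral with one hyperbolic sine. -/
theorem dilogExponent_sub (hħ : 0 < ħ) (hr : 0 < r) (hr₁ : r < 1) (hr₂ : ħ * r < 1) {β : ℝ}
    (hβ : |β| < Real.pi + Real.pi * ħ) {ψ : ℂ → ℂ}
    (hψ : ∀ p ∈ contourSet r, Complex.sinh (β * p) * dilogWeight ħ p = ψ p) (x : ℝ) :
    dilogExponent ħ r (x + β * I) - dilogExponent ħ r (x - β * I)
      = 2 * contourIntegral r fun p => Complex.exp (-(I * p * x)) * ψ p := by
  have hW := isContourWeight_dilogWeight hħ hr hr₁ hr₂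
  rw [dilogExponent, dilogExponent, ← ContourIntegrable.integral_sub
    (hW.contourIntegrable hr (by simpa using hβ)) (hW.contourIntegrable hr (by simpa using hβ)),
    ← contourIntegral_const_mul]
  refine contourIntegral_congr hr fun p hp => ?_
  rw [← hψ p hp, Complex.sinh]
  have e1 : Complex.exp (-(I * p * (x + β * I)))
      = Complex.exp (-(I * p * x)) * Complex.exp (β * p) := by
    rw [← Complex.exp_add]; congr 1
    linear_combination (-(p * β)) * Complex.I_mul_I
  have e2 : Complex.exp (-(I * p * (x - β * I)))
      = Complex.exp (-(I * p * x)) * Complex.exp (-(β * p)) := by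
    rw [← Complex.exp_add]; congr 1
    linear_combination (p * β) * Complex.I_mul_I
  rw [e1, e2]
  ring

theorem sinh_ne_zero_of_mem_contourSet {a : ℝ} (hr : 0 < r) (ha : 0 < a) (har : a * r < Real.pi)
    {p : ℂ} (hp : p ∈ contourSet r) : Complex.sinh (a * p) ≠ 0 := by
  refine sinh_ne_zero_of_abs_im_lt
    (mul_ne_zero (by exact_mod_cast ha.ne') (ne_zero_of_mem_contourSet hr hp)) ?_
  rw [Complex.im_ofReal_mul, abs_mul, abs_of_pos ha]
  rcases hp with ⟨h, -⟩ | h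
  · simpa [h] using Real.pi_pos
  · refine lt_of_le_of_lt (mul_le_mul_of_nonneg_left ?_ ha.le) har
    rw [← h]; exact Complex.abs_im_le_norm p

/-- The difference equation of the quantum dilogarithm with step `2 π i ħ`. -/
theorem qDilog_add_pi_mul_I (hħ : 0 < ħ) (hr : 0 < r) (hr₁ : r < 1) (hr₂ : ħ * r < 1) (x : ℝ) :
    qDilog ħ r (x + (Real.pi * ħ : ℝ) * I)
      = (1 + Complex.exp x) * qDilog ħ r (x - (Real.pi * ħ : ℝ) * I) := by
  have hpi := Real.pi_pos
  have hpħ := mul_pos hpi hħ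
  have hs := dilogExponent_sub hħ hr hr₁ hr₂ (β := Real.pi * ħ)
    (by rw [abs_of_pos hpħ]; linarith)
    (ψ := fun p => (Complex.sinh (Real.pi * p))⁻¹ * p⁻¹) (fun p hp => by
      have := sinh_ne_zero_of_mem_contourSet hr hpħ (by rw [mul_assoc]; nlinarith) hp
      rw [dilogWeight]; field_simp) x
  have h1 := exp_contourIntegral_one_sinh hr hr₁ x
  rw [qDilog_eq, qDilog_eq, ← h1, ← Complex.exp_add]
  congr 1
  linear_combination (-(1 / 4)) * hs

/-- The difference equation of the quantum dilogarithm with step `2 π i`. -/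
theorem qDilog_add_pi_I (hħ : 0 < ħ) (hr : 0 < r) (hr₁ : r < 1) (hr₂ : ħ * r < 1) (x : ℝ) :
    qDilog ħ r (x + Real.pi * I)
      = (1 + Complex.exp (x / ħ)) * qDilog ħ r (x - Real.pi * I) := by
  have hpi := Real.pi_pos
  have hpħ := mul_pos hpi hħ
  have hs := dilogExponent_sub hħ hr hr₁ hr₂ (β := Real.pi)
    (by rw [abs_of_pos hpi]; linarith)
    (ψ := fun p => (Complex.sinh ((Real.pi * ħ : ℝ) * p))⁻¹ * p⁻¹) (fun p hp => by
      have := sinh_ne_zero_of_mem_contourSet hr hpi (by nlinarith) hp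
      rw [dilogWeight]; field_simp) x
  have h1 := exp_contourIntegral_one_sinh_scaled hr hħ hr₂ x
  rw [qDilog_eq, qDilog_eq, ← h1, ← Complex.exp_add]
  congr 1
  linear_combination (-(1 / 4)) * hs

/-- The mixed term vanishes as the derivative of the cosine is zero at the origin. -/
theorem iteratedDeriv_two_cos_mul {M : ℂ → ℂ} {R : ℝ} (hR : 0 < R)
    (hM : DifferentiableOn ℂ M (Metric.ball 0 R)) (z : ℂ) :
    iteratedDeriv 2 (fun p => 2 * Complex.cos (p * z) * M p) 0
      = 2 * deriv (deriv M) 0 - 2 * z ^ 2 * M 0 := by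
  have h0 : (0 : ℂ) ∈ Metric.ball (0 : ℂ) R := Metric.mem_ball_self hR
  have hMd : ∀ p ∈ Metric.ball (0 : ℂ) R, HasDerivAt M (deriv M p) p := fun p hp =>
    ((hM p hp).differentiableAt (Metric.isOpen_ball.mem_nhds hp)).hasDerivAt
  have hM' := hM.deriv Metric.isOpen_ball
  have hM2 : HasDerivAt (deriv M) (deriv (deriv M) 0) 0 :=
    ((hM' 0 h0).differentiableAt (Metric.isOpen_ball.mem_nhds h0)).hasDerivAt
  have hid : ∀ p : ℂ, HasDerivAt (fun p => p * z) z p := fun p => by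
    simpa using (hasDerivAt_id' p).mul_const z
  have e1 : deriv (fun p => 2 * Complex.cos (p * z) * M p) =ᶠ[𝓝 0]
      fun p => 2 * (-Complex.sin (p * z) * z) * M p + 2 * Complex.cos (p * z) * deriv M p := by
    filter_upwards [Metric.isOpen_ball.mem_nhds h0] with p hp
    exact (((hid p).ccos.const_mul 2).mul (hMd p hp)).deriv
  rw [iteratedDeriv_succ, iteratedDeriv_one, e1.deriv_eq]
  have h2 := (((((hid 0).csin.neg).mul_const z).const_mul 2).mul (hMd 0 h0)).add
    (((hid 0).ccos.const_mul 2).mul hM2)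
  refine h2.deriv.trans ?_
  simp
  ring

/-- The inversion relation of the quantum dilogarithm: in the sum the half lines cancel, as the
integrand becomes odd, and Cauchy's formula applies to the triple pole at the origin. -/
theorem exists_dilogExponent_add_neg (hħ : 0 < ħ) (hr : 0 < r) (hr₁ : r < 1) (hr₂ : ħ * r < 1) :
    ∃ A : ℂ, ∀ z : ℂ, |z.im| < Real.pi + Real.pi * ħ →
      dilogExponent ħ r z + dilogExponent ħ r (-z) = A + I * z ^ 2 / (Real.pi * ħ) := by
  have hpi := Real.pi_pos
  have hpħ := mul_pos hpi hħ
  have hW := isContourWeight_dilogWeight hħ hr hr₁ hr₂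
  set M : ℂ → ℂ := fun p => (sinhQuot Real.pi p * sinhQuot (Real.pi * ħ) p)⁻¹ with hM
  obtain ⟨R, hrR, hR⟩ : ∃ R, r < R ∧ R < min 1 (1 / ħ) :=
    exists_between (lt_min hr₁ ((lt_div_iff₀' hħ).mpr hr₂))
  obtain ⟨hR1, hR2⟩ := lt_min_iff.mp hR
  rw [lt_div_iff₀' hħ] at hR2
  have hMd : DifferentiableOn ℂ M (Metric.ball 0 R) := by
    intro p hp
    have hp' : |p.im| < R := (Complex.abs_im_le_norm p).trans_lt (by simpa using hp)
    refine (((differentiable_sinhQuot _ p).mul (differentiable_sinhQuot _ p)).inv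
      (mul_ne_zero (sinhQuot_ne_zero hpi ?_) (sinhQuot_ne_zero hpħ ?_))).differentiableWithinAt
    · nlinarith
    · rw [mul_assoc]; nlinarith [mul_lt_mul_of_pos_left hp' hħ]
  have hM0 : M 0 = 1 / (Real.pi * (Real.pi * ħ)) := by
    simp [hM, sinhQuot_zero]
  refine ⟨-(Real.pi * I) * deriv (deriv M) 0, fun z hz => ?_⟩
  rw [dilogExponent, dilogExponent, ← ContourIntegrable.integral_add (hW.contourIntegrable hr hz)
    (hW.contourIntegrable hr (by simpa using hz))]
  have e1 : (fun p => Complex.exp (-(I * p * z)) * dilogWeight ħ p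
      + Complex.exp (-(I * p * -z)) * dilogWeight ħ p)
      = fun p => 2 * Complex.cos (p * z) * dilogWeight ħ p := by
    funext p
    rw [← add_mul, Complex.cos]
    ring_nf
  rw [e1, contourIntegral_of_odd hr (g := fun p => 2 * Complex.cos (p * z) * dilogWeight ħ p)
    (fun p => by
      rw [neg_dilogWeight, neg_mul, Complex.cos_neg, mul_neg])
    ((Continuous.continuousOn (by fun_prop)).mul
      (hW.continuousOn.mono fun p hp => Or.inr (by simpa using hp)))]
  have e2 : ∮ p in C(0, r), 2 * Complex.cos (p * z) * dilogWeight ħ p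
      = ∮ p in C(0, r), (1 / (p - 0) ^ (2 + 1)) • (2 * Complex.cos (p * z) * M p) := by
    refine circleIntegral.integral_congr hr.le fun p hp => ?_
    have hp0 : p ≠ 0 := by
      rintro rfl
      simp at hp; exact hr.ne hp
    simp only [hM, dilogWeight, sinhQuot_of_ne _ hp0, sub_zero, smul_eq_mul, mul_inv, inv_div]
    field_simp
    ring
  rw [e2, DifferentiableOn.circleIntegral_one_div_sub_center_pow_smul hr 2
    (f := fun p => 2 * Complex.cos (p * z) * M p)
    (((Differentiable.differentiableOn (by fun_prop)).mul hMd).mono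
      (Metric.closedBall_subset_ball hrR)),
    iteratedDeriv_two_cos_mul (hr.trans hrR) hMd, hM0]
  have : (Real.pi : ℂ) ≠ 0 := by exact_mod_cast hpi.ne'
  have : (ħ : ℂ) ≠ 0 := by exact_mod_cast hħ.ne'
  simp only [Nat.factorial, smul_eq_mul]
  push_cast
  field_simp
  ring

/-- The quantum dilogarithm grows at most exponentially in closed strips inside its domain: it is
bounded in the left half, and the inversion relation, whose quadratic term is imaginary on the real
line, gives the bound in the right half. -/
theorem exists_norm_qDilog_le (hħ : 0 < ħ) (hr : 0 < r) (hr₁ : r < 1) (hr₂ : ħ * r < 1) {b : ℝ}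
    (hb : b < Real.pi + Real.pi * ħ) :
    ∃ C c : ℝ, 0 ≤ C ∧ 0 ≤ c ∧
      ∀ z : ℂ, |z.im| ≤ b → ‖qDilog ħ r z‖ ≤ C * Real.exp (c * |z.re|) := by
  have hpħ := mul_pos Real.pi_pos hħ
  obtain ⟨B, hB⟩ := (isContourWeight_dilogWeight hħ hr hr₁ hr₂).bounded hr hb
  obtain ⟨A, hA⟩ := exists_dilogExponent_add_neg hħ hr hr₁ hr₂
  refine ⟨Real.exp (1 / 4 * (‖A‖ + B)), |b| / (2 * (Real.pi * ħ)), (Real.exp_pos _).le,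
    by positivity, fun z hz => ?_⟩
  have hB0 : ∀ z : ℂ, z.re ≤ 0 → |z.im| ≤ b → ‖dilogExponent ħ r z‖ ≤ B := hB
  rw [qDilog_eq, Complex.norm_exp, ← Real.exp_add]
  refine Real.exp_le_exp.mpr ?_
  rcases le_total z.re 0 with h | h
  · have h1 := (Complex.re_le_norm (-(1 / 4) * dilogExponent ħ r z))
    have h2 : ‖-(1 / 4) * dilogExponent ħ r z‖ = 1 / 4 * ‖dilogExponent ħ r z‖ := by
      rw [norm_mul, norm_neg]; norm_num
    have h3 := hB0 z h hz
    have h4 : 0 ≤ |b| / (2 * (Real.pi * ħ)) * |z.re| := by positivity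
    linarith [norm_nonneg A]
  · have h3 := hB0 (-z) (by simpa using h) (by simpa using hz)
    have h1 := hA z (hz.trans_lt hb)
    have h2 : -(1 / 4) * dilogExponent ħ r z
        = -(1 / 4) * (A - dilogExponent ħ r (-z)) + -(I * z ^ 2 / (Real.pi * ħ)) / 4 := by
      linear_combination (-(1 / 4)) * h1
    have h4 : (-(I * z ^ 2 / (Real.pi * ħ)) / 4 : ℂ).re
        = z.im * z.re / (2 * (Real.pi * ħ)) := by
      have : (-(I * z ^ 2 / (Real.pi * ħ)) / 4 : ℂ)
          = ((-(1 / (4 * (Real.pi * ħ))) : ℝ) : ℂ) * (I * z ^ 2) := by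
        push_cast; ring
      rw [this, Complex.re_ofReal_mul]
      simp [pow_two]
      ring
    have h5 := Complex.re_le_norm (-(1 / 4) * (A - dilogExponent ħ r (-z)))
    have h6 : ‖-(1 / 4) * (A - dilogExponent ħ r (-z))‖ ≤ 1 / 4 * (‖A‖ + B) := by
      rw [norm_mul, norm_neg]
      refine mul_le_mul (by norm_num) ((norm_sub_le _ _).trans (by linarith)) (norm_nonneg _)
        (by norm_num)
    have h7 : z.im * z.re / (2 * (Real.pi * ħ)) ≤ |b| / (2 * (Real.pi * ħ)) * |z.re| := by
      rw [div_mul_eq_mul_div]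
      refine div_le_div_of_nonneg_right ?_ (by positivity)
      calc z.im * z.re ≤ |z.im * z.re| := le_abs_self _
        _ = |z.im| * |z.re| := abs_mul _ _
        _ ≤ |b| * |z.re| := mul_le_mul_of_nonneg_right (hz.trans (le_abs_self b)) (abs_nonneg _)
    rw [h2, Complex.add_re, h4]
    linarith

end

/-! ### Decay and growth in horizontal strips -/

/-- Entire functions which decay faster than every exponential in each horizontal strip. -/
structure StripDecay (w : ℂ → ℂ) : Prop where
  differentiable : Differentiable ℂ w
  bound : ∀ M c : ℝ, ∃ C, 0 ≤ C ∧ ∀ z : ℂ, |z.im| ≤ M → ‖w z‖ ≤ C * Real.exp (-c * |z.re|)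

/-- Entire functions which grow at most exponentially in each horizontal strip. -/
structure StripGrowth (f : ℂ → ℂ) : Prop where
  differentiable : Differentiable ℂ f
  bound : ∀ M : ℝ, ∃ C c : ℝ, 0 ≤ C ∧ ∀ z : ℂ, |z.im| ≤ M → ‖f z‖ ≤ C * Real.exp (c * |z.re|)

theorem StripDecay.add {f g : ℂ → ℂ} (hf : StripDecay f) (hg : StripDecay g) :
    StripDecay (f + g) where
  differentiable := hf.differentiable.add hg.differentiable
  bound M c := by
    obtain ⟨C, hC0, hC⟩ := hf.bound M c
    obtain ⟨D, hD0, hD⟩ := hg.bound M c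
    refine ⟨C + D, by positivity, fun z hz => ?_⟩
    rw [add_mul]
    exact (norm_add_le _ _).trans (add_le_add (hC z hz) (hD z hz))

theorem StripGrowth.mul_stripDecay {f g : ℂ → ℂ} (hf : StripGrowth f) (hg : StripDecay g) :
    StripDecay (f * g) where
  differentiable := hf.differentiable.mul hg.differentiable
  bound M c := by
    obtain ⟨C, a, hC0, hC⟩ := hf.bound M
    obtain ⟨D, hD0, hD⟩ := hg.bound M (a + c)
    refine ⟨C * D, by positivity, fun z hz => ?_⟩
    rw [Pi.mul_apply, norm_mul]
    refine (mul_le_mul (hC z hz) (hD z hz) (norm_nonneg _) (by positivity)).trans_eq ?_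
    rw [mul_mul_mul_comm, ← Real.exp_add]
    ring_nf

theorem StripGrowth.mul {f g : ℂ → ℂ} (hf : StripGrowth f) (hg : StripGrowth g) :
    StripGrowth (f * g) where
  differentiable := hf.differentiable.mul hg.differentiable
  bound M := by
    obtain ⟨C, a, hC0, hC⟩ := hf.bound M
    obtain ⟨D, b, hD0, hD⟩ := hg.bound M
    refine ⟨C * D, a + b, by positivity, fun z hz => ?_⟩
    rw [Pi.mul_apply, norm_mul]
    refine (mul_le_mul (hC z hz) (hD z hz) (norm_nonneg _) (by positivity)).trans_eq ?_
    rw [mul_mul_mul_comm, ← Real.exp_add]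
    ring_nf

theorem StripGrowth.add {f g : ℂ → ℂ} (hf : StripGrowth f) (hg : StripGrowth g) :
    StripGrowth (f + g) where
  differentiable := hf.differentiable.add hg.differentiable
  bound M := by
    obtain ⟨C, a, hC0, hC⟩ := hf.bound M
    obtain ⟨D, b, hD0, hD⟩ := hg.bound M
    refine ⟨C + D, max a b, by positivity, fun z hz => ?_⟩
    rw [add_mul]
    refine (norm_add_le _ _).trans (add_le_add ((hC z hz).trans ?_) ((hD z hz).trans ?_))
    · gcongr; exact le_max_left _ _
    · gcongr; exact le_max_right _ _

theorem stripGrowth_const (a : ℂ) : StripGrowth fun _ => a where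
  differentiable := by fun_prop
  bound _ := ⟨‖a‖, 0, norm_nonneg _, fun z _ => by simp⟩

theorem stripGrowth_exp (t : ℂ) : StripGrowth fun z => Complex.exp (t * z) where
  differentiable := by fun_prop
  bound M := by
    refine ⟨Real.exp (‖t‖ * M), ‖t‖, (Real.exp_pos _).le, fun z hz => ?_⟩
    rw [← Real.exp_add]
    refine (Complex.norm_exp_le_exp_norm _).trans (Real.exp_le_exp.mpr ?_)
    rw [norm_mul, ← mul_add]
    refine mul_le_mul_of_nonneg_left ?_ (norm_nonneg _)
    linarith [Complex.norm_le_abs_re_add_abs_im z]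

theorem stripGrowth_polynomial (P : Polynomial ℂ) : StripGrowth fun z => P.eval z := by
  induction P using Polynomial.induction_on' with
  | add p q hp hq => simpa [Pi.add_def] using hp.add hq
  | monomial n a =>
    have h : StripGrowth fun z : ℂ => z ^ n := by
      refine ⟨by fun_prop, fun M => ⟨n.factorial * Real.exp M, 1, by positivity, fun z hz => ?_⟩⟩
      have h1 : ‖z‖ ≤ M + 1 * |z.re| := by
        linarith [Complex.norm_le_abs_re_add_abs_im z]
      have h2 := Real.pow_div_factorial_le_exp _ (norm_nonneg z) n
      rw [div_le_iff₀ (by positivity)] at h2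
      rw [norm_pow]
      calc ‖z‖ ^ n ≤ Real.exp ‖z‖ * n.factorial := h2
        _ ≤ Real.exp (M + 1 * |z.re|) * n.factorial := by gcongr
        _ = _ := by rw [Real.exp_add]; ring
    simpa [Pi.mul_def] using (stripGrowth_const a).mul h

theorem stripDecay_gaussian {a : ℝ} (ha : 0 < a) :
    StripDecay fun z => Complex.exp (-(a * z ^ 2) / 2) where
  differentiable := by fun_prop
  bound M c := by
    refine ⟨Real.exp (a * M ^ 2 / 2 + c ^ 2 / (2 * a)), (Real.exp_pos _).le, fun z hz => ?_⟩
    rw [← Real.exp_add, Complex.norm_exp]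
    refine Real.exp_le_exp.mpr ?_
    have hre : (-(a * z ^ 2) / 2 : ℂ).re = -(a * (|z.re| ^ 2 - |z.im| ^ 2)) / 2 := by
      have : (-(a * z ^ 2) / 2 : ℂ) = ((-a / 2 : ℝ) : ℂ) * z ^ 2 := by push_cast; ring
      rw [this, Complex.re_ofReal_mul, sq_abs, sq_abs]
      simp [pow_two]
      ring
    rw [hre]
    have h1 : |z.im| ^ 2 ≤ M ^ 2 := pow_le_pow_left₀ (abs_nonneg _) hz 2
    have h2 : 0 ≤ (a * |z.re| - c) ^ 2 / (2 * a) := by positivity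
    have h3 : (a * |z.re| - c) ^ 2 / (2 * a)
        = a * |z.re| ^ 2 / 2 - c * |z.re| + c ^ 2 / (2 * a) := by
      field_simp
      ring
    nlinarith

theorem stripDecay_of_mem_gaussW {w : ℂ → ℂ} (hw : w ∈ gaussW) : StripDecay w := by
  induction hw using Submodule.span_induction with
  | mem f hf =>
    obtain ⟨a, b, P, ha, rfl⟩ := hf
    have := StripGrowth.mul_stripDecay (stripGrowth_polynomial P)
      (StripGrowth.mul_stripDecay (stripGrowth_exp b) (stripDecay_gaussian ha))
    convert this using 1
    funext z
    simp only [Pi.mul_apply]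
    rw [Complex.exp_add]; ring
  | zero => exact ⟨differentiable_const 0, fun M c => ⟨0, le_rfl, fun z _ => by simp⟩⟩
  | add f g _ _ hf hg => exact hf.add hg
  | smul c f _ hf => exact StripGrowth.mul_stripDecay (stripGrowth_const c) hf

/-! ### The operators of the quantum torus on these spaces -/

theorem shiftOp_apply (s : ℂ) (f : ℂ → ℂ) (z : ℂ) :
    (shiftOp s : Module.End ℂ (ℂ → ℂ)) f z = f (z + s) := rfl

theorem expOp_apply (t : ℂ) (f : ℂ → ℂ) (z : ℂ) :
    (expOp t : Module.End ℂ (ℂ → ℂ)) f z = Complex.exp (t * z) * f z := rfl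

theorem shiftOp_inv (s : ℂ) : (shiftOp s)⁻¹ = shiftOp (-s) := by
  apply Units.ext
  apply LinearMap.ext
  intro f
  funext z
  change f (z - s) = f (z + -s)
  rw [sub_eq_add_neg]

theorem expOp_inv (t : ℂ) : (expOp t)⁻¹ = expOp (-t) := by
  apply Units.ext
  apply LinearMap.ext
  intro f
  funext z
  change Complex.exp (-(t * z)) * f z = Complex.exp (-t * z) * f z
  rw [neg_mul]

theorem shiftOp_mem_gaussW (s : ℂ) {w : ℂ → ℂ} (hw : w ∈ gaussW) :
    (shiftOp s : Module.End ℂ (ℂ → ℂ)) w ∈ gaussW := by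
  induction hw using Submodule.span_induction with
  | mem f hf =>
    obtain ⟨a, b, P, ha, rfl⟩ := hf
    refine Submodule.subset_span ⟨a, b - a * s,
      Polynomial.C (Complex.exp (-(a * s ^ 2) / 2 + b * s)) * P.comp (Polynomial.X + Polynomial.C s),
      ha, ?_⟩
    funext z
    rw [shiftOp_apply, Polynomial.eval_mul, Polynomial.eval_C, Polynomial.eval_comp,
      Polynomial.eval_add, Polynomial.eval_X, Polynomial.eval_C, ← mul_assoc, ← Complex.exp_add]
    congr 2
    ring
  | zero => rw [map_zero]; exact gaussW.zero_mem
  | add f g _ _ hf hg => rw [map_add]; exact gaussW.add_mem hf hg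
  | smul c f _ hf => rw [map_smul]; exact gaussW.smul_mem c hf

theorem expOp_mem_gaussW (t : ℂ) {w : ℂ → ℂ} (hw : w ∈ gaussW) :
    (expOp t : Module.End ℂ (ℂ → ℂ)) w ∈ gaussW := by
  induction hw using Submodule.span_induction with
  | mem f hf =>
    obtain ⟨a, b, P, ha, rfl⟩ := hf
    refine Submodule.subset_span ⟨a, b + t, P, ha, ?_⟩
    funext z
    rw [expOp_apply, ← mul_assoc, ← Complex.exp_add]
    congr 2
    ring
  | zero => rw [map_zero]; exact gaussW.zero_mem
  | add f g _ _ hf hg => rw [map_add]; exact gaussW.add_mem hf hg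
  | smul c f _ hf => rw [map_smul]; exact gaussW.smul_mem c hf

theorem StripGrowth.shift {f : ℂ → ℂ} (hf : StripGrowth f) (s : ℂ) :
    StripGrowth ((shiftOp s : Module.End ℂ (ℂ → ℂ)) f) where
  differentiable := hf.differentiable.comp (by fun_prop : Differentiable ℂ fun z => z + s)
  bound M := by
    obtain ⟨C, c, hC0, hC⟩ := hf.bound (M + |s.im|)
    refine ⟨C * Real.exp (|c| * |s.re|), |c|, by positivity, fun z hz => ?_⟩
    rw [shiftOp_apply]
    refine (hC (z + s) ?_).trans ?_
    · rw [Complex.add_im]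
      exact (abs_add_le _ _).trans (by linarith)
    · rw [mul_assoc, ← Real.exp_add]
      refine mul_le_mul_of_nonneg_left (Real.exp_le_exp.mpr ?_) hC0
      rw [Complex.add_re, ← mul_add]
      exact mul_le_mul (le_abs_self c) ((abs_add_le _ _).trans_eq (add_comm _ _)) (abs_nonneg _)
        (abs_nonneg _)

theorem StripGrowth.expOp {f : ℂ → ℂ} (hf : StripGrowth f) (t : ℂ) :
    StripGrowth ((expOp t : Module.End ℂ (ℂ → ℂ)) f) :=
  (stripGrowth_exp t).mul hf

/-! ### The operator `K` -/

section

variable {ħ r : ℝ}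

theorem norm_exp_kernel (hħ : 0 < ħ) (u z : ℂ) :
    ‖Complex.exp (-(u * z) / (2 * Real.pi * I * ħ))‖
      = Real.exp (-(u.re * z.im + u.im * z.re) / (2 * Real.pi * ħ)) := by
  have hpi : (Real.pi : ℂ) ≠ 0 := by exact_mod_cast Real.pi_ne_zero
  have hħ' : (ħ : ℂ) ≠ 0 := by exact_mod_cast hħ.ne'
  have : -(u * z) / (2 * Real.pi * I * ħ) = ((1 / (2 * Real.pi * ħ) : ℝ) : ℂ) * (I * (u * z)) := by
    push_cast
    field_simp
    linear_combination (-(u * z)) * Complex.I_sq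
  rw [Complex.norm_exp, this, Complex.re_ofReal_mul]
  congr 1
  simp only [Complex.I_mul_re, Complex.mul_im]
  ring

/-- The integrand of `K w` at complex points. -/
noncomputable def kernelC (ħ r : ℝ) (w : ℂ → ℂ) (z u : ℂ) : ℂ :=
  w u * qDilog ħ r u * Complex.exp (-(u * z) / (2 * Real.pi * I * ħ))

theorem exists_norm_mul_qDilog_le (hħ : 0 < ħ) (hr : 0 < r) (hr₁ : r < 1) (hr₂ : ħ * r < 1)
    {w : ℂ → ℂ} (hw : StripDecay w) {b : ℝ} (hb : b < Real.pi + Real.pi * ħ) (c : ℝ) :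
    ∃ C, 0 ≤ C ∧ ∀ u : ℂ, |u.im| ≤ b → ‖w u * qDilog ħ r u‖ ≤ C * Real.exp (-c * |u.re|) := by
  obtain ⟨C, a, hC0, -, hC⟩ := exists_norm_qDilog_le hħ hr hr₁ hr₂ hb
  obtain ⟨D, hD0, hD⟩ := hw.bound b (a + c)
  refine ⟨D * C, by positivity, fun u hu => ?_⟩
  rw [norm_mul]
  refine (mul_le_mul (hD u hu) (hC u hu) (norm_nonneg _) (by positivity)).trans_eq ?_
  rw [mul_mul_mul_comm, ← Real.exp_add]
  ring_nf

/-- The last factor, which is not absorbed in the constant, is the source of the decay of `K w` on the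
real line. -/
theorem exists_norm_kernelC_le (hħ : 0 < ħ) (hr : 0 < r) (hr₁ : r < 1) (hr₂ : ħ * r < 1)
    {w : ℂ → ℂ} (hw : StripDecay w) {b : ℝ} (hb : b < Real.pi + Real.pi * ħ) (M : ℝ) :
    ∃ C, 0 ≤ C ∧ ∀ z u : ℂ, |u.im| ≤ b → |z.im| ≤ M → ‖kernelC ħ r w z u‖
      ≤ C * Real.exp (-1 * |u.re|) * Real.exp (-(u.im * z.re) / (2 * Real.pi * ħ)) := by
  have hpi := Real.pi_pos
  obtain ⟨C, hC0, hC⟩ := exists_norm_mul_qDilog_le hħ hr hr₁ hr₂ hw hb (M / (2 * Real.pi * ħ) + 1)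
  refine ⟨C, hC0, fun z u hu hz => ?_⟩
  rw [kernelC, norm_mul, norm_exp_kernel hħ]
  refine (mul_le_mul_of_nonneg_right (hC u hu) (Real.exp_pos _).le).trans ?_
  rw [mul_assoc C, mul_assoc C, ← Real.exp_add, ← Real.exp_add]
  refine mul_le_mul_of_nonneg_left (Real.exp_le_exp.mpr ?_) hC0
  have h1 : -(u.re * z.im) ≤ M * |u.re| := by
    calc -(u.re * z.im) ≤ |u.re * z.im| := neg_le_abs _
      _ = |z.im| * |u.re| := by rw [abs_mul, mul_comm]
      _ ≤ _ := mul_le_mul_of_nonneg_right hz (abs_nonneg _)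
  have h2 := div_le_div_of_nonneg_right h1 (by positivity : 0 ≤ 2 * Real.pi * ħ)
  have e1 : -(u.re * z.im + u.im * z.re) / (2 * Real.pi * ħ)
      = -(u.re * z.im) / (2 * Real.pi * ħ) + -(u.im * z.re) / (2 * Real.pi * ħ) := by ring
  have e2 : M * |u.re| / (2 * Real.pi * ħ) = M / (2 * Real.pi * ħ) * |u.re| := by ring
  rw [e1]
  linarith

theorem differentiableOn_kernelC (hħ : 0 < ħ) (hr : 0 < r) (hr₁ : r < 1) (hr₂ : ħ * r < 1)
    {w : ℂ → ℂ} (hw : StripDecay w) (z : ℂ) :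
    DifferentiableOn ℂ (kernelC ħ r w z) {u | |u.im| < Real.pi + Real.pi * ħ} :=
  (hw.differentiable.differentiableOn.mul (differentiableOn_qDilog hħ hr hr₁ hr₂)).mul
    (Differentiable.differentiableOn (by fun_prop))

theorem integrable_kernelC (hħ : 0 < ħ) (hr : 0 < r) (hr₁ : r < 1) (hr₂ : ħ * r < 1)
    {w : ℂ → ℂ} (hw : StripDecay w) (z : ℂ) {y : ℝ} (hy : |y| < Real.pi + Real.pi * ħ) :
    Integrable fun x : ℝ => kernelC ħ r w z (x + y * I) := by
  obtain ⟨C, -, hC⟩ := exists_norm_kernelC_le hħ hr hr₁ hr₂ hw hy |z.im|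
  refine integrable_line (c := 1) (C := C * Real.exp (-(y * z.re) / (2 * Real.pi * ħ)))
    (differentiableOn_kernelC hħ hr hr₁ hr₂ hw z).continuousOn one_pos (by simpa using hy) fun x => ?_
  have := hC z (x + y * I) (by simp) le_rfl
  simp only [Complex.add_im, Complex.ofReal_im, Complex.mul_im, Complex.ofReal_re, Complex.I_im,
    mul_one, Complex.I_re, mul_zero, add_zero, zero_add, Complex.add_re, Complex.mul_re,
    sub_self] at this
  linarith

/-- The line of integration in `K w` can be moved inside the strip where the quantum dilogarithm is
holomorphic. -/
theorem opK_eq_shift (hħ : 0 < ħ) (hr : 0 < r) (hr₁ : r < 1) (hr₂ : ħ * r < 1)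
    {w : ℂ → ℂ} (hw : StripDecay w) (z : ℂ) {y : ℝ} (hy : |y| < Real.pi + Real.pi * ħ) :
    opK ħ r w z = ∫ x : ℝ, kernelC ħ r w z (x + y * I) := by
  have hpi := Real.pi_pos
  have hv : ∀ v ∈ uIcc 0 y, |v| ≤ |y| := fun v hv => by
    simpa using abs_sub_left_of_mem_uIcc hv
  obtain ⟨C, hC0, hC⟩ := exists_norm_kernelC_le hħ hr hr₁ hr₂ hw hy |z.im|
  refine (integral_line_shift (f := kernelC ħ r w z) one_pos
    (C := C * Real.exp (|y| * |z.re| / (2 * Real.pi * ħ)))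
    ((differentiableOn_kernelC hħ hr hr₁ hr₂ hw z).mono fun u hu => (hv _ hu).trans_lt hy)
    fun x v hv' => ?_)
  refine (hC z (x + v * I) (by simpa using hv v hv') le_rfl).trans ?_
  have h1 : -(v * z.re) ≤ |y| * |z.re| := by
    calc -(v * z.re) ≤ |v * z.re| := neg_le_abs _
      _ = |v| * |z.re| := abs_mul _ _
      _ ≤ _ := mul_le_mul_of_nonneg_right (hv v hv') (abs_nonneg _)
  rw [mul_right_comm]
  simp only [Complex.add_im, Complex.ofReal_im, Complex.mul_im, Complex.ofReal_re, Complex.I_im,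
    mul_one, Complex.I_re, mul_zero, add_zero, zero_add, Complex.add_re, Complex.mul_re,
    sub_self]
  gcongr

theorem integrable_kernelK (hħ : 0 < ħ) (hr : 0 < r) (hr₁ : r < 1) (hr₂ : ħ * r < 1)
    {w : ℂ → ℂ} (hw : StripDecay w) (z : ℂ) : Integrable (kernelK ħ r w z) := by
  have := integrable_kernelC hħ hr hr₁ hr₂ hw z (y := 0)
    (by rw [abs_zero]; have := Real.pi_pos; positivity)
  simp only [Complex.ofReal_zero, zero_mul, add_zero] at this
  exact this

theorem differentiable_opK (hħ : 0 < ħ) (hr : 0 < r) (hr₁ : r < 1) (hr₂ : ħ * r < 1)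
    {w : ℂ → ℂ} (hw : StripDecay w) : Differentiable ℂ (opK ħ r w) := by
  intro z
  have hpi := Real.pi_pos
  have hpi' : (Real.pi : ℂ) ≠ 0 := by exact_mod_cast Real.pi_ne_zero
  have hħ' : (ħ : ℂ) ≠ 0 := by exact_mod_cast hħ.ne'
  have hb : (0 : ℝ) < Real.pi + Real.pi * ħ := by positivity
  set k := 1 / (2 * Real.pi * ħ) with hk
  have hk0 : 0 < k := by positivity
  obtain ⟨C, hC0, hC⟩ := exists_norm_mul_qDilog_le hħ hr hr₁ hr₂ hw hb (k * (‖z‖ + 1) + k + 1)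
  have hcont : Continuous fun x : ℝ => w x * qDilog ħ r x := by
    have h := continuous_line _ (hw.differentiable.continuous.continuousOn.mul
      (differentiableOn_qDilog hħ hr hr₁ hr₂).continuousOn) 0 (by simpa using hb)
    simpa using h
  have key := (hasDerivAt_integral_exp (μ := volume) (z := z) (U := Metric.ball z 1)
    (p := fun x : ℝ => ((-(k * x) : ℝ) : ℂ)) (ψ := fun x : ℝ => w x * qDilog ħ r x)
    (bound := fun x => C * Real.exp (-1 * |x|))
    (Metric.ball_mem_nhds z one_pos) (by fun_prop) hcont.aestronglyMeasurable
    ((integrable_exp_neg_mul_abs one_pos).const_mul C)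
    (Eventually.of_forall fun x u hu => ?_)).2.2.differentiableAt
  · refine key.congr_of_eventuallyEq (Eventually.of_forall fun u => ?_)
    refine integral_congr_ae (Eventually.of_forall fun x => ?_)
    simp only [kernelK]
    rw [mul_comm]
    congr 2
    rw [hk]
    push_cast
    field_simp
    linear_combination (-(x * u : ℂ)) * Complex.I_sq
  · have h1 := hC x (by simp)
    have hu' : ‖u‖ ≤ ‖z‖ + 1 := by
      have h2 : ‖u - z‖ < 1 := by rwa [← dist_eq_norm]
      linarith [norm_sub_norm_le u z]
    rw [Complex.ofReal_re] at h1
    have hnx : ‖((-(k * x) : ℝ) : ℂ)‖ = k * |x| := by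
      rw [Complex.norm_real, norm_neg, norm_mul, Real.norm_of_nonneg hk0.le, Real.norm_eq_abs]
    have h3 : ‖Complex.exp (-(I * ((-(k * x) : ℝ) : ℂ) * u))‖
        ≤ Real.exp (k * (‖z‖ + 1) * |x|) := by
      refine (Complex.norm_exp_le_exp_norm _).trans (Real.exp_le_exp.mpr ?_)
      rw [norm_neg, norm_mul, norm_mul, Complex.norm_I, one_mul, hnx]
      nlinarith [mul_le_mul_of_nonneg_left hu' (mul_nonneg hk0.le (abs_nonneg x))]
    have h4 : 1 + ‖((-(k * x) : ℝ) : ℂ)‖ ≤ Real.exp (k * |x|) := by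
      rw [hnx, add_comm]; exact Real.add_one_le_exp _
    rw [norm_mul]
    refine (mul_le_mul (mul_le_mul h3 h1 (norm_nonneg _) (Real.exp_pos _).le) h4 (by positivity)
      (by positivity)).trans_eq ?_
    rw [mul_left_comm, mul_assoc, ← Real.exp_add, ← Real.exp_add]
    congr 2
    ring

theorem stripGrowth_opK (hħ : 0 < ħ) (hr : 0 < r) (hr₁ : r < 1) (hr₂ : ħ * r < 1)
    {w : ℂ → ℂ} (hw : StripDecay w) : StripGrowth (opK ħ r w) where
  differentiable := differentiable_opK hħ hr hr₁ hr₂ hw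
  bound M := by
    have hb : (0 : ℝ) < Real.pi + Real.pi * ħ := by have := Real.pi_pos; positivity
    obtain ⟨C, hC0, hC⟩ := exists_norm_kernelC_le hħ hr hr₁ hr₂ hw hb M
    refine ⟨∫ x : ℝ, C * Real.exp (-1 * |x|), 0,
      integral_nonneg fun x => by positivity, fun z hz => ?_⟩
    rw [zero_mul, Real.exp_zero, mul_one]
    refine norm_integral_le_of_norm_le ((integrable_exp_neg_mul_abs one_pos).const_mul C)
      (Eventually.of_forall fun x => ?_)
    have h : ‖kernelK ħ r w z x‖ ≤ _ := hC z x (by simp) hz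
    simpa using h

/-- Moving the line of integration up or down gives exponential decay on the real line. -/
theorem memLp_opK (hħ : 0 < ħ) (hr : 0 < r) (hr₁ : r < 1) (hr₂ : ħ * r < 1)
    {w : ℂ → ℂ} (hw : StripDecay w) : MemLp (fun x : ℝ => opK ħ r w x) 2 := by
  have hpi := Real.pi_pos
  have hb : Real.pi < Real.pi + Real.pi * ħ := by have := mul_pos hpi hħ; linarith
  obtain ⟨C, hC0, hC⟩ := exists_norm_kernelC_le hħ hr hr₁ hr₂ hw hb 0
  set D := ∫ x : ℝ, C * Real.exp (-1 * |x|) with hD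
  have hbound : ∀ z : ℝ, ‖opK ħ r w z‖ ≤ D * Real.exp (-(1 / (2 * ħ)) * |z|) := by
    intro z
    -- The line is moved in the direction given by the sign of `z`.
    obtain ⟨y, hy, hyz⟩ : ∃ y : ℝ, |y| = Real.pi ∧ y * z = Real.pi * |z| := by
      rcases abs_cases z with ⟨h, -⟩ | ⟨h, -⟩
      · exact ⟨Real.pi, abs_of_pos hpi, by rw [h]⟩
      · exact ⟨-Real.pi, by rw [abs_neg, abs_of_pos hpi], by rw [h]; ring⟩
    rw [opK_eq_shift hħ hr hr₁ hr₂ hw z (hy.trans_lt hb), hD, ← integral_mul_const]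
    refine norm_integral_le_of_norm_le (((integrable_exp_neg_mul_abs one_pos).const_mul C).mul_const _)
      (Eventually.of_forall fun x => ?_)
    have := hC z (x + y * I) (by simpa using hy.le) (by simp)
    simp only [Complex.add_im, Complex.ofReal_im, Complex.mul_im, Complex.ofReal_re, Complex.I_im,
      mul_one, Complex.I_re, mul_zero, add_zero, zero_add, Complex.add_re, Complex.mul_re,
      sub_self] at this
    refine this.trans_eq ?_
    rw [hyz]
    congr 2
    field_simp
  have hcont : Continuous fun x : ℝ => opK ħ r w x :=
    (differentiable_opK hħ hr hr₁ hr₂ hw).continuous.comp Complex.continuous_ofReal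
  rw [memLp_two_iff_integrable_sq_norm hcont.aestronglyMeasurable]
  refine ((integrable_exp_neg_mul_abs (by positivity : 0 < 1 / ħ)).const_mul (D ^ 2)).mono'
    (hcont.norm.pow 2).aestronglyMeasurable (Eventually.of_forall fun z => ?_)
  rw [Real.norm_of_nonneg (by positivity)]
  refine (pow_le_pow_left₀ (norm_nonneg _) (hbound z) 2).trans_eq ?_
  rw [mul_pow, ← Real.exp_nat_mul]
  congr 2
  push_cast
  field_simp

theorem opK_add (hħ : 0 < ħ) (hr : 0 < r) (hr₁ : r < 1) (hr₂ : ħ * r < 1)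
    {f g : ℂ → ℂ} (hf : StripDecay f) (hg : StripDecay g) :
    opK ħ r (f + g) = opK ħ r f + opK ħ r g := by
  funext z
  rw [Pi.add_apply, opK, opK, opK, ← integral_add (integrable_kernelK hħ hr hr₁ hr₂ hf z)
    (integrable_kernelK hħ hr hr₁ hr₂ hg z)]
  simp only [kernelK, Pi.add_apply, add_mul]

theorem opK_smul (c : ℂ) (f : ℂ → ℂ) : opK ħ r (c • f) = c • opK ħ r f := by
  funext z
  rw [Pi.smul_apply, opK, opK, smul_eq_mul, ← integral_const_mul]
  simp only [kernelK, Pi.smul_apply, smul_eq_mul, mul_assoc]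

/-- Multiplication of `w` by an exponential shifts `K w`; this gives the relations with `X ^ (±1)`. -/
theorem opK_expOp (hħ : 0 < ħ) (t : ℂ) (f : ℂ → ℂ) :
    opK ħ r ((expOp t : Module.End ℂ (ℂ → ℂ)) f)
      = (shiftOp (-(2 * Real.pi * I * ħ * t)) : Module.End ℂ (ℂ → ℂ)) (opK ħ r f) := by
  have hpi : (Real.pi : ℂ) ≠ 0 := by exact_mod_cast Real.pi_ne_zero
  have hħ' : (ħ : ℂ) ≠ 0 := by exact_mod_cast hħ.ne'
  funext z
  rw [shiftOp_apply]
  refine integral_congr_ae (Eventually.of_forall fun x => ?_)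
  simp only [kernelK, expOp_apply]
  have : -(x * (z + -(2 * Real.pi * I * ħ * t))) / (2 * Real.pi * I * ħ)
      = t * x + -(x * z) / (2 * Real.pi * I * ħ) := by
    have := Complex.I_ne_zero
    field_simp
    ring
  rw [this, Complex.exp_add]
  ring

/-- The difference equation of the quantum dilogarithm becomes, by moving the line of integration
up on one side and down on the other, the relation of `K` with `Y ↦ (1 + q Y) X`. -/
theorem expOp_opK (hħ : 0 < ħ) (hr : 0 < r) (hr₁ : r < 1) (hr₂ : ħ * r < 1) {t : ℝ} {ζ : ℂ}
    (hζ : ζ = Complex.exp (Real.pi * I * ħ * t ^ 2))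
    (ht : |Real.pi * ħ * t| < Real.pi + Real.pi * ħ)
    (hΦ : ∀ x : ℝ, qDilog ħ r (x + (Real.pi * ħ * t : ℝ) * I)
      = (1 + Complex.exp (t * x)) * qDilog ħ r (x - (Real.pi * ħ * t : ℝ) * I))
    {w v : ℂ → ℂ} (hw : StripDecay w) (hv : StripDecay v)
    (hvw : ∀ u, v u = (1 + ζ * Complex.exp (t * u)) * w (u + 2 * Real.pi * I * ħ * t)) :
    (expOp t : Module.End ℂ (ℂ → ℂ)) (opK ħ r w) = opK ħ r v := by
  have hpi : (Real.pi : ℂ) ≠ 0 := by exact_mod_cast Real.pi_ne_zero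
  have hħ' : (ħ : ℂ) ≠ 0 := by exact_mod_cast hħ.ne'
  funext z
  rw [expOp_apply, opK_eq_shift hħ hr hr₁ hr₂ hw z ht,
    opK_eq_shift hħ hr hr₁ hr₂ hv z (y := -(Real.pi * ħ * t)) (by rwa [abs_neg]),
    ← integral_const_mul]
  refine integral_congr_ae (Eventually.of_forall fun x => ?_)
  simp only [kernelC]
  have e0 : (x + (-(Real.pi * ħ * t) : ℝ) * I : ℂ) = x - (Real.pi * ħ * t : ℝ) * I := by
    push_cast; ring
  have e1 : (x - (Real.pi * ħ * t : ℝ) * I + 2 * Real.pi * I * ħ * t : ℂ)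
      = x + (Real.pi * ħ * t : ℝ) * I := by
    push_cast; ring
  have e2 : ζ * Complex.exp (t * (x - (Real.pi * ħ * t : ℝ) * I)) = Complex.exp (t * x) := by
    rw [hζ, ← Complex.exp_add]
    congr 1
    push_cast; ring
  have e3 : Complex.exp (t * z)
      * Complex.exp (-((x + (Real.pi * ħ * t : ℝ) * I) * z) / (2 * Real.pi * I * ħ))
      = Complex.exp (-((x - (Real.pi * ħ * t : ℝ) * I) * z) / (2 * Real.pi * I * ħ)) := by
    rw [← Complex.exp_add]
    congr 1
    have := Complex.I_ne_zero
    push_cast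
    field_simp
    ring
  rw [e0, hvw, e1, e2, hΦ, ← e3]
  ring

end

/-! ### Induction on the quantum torus -/

theorem QTorus.induction_gen {R : Type} [CommRing R] {q : Rˣ} {P : QTorus q → Prop}
    (hscalar : ∀ r, P (algebraMap R (QTorus q) r)) (hX : P (QTorus.X q : QTorus q))
    (hXinv : P (((QTorus.X q)⁻¹ : (QTorus q)ˣ) : QTorus q)) (hY : P (QTorus.Y q : QTorus q))
    (hYinv : P (((QTorus.Y q)⁻¹ : (QTorus q)ˣ) : QTorus q))
    (hadd : ∀ a b, P a → P b → P (a + b)) (hmul : ∀ a b, P a → P b → P (a * b))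
    (T : QTorus q) : P T := by
  obtain ⟨T, rfl⟩ := RingQuot.mkAlgHom_surjective R (TorusRel q) T
  induction T using FreeAlgebra.induction with
  | grade0 r => rw [AlgHom.commutes]; exact hscalar r
  | grade1 g => cases g; exacts [hX, hXinv, hY, hYinv]
  | mul a b ha hb => rw [map_mul]; exact hmul _ _ ha hb
  | add a b ha hb => rw [map_add]; exact hadd _ _ ha hb

/-- The subalgebra generated by `X`, `X⁻¹` and `Y`, where `γ` takes values in the quantum torus. -/
noncomputable def QTorus.halfTorus {R : Type} [CommRing R] (q : Rˣ) : Subalgebra R (QTorus q) :=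
  Algebra.adjoin R {(QTorus.X q : QTorus q), (((QTorus.X q)⁻¹ : (QTorus q)ˣ) : QTorus q),
    (QTorus.Y q : QTorus q)}

/-- Multiplication by a power of `Y` clears the negative powers of `Y`. -/
theorem QTorus.exists_Y_pow_mul_mem {R : Type} [CommRing R] (q : Rˣ) (T : QTorus q) :
    ∃ n : ℕ, (QTorus.Y q : QTorus q) ^ n * T ∈ QTorus.halfTorus q := by
  have hX : (QTorus.X q : QTorus q) ∈ QTorus.halfTorus q := Algebra.subset_adjoin (by simp)
  have hX' : (((QTorus.X q)⁻¹ : (QTorus q)ˣ) : QTorus q) ∈ QTorus.halfTorus q :=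
    Algebra.subset_adjoin (by simp)
  have hY : (QTorus.Y q : QTorus q) ∈ QTorus.halfTorus q := Algebra.subset_adjoin (by simp)
  have hT : T ∈ Submodule.span R (Set.range fun p => (QTorus.mon q p : QTorus q)) := by
    rw [QTorus.span_mon]; trivial
  induction hT using Submodule.span_induction with
  | mem x hx =>
    obtain ⟨⟨a, b⟩, rfl⟩ := hx
    refine ⟨b.natAbs, ?_⟩
    have h1 : (QTorus.Y q : QTorus q) ^ b.natAbs = (QTorus.mon q (0, (b.natAbs : ℤ)) : QTorus q) := by
      simp only [QTorus.mon, zpow_zero, one_mul, zpow_natCast, Units.val_pow_eq_pow_val]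
    simp only [h1, QTorus.mon_mul]
    refine Subalgebra.smul_mem _ ?_ _
    obtain ⟨m, hm⟩ : ∃ m : ℕ, (b.natAbs : ℤ) + b = m := ⟨((b.natAbs : ℤ) + b).toNat, by omega⟩
    simp only [QTorus.mon, Prod.mk_add_mk, zero_add, hm, zpow_natCast, Units.val_mul,
      Units.val_pow_eq_pow_val]
    refine mul_mem ?_ (pow_mem hY m)
    rcases Int.eq_nat_or_neg a with ⟨k, rfl | rfl⟩
    · rw [zpow_natCast, Units.val_pow_eq_pow_val]; exact pow_mem hX k
    · rw [zpow_neg, ← inv_zpow, zpow_natCast, Units.val_pow_eq_pow_val]; exact pow_mem hX' k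
  | zero => exact ⟨0, by simp⟩
  | add x y _ _ hx hy =>
    obtain ⟨n, hn⟩ := hx
    obtain ⟨m, hm⟩ := hy
    refine ⟨n + m, ?_⟩
    rw [mul_add]
    refine add_mem ?_ ?_
    · rw [add_comm n m, pow_add, mul_assoc]; exact mul_mem (pow_mem hY m) hn
    · rw [pow_add, mul_assoc]; exact mul_mem (pow_mem hY n) hm
  | smul c x _ hx =>
    obtain ⟨n, hn⟩ := hx
    exact ⟨n, by rw [mul_smul_comm]; exact Subalgebra.smul_mem _ hn c⟩

/-! ### Representations by shifts and exponentials -/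

section

variable {ζ : ℂˣ} {s t : ℂ} {h : (ζ : ℂ) ^ 2 = Complex.exp (t * s)}

theorem torusRep_X : torusRep ζ s t h (QTorus.X qVar : Tq) = shiftOp s := QTorus.liftRing_X _ _ _ _ _ _

theorem torusRep_Y : torusRep ζ s t h (QTorus.Y qVar : Tq) = expOp t := QTorus.liftRing_Y _ _ _ _ _ _

theorem torusRep_Xinv :
    torusRep ζ s t h (((QTorus.X qVar)⁻¹ : Tqˣ) : Tq) = shiftOp (-s) := by
  have : Units.map (torusRep ζ s t h : Tq →* Module.End ℂ (ℂ → ℂ)) (QTorus.X qVar) = shiftOp s :=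
    Units.ext torusRep_X
  rw [← shiftOp_inv, ← this]
  rfl

theorem torusRep_Yinv :
    torusRep ζ s t h (((QTorus.Y qVar)⁻¹ : Tqˣ) : Tq) = expOp (-t) := by
  have : Units.map (torusRep ζ s t h : Tq →* Module.End ℂ (ℂ → ℂ)) (QTorus.Y qVar) = expOp t :=
    Units.ext torusRep_Y
  rw [← expOp_inv, ← this]
  rfl

theorem torusRep_algebraMap (a : Zq) (f : ℂ → ℂ) :
    torusRep ζ s t h (algebraMap Zq Tq a) f
      = LaurentPolynomial.eval₂ (Int.castRingHom ℂ) ζ a • f := by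
  rw [torusRep, QTorus.liftRing_algebraMap]
  rfl

theorem torusRep_flipY_apply (f : ℂ → ℂ) (z : ℂ) :
    torusRep ζ s t h (QTorus.flipY qVar) f z
      = (1 + ζ * Complex.exp (t * z)) * f (z + s) := by
  rw [QTorus.flipY, map_mul, map_add, map_one, Algebra.smul_def, map_mul, torusRep_X, torusRep_Y]
  change f (z + s) + torusRep ζ s t h (algebraMap Zq Tq _) _ z = _
  rw [torusRep_algebraMap]
  have : LaurentPolynomial.eval₂ (Int.castRingHom ℂ) ζ (qVar : Zq) = (ζ : ℂ) := by
    change LaurentPolynomial.eval₂ (Int.castRingHom ℂ) ζ (LaurentPolynomial.T 1) = _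
    rw [LaurentPolynomial.eval₂_T]; simp
  rw [this, Pi.smul_apply, smul_eq_mul, expOp_apply, shiftOp_apply]
  ring

theorem torusRep_mem_gaussW (T : Tq) {w : ℂ → ℂ} (hw : w ∈ gaussW) :
    torusRep ζ s t h T w ∈ gaussW := by
  induction T using QTorus.induction_gen generalizing w with
  | hscalar a => rw [torusRep_algebraMap]; exact gaussW.smul_mem _ hw
  | hX => rw [torusRep_X]; exact shiftOp_mem_gaussW s hw
  | hXinv => rw [torusRep_Xinv]; exact shiftOp_mem_gaussW _ hw
  | hY => rw [torusRep_Y]; exact expOp_mem_gaussW t hw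
  | hYinv => rw [torusRep_Yinv]; exact expOp_mem_gaussW _ hw
  | hadd a b ha hb => rw [map_add]; exact gaussW.add_mem (ha hw) (hb hw)
  | hmul a b ha hb => rw [map_mul]; exact ha (hb hw)

theorem StripGrowth.torusRep (T : Tq) {f : ℂ → ℂ} (hf : StripGrowth f) :
    StripGrowth (torusRep ζ s t h T f) := by
  induction T using QTorus.induction_gen generalizing f with
  | hscalar a => rw [torusRep_algebraMap]; exact (stripGrowth_const _).mul hf
  | hX => rw [torusRep_X]; exact hf.shift s
  | hXinv => rw [torusRep_Xinv]; exact hf.shift _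
  | hY => rw [torusRep_Y]; exact hf.expOp t
  | hYinv => rw [torusRep_Yinv]; exact hf.expOp _
  | hadd a b ha hb => rw [map_add]; exact (ha hf).add (hb hf)
  | hmul a b ha hb => rw [map_mul]; exact ha (hb hf)

/-! ### The relation of `K` with one quantum torus -/

/-- The hypothesis `hY` is the relation for the generator `Y`; those for `X` and `X⁻¹` hold
unconditionally. -/
theorem exists_gamma_eq_of_mem_halfTorus {ħ r : ℝ} (hħ : 0 < ħ) (hr : 0 < r) (hr₁ : r < 1)
    (hr₂ : ħ * r < 1) (hs : s = 2 * Real.pi * I * ħ * t)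
    (hY : ∀ w ∈ gaussW, (expOp t : Module.End ℂ (ℂ → ℂ)) (opK ħ r w)
      = opK ħ r (torusRep ζ s t h (QTorus.flipY qVar) w))
    {T : Tq} (hT : T ∈ QTorus.halfTorus qVar) :
    ∃ T' : Tq, QTorus.gamma qVar (QTorus.toFrac qVar T) = QTorus.toFrac qVar T' ∧
      ∀ w ∈ gaussW, opK ħ r (torusRep ζ s t h T' w) = torusRep ζ s t h T (opK ħ r w) := by
  induction hT using Algebra.adjoin_induction with
  | mem x hx =>
    simp only [Set.mem_insert_iff, Set.mem_singleton_iff] at hx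
    rcases hx with rfl | rfl | rfl
    · refine ⟨(((QTorus.Y qVar)⁻¹ : Tqˣ) : Tq), ?_, fun w _ => ?_⟩
      · rw [QTorus.gamma_X, QTorus.toFrac_inv]
      · rw [torusRep_X, torusRep_Yinv, opK_expOp hħ, mul_neg, neg_neg, hs]
    · refine ⟨QTorus.Y qVar, QTorus.gamma_Xinv qVar, fun w _ => ?_⟩
      rw [torusRep_Xinv, torusRep_Y, opK_expOp hħ, hs]
    · refine ⟨QTorus.flipY qVar, QTorus.gamma_Y' qVar, fun w hw => ?_⟩
      rw [torusRep_Y, hY w hw]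
  | algebraMap a =>
    refine ⟨algebraMap Zq Tq a, by simp, fun w _ => ?_⟩
    rw [torusRep_algebraMap, torusRep_algebraMap, opK_smul]
  | add x y _ _ hx hy =>
    obtain ⟨x', hx', hx⟩ := hx
    obtain ⟨y', hy', hy⟩ := hy
    refine ⟨x' + y', by simp only [map_add, hx', hy'], fun w hw => ?_⟩
    rw [map_add, map_add, LinearMap.add_apply, LinearMap.add_apply, ← hx w hw, ← hy w hw,
      opK_add hħ hr hr₁ hr₂ (stripDecay_of_mem_gaussW (torusRep_mem_gaussW _ hw))
      (stripDecay_of_mem_gaussW (torusRep_mem_gaussW _ hw))]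
  | mul x y _ _ hx hy =>
    obtain ⟨x', hx', hx⟩ := hx
    obtain ⟨y', hy', hy⟩ := hy
    refine ⟨x' * y', by simp only [map_mul, hx', hy'], fun w hw => ?_⟩
    rw [map_mul, map_mul, Module.End.mul_apply, Module.End.mul_apply, ← hy w hw,
      hx _ (torusRep_mem_gaussW _ hw)]

/-- The relation of `K` with all Laurent polynomials whose image under `γ` is a Laurent polynomial.
After multiplication by a power of `Y` on the left, which acts invertibly, only nonnegative powers
of `Y` remain. -/
theorem opK_torusRep {ħ r : ℝ} (hħ : 0 < ħ) (hr : 0 < r) (hr₁ : r < 1)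
    (hr₂ : ħ * r < 1) (hs : s = 2 * Real.pi * I * ħ * t)
    (hY : ∀ w ∈ gaussW, (expOp t : Module.End ℂ (ℂ → ℂ)) (opK ħ r w)
      = opK ħ r (torusRep ζ s t h (QTorus.flipY qVar) w))
    {T T' : Tq} (hT : QTorus.gamma qVar (QTorus.toFrac qVar T) = QTorus.toFrac qVar T')
    {w : ℂ → ℂ} (hw : w ∈ gaussW) :
    opK ħ r (torusRep ζ s t h T' w) = torusRep ζ s t h T (opK ħ r w) := by
  obtain ⟨n, hn⟩ := QTorus.exists_Y_pow_mul_mem qVar T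
  obtain ⟨S, hS, hSw⟩ := exists_gamma_eq_of_mem_halfTorus hħ hr hr₁ hr₂ hs hY hn
  have hS' : S = QTorus.flipY qVar ^ n * T' := by
    apply QTorus.toFrac_injective qVar
    rw [← hS, map_mul, map_mul, map_pow, map_pow, QTorus.gamma_Y', hT, map_mul, map_pow]
  have hpow : ∀ (n : ℕ) (v : ℂ → ℂ), v ∈ gaussW →
      opK ħ r (torusRep ζ s t h (QTorus.flipY qVar ^ n) v)
        = torusRep ζ s t h ((QTorus.Y qVar : Tq) ^ n) (opK ħ r v) := by
    intro n
    induction n with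
    | zero => intro v _; simp
    | succ n ih =>
      intro v hv
      rw [pow_succ, pow_succ, map_mul, map_mul, Module.End.mul_apply, Module.End.mul_apply,
        ih _ (torusRep_mem_gaussW _ hv), torusRep_Y, hY v hv]
  have h1 := hSw w hw
  rw [hS', map_mul, Module.End.mul_apply, hpow n _ (torusRep_mem_gaussW _ hw), map_mul,
    Module.End.mul_apply] at h1
  have h2 := congrArg (torusRep ζ s t h ((((QTorus.Y qVar)⁻¹ ^ n : Tqˣ)) : Tq)) h1
  rw [← Module.End.mul_apply, ← Module.End.mul_apply, ← map_mul, ← Units.val_pow_eq_pow_val,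
    ← Units.val_mul, inv_pow, inv_mul_cancel, Units.val_one, map_one] at h2
  exact h2

end

/-! ### Duality -/

theorem StripDecay.conj_conj {v : ℂ → ℂ} (hv : StripDecay v) :
    StripDecay fun u => conj (v (conj u)) where
  differentiable u := by
    have := (hv.differentiable (conj u)).conj_conj
    rwa [Complex.conj_conj] at this
  bound M c := by
    obtain ⟨C, hC0, hC⟩ := hv.bound M c
    refine ⟨C, hC0, fun z hz => ?_⟩
    simpa using hC (conj z) (by simpa using hz)

theorem StripDecay.integrable {f : ℂ → ℂ} (hf : StripDecay f) : Integrable fun x : ℝ => f x := by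
  obtain ⟨C, -, hC⟩ := hf.bound 0 1
  simpa using integrable_line (v := 0) (U := univ) hf.differentiable.continuous.continuousOn one_pos
    (by simp) fun x => by simpa using hC x (by simp)

/-- Cauchy's theorem. -/
theorem StripDecay.integral_shift {f : ℂ → ℂ} (hf : StripDecay f) (y : ℝ) :
    ∫ x : ℝ, f x = ∫ x : ℝ, f (x + y * I) := by
  obtain ⟨C, -, hC⟩ := hf.bound |y| 1
  refine integral_line_shift one_pos hf.differentiable.differentiableOn (C := C) fun x v hv => ?_
  have hv' : |v| ≤ |y| := by simpa using abs_sub_left_of_mem_uIcc hv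
  simpa using hC (x + v * I) (by simpa using hv')

theorem integrable_mul_conj {f v : ℂ → ℂ} (hf : StripGrowth f) (hv : StripDecay v) :
    Integrable fun x : ℝ => f x * conj (v x) := by
  simpa using (StripGrowth.mul_stripDecay hf hv.conj_conj).integrable

/-- The shift by an imaginary number is symmetric. -/
theorem integral_shiftOp_mul_conj {f v : ℂ → ℂ} (hf : StripGrowth f) (hv : StripDecay v) (y : ℝ) :
    ∫ x : ℝ, (shiftOp (y * I) : Module.End ℂ (ℂ → ℂ)) f x * conj (v x)
      = ∫ x : ℝ, f x * conj ((shiftOp (y * I) : Module.End ℂ (ℂ → ℂ)) v x) := by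
  have h := (StripGrowth.mul_stripDecay (hf.shift (y * I)) hv.conj_conj).integral_shift (-y)
  simp only [Pi.mul_apply, Complex.conj_ofReal] at h
  -- The function `f(u + i y) v*(u)`, with `v*` the conjugate of `v`, is integrated over `Im u = -y`.
  rw [h]
  refine integral_congr_ae (Eventually.of_forall fun x => ?_)
  simp only [shiftOp_apply, map_add, map_mul, Complex.conj_ofReal, Complex.conj_I]
  push_cast
  ring_nf

theorem starLin_mul (a b : Tq) : starLin (a * b) = starLin b * starLin a := by
  simp [starLin_apply]

theorem starLin_algebraMap (a : Zq) :
    starLin (algebraMap Zq Tq a) = algebraMap Zq Tq (LaurentPolynomial.invert a) :=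
  congrArg MulOpposite.unop (QTorus.liftRing_algebraMap qVar starScalar starScalar_comm
    (Units.opEquiv.symm (MulOpposite.op (QTorus.X qVar)))
    (Units.opEquiv.symm (MulOpposite.op (QTorus.Y qVar))) star_rel a)

theorem starLin_X : starLin (QTorus.X qVar : Tq) = QTorus.X qVar := by
  rw [starLin_apply, starTq_X, MulOpposite.unop_op]

theorem starLin_Y : starLin (QTorus.Y qVar : Tq) = QTorus.Y qVar := by
  rw [starLin_apply, starTq_Y, MulOpposite.unop_op]

theorem starLin_one : starLin 1 = 1 := by simp [starLin_apply]

theorem starLin_inv {u : Tqˣ} (hu : starLin (u : Tq) = u) :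
    starLin ((u⁻¹ : Tqˣ) : Tq) = ((u⁻¹ : Tqˣ) : Tq) := by
  have h1 : starLin ((u⁻¹ : Tqˣ) : Tq) * u = 1 := by
    have := starLin_mul (u : Tq) ((u⁻¹ : Tqˣ) : Tq)
    rwa [Units.mul_inv, starLin_one, hu, eq_comm] at this
  exact eq_comm.mp (Units.inv_eq_of_mul_eq_one_left h1)

theorem conj_eval₂_invert {ζ : ℂˣ} (hζ : conj (ζ : ℂ) = (ζ : ℂ)⁻¹) (a : Zq) :
    conj (LaurentPolynomial.eval₂ (Int.castRingHom ℂ) ζ (LaurentPolynomial.invert a))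
      = LaurentPolynomial.eval₂ (Int.castRingHom ℂ) ζ a := by
  induction a using LaurentPolynomial.induction_on' with
  | add p q hp hq => simp only [map_add, hp, hq]
  | C_mul_T n c =>
    rw [map_mul, LaurentPolynomial.invert_C, LaurentPolynomial.invert_T, map_mul, map_mul, map_mul,
      LaurentPolynomial.eval₂_T, LaurentPolynomial.eval₂_T, LaurentPolynomial.eval₂_C]
    simp [hζ]

/-- The operators of `T` and `∗T` are adjoint to each other if the shift is imaginary, the exponent
real and the parameter of modulus one. -/
theorem integral_torusRep_mul_conj {ζ : ℂˣ} {y t : ℝ} {h : (ζ : ℂ) ^ 2 = Complex.exp (t * (y * I))}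
    (hζ : conj (ζ : ℂ) = (ζ : ℂ)⁻¹) (T : Tq) {f v : ℂ → ℂ} (hf : StripGrowth f) (hv : v ∈ gaussW) :
    ∫ x : ℝ, torusRep ζ (y * I) t h T f x * conj (v x)
      = ∫ x : ℝ, f x * conj (torusRep ζ (y * I) t h (starLin T) v x) := by
  have hexp : ∀ t : ℝ, ∀ f v : ℂ → ℂ, ∀ x : ℝ,
      (expOp t : Module.End ℂ (ℂ → ℂ)) f x * conj (v x)
        = f x * conj ((expOp t : Module.End ℂ (ℂ → ℂ)) v x) := by
    intro t f v x
    simp only [expOp_apply, map_mul, ← Complex.exp_conj, Complex.conj_ofReal]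
    ring
  induction T using QTorus.induction_gen generalizing f v with
  | hscalar a =>
    rw [starLin_algebraMap, torusRep_algebraMap, torusRep_algebraMap]
    simp only [Pi.smul_apply, smul_eq_mul, map_mul, conj_eval₂_invert hζ]
    refine integral_congr_ae (Eventually.of_forall fun x => ?_)
    simp only
    ring
  | hX =>
    rw [starLin_X, torusRep_X]
    exact integral_shiftOp_mul_conj hf (stripDecay_of_mem_gaussW hv) y
  | hXinv =>
    rw [starLin_inv starLin_X, torusRep_Xinv]
    have := integral_shiftOp_mul_conj hf (stripDecay_of_mem_gaussW hv) (-y)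
    rwa [Complex.ofReal_neg, neg_mul] at this
  | hY =>
    rw [starLin_Y, torusRep_Y]
    simp only [hexp]
  | hYinv =>
    rw [starLin_inv starLin_Y, torusRep_Yinv, ← Complex.ofReal_neg]
    simp only [hexp]
  | hadd a b ha hb =>
    have h1 := ha hf hv
    have h2 := hb hf hv
    simp only [map_add, LinearMap.add_apply, Pi.add_apply, add_mul, mul_add]
    rw [integral_add (integrable_mul_conj (hf.torusRep _) (stripDecay_of_mem_gaussW hv))
      (integrable_mul_conj (hf.torusRep _) (stripDecay_of_mem_gaussW hv)),
      integral_add (integrable_mul_conj hf (stripDecay_of_mem_gaussW (torusRep_mem_gaussW _ hv)))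
      (integrable_mul_conj hf (stripDecay_of_mem_gaussW (torusRep_mem_gaussW _ hv))), h1, h2]
  | hmul a b ha hb =>
    rw [starLin_mul, map_mul, map_mul, Module.End.mul_apply, Module.End.mul_apply,
      ha (hf.torusRep _) hv, hb hf (torusRep_mem_gaussW _ hv)]

/-! ### The two commuting quantum tori -/

theorem commute_shiftOp_expOp {s t : ℂ} (h : Complex.exp (t * s) = 1) :
    Commute (shiftOp s : Module.End ℂ (ℂ → ℂ)) (expOp t : Module.End ℂ (ℂ → ℂ)) := by
  apply LinearMap.ext
  intro f
  funext z
  change Complex.exp (t * (z + s)) * f (z + s) = Complex.exp (t * z) * f (z + s)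
  rw [mul_add, Complex.exp_add, h, mul_one]

theorem commute_shiftOp_shiftOp (s s' : ℂ) :
    Commute (shiftOp s : Module.End ℂ (ℂ → ℂ)) (shiftOp s' : Module.End ℂ (ℂ → ℂ)) := by
  apply LinearMap.ext
  intro f
  funext z
  change f (z + s + s') = f (z + s' + s)
  rw [add_right_comm]

theorem commute_expOp_expOp (t t' : ℂ) :
    Commute (expOp t : Module.End ℂ (ℂ → ℂ)) (expOp t' : Module.End ℂ (ℂ → ℂ)) := by
  apply LinearMap.ext
  intro f
  funext z
  change Complex.exp (t * z) * (Complex.exp (t' * z) * f z)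
    = Complex.exp (t' * z) * (Complex.exp (t * z) * f z)
  ring

theorem commute_torusRep_of_gen {ζ : ℂˣ} {s t : ℂ} {h : (ζ : ℂ) ^ 2 = Complex.exp (t * s)}
    {B : Module.End ℂ (ℂ → ℂ)} (hs : Commute (shiftOp s : Module.End ℂ (ℂ → ℂ)) B)
    (ht : Commute (expOp t : Module.End ℂ (ℂ → ℂ)) B) (T : Tq) :
    Commute (torusRep ζ s t h T) B := by
  induction T using QTorus.induction_gen with
  | hscalar a =>
    rw [torusRep, QTorus.liftRing_algebraMap]
    exact scalarRep_comm ζ a B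
  | hX => rwa [torusRep_X]
  | hXinv => rw [torusRep_Xinv, ← shiftOp_inv]; exact hs.units_inv_left
  | hY => rwa [torusRep_Y]
  | hYinv => rw [torusRep_Yinv, ← expOp_inv]; exact ht.units_inv_left
  | hadd a b ha hb => rw [map_add]; exact ha.add_left hb
  | hmul a b ha hb => rw [map_mul]; exact ha.mul_left hb

variable {ħ r : ℝ}

theorem commute_rep_repDual (hħ : 0 < ħ) (F G : Tq) : Commute (rep ħ F) (repDual ħ G) := by
  have hħ' : (ħ : ℂ) ≠ 0 := by exact_mod_cast hħ.ne'
  refine commute_torusRep_of_gen (Commute.symm (commute_torusRep_of_gen ?_ ?_ G))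
    (Commute.symm (commute_torusRep_of_gen ?_ ?_ G)) F
  · exact commute_shiftOp_shiftOp _ _
  · refine (commute_shiftOp_expOp ?_).symm
    rw [show 1 / (ħ : ℂ) * (2 * Real.pi * I * ħ) = 2 * Real.pi * I by field_simp,
      Complex.exp_two_pi_mul_I]
  · refine commute_shiftOp_expOp ?_
    rw [one_mul, Complex.exp_two_pi_mul_I]
  · exact commute_expOp_expOp _ _

theorem rep_mem_gaussW (T : Tq) {w : ℂ → ℂ} (hw : w ∈ gaussW) : rep ħ T w ∈ gaussW :=
  torusRep_mem_gaussW T hw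

theorem repDual_mem_gaussW (T : Tq) {w : ℂ → ℂ} (hw : w ∈ gaussW) : repDual ħ T w ∈ gaussW :=
  torusRep_mem_gaussW T hw

theorem conj_exp_mul_I (a : ℝ) : conj (Complex.exp (a * I)) = (Complex.exp (a * I))⁻¹ := by
  rw [← Complex.exp_conj, ← Complex.exp_neg, map_mul, Complex.conj_ofReal, Complex.conj_I, mul_neg]

theorem integral_rep_mul_conj (T : Tq) {f v : ℂ → ℂ} (hf : StripGrowth f) (hv : v ∈ gaussW) :
    ∫ x : ℝ, rep ħ T f x * conj (v x) = ∫ x : ℝ, f x * conj (rep ħ (starLin T) v x) := by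
  have e1 : (2 * Real.pi * I * ħ : ℂ) = (2 * Real.pi * ħ : ℝ) * I := by push_cast; ring
  have e2 : (1 : ℂ) = (1 : ℝ) := by simp
  have hζ : conj (expUnit (Real.pi * I * ħ) : ℂ) = (expUnit (Real.pi * I * ħ) : ℂ)⁻¹ := by
    change conj (Complex.exp (Real.pi * I * ħ)) = (Complex.exp (Real.pi * I * ħ))⁻¹
    rw [show (Real.pi * I * ħ : ℂ) = (Real.pi * ħ : ℝ) * I by push_cast; ring, conj_exp_mul_I]
  unfold rep
  simp only [e1, e2]
  exact integral_torusRep_mul_conj hζ T hf hv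

theorem integral_repDual_mul_conj (T : Tq) {f v : ℂ → ℂ} (hf : StripGrowth f) (hv : v ∈ gaussW) :
    ∫ x : ℝ, repDual ħ T f x * conj (v x) = ∫ x : ℝ, f x * conj (repDual ħ (starLin T) v x) := by
  have e1 : (2 * Real.pi * I : ℂ) = (2 * Real.pi : ℝ) * I := by push_cast; ring
  have e2 : (1 / ħ : ℂ) = (1 / ħ : ℝ) := by push_cast; ring
  have hζ : conj (expUnit (Real.pi * I / ħ) : ℂ) = (expUnit (Real.pi * I / ħ) : ℂ)⁻¹ := by
    change conj (Complex.exp (Real.pi * I / ħ)) = (Complex.exp (Real.pi * I / ħ))⁻¹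
    rw [show (Real.pi * I / ħ : ℂ) = (Real.pi / ħ : ℝ) * I by push_cast; ring, conj_exp_mul_I]
  unfold repDual
  simp only [e1, e2]
  exact integral_torusRep_mul_conj hζ T hf hv

theorem opK_rep (hħ : 0 < ħ) (hr : 0 < r) (hr₁ : r < 1) (hr₂ : ħ * r < 1) {T T' : Tq}
    (hT : QTorus.gamma qVar (QTorus.toFrac qVar T) = QTorus.toFrac qVar T')
    {w : ℂ → ℂ} (hw : w ∈ gaussW) :
    opK ħ r (rep ħ T' w) = rep ħ T (opK ħ r w) := by
  have hpi := Real.pi_pos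
  have hpħ := mul_pos hpi hħ
  refine opK_torusRep hħ hr hr₁ hr₂ (by ring) (fun w hw => ?_) hT hw
  have := expOp_opK hħ hr hr₁ hr₂ (t := 1) (ζ := Complex.exp (Real.pi * I * ħ))
    (w := w) (v := rep ħ (QTorus.flipY qVar) w)
    (by simp) (by rw [mul_one, abs_of_pos hpħ]; linarith)
    (fun x => by simpa using qDilog_add_pi_mul_I hħ hr hr₁ hr₂ x) (stripDecay_of_mem_gaussW hw)
    (stripDecay_of_mem_gaussW (rep_mem_gaussW _ hw)) (fun u => by
      rw [rep, torusRep_flipY_apply, Complex.ofReal_one, mul_one]; rfl)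
  rwa [Complex.ofReal_one] at this

theorem opK_repDual (hħ : 0 < ħ) (hr : 0 < r) (hr₁ : r < 1) (hr₂ : ħ * r < 1) {T T' : Tq}
    (hT : QTorus.gamma qVar (QTorus.toFrac qVar T) = QTorus.toFrac qVar T')
    {w : ℂ → ℂ} (hw : w ∈ gaussW) :
    opK ħ r (repDual ħ T' w) = repDual ħ T (opK ħ r w) := by
  have hpi := Real.pi_pos
  have hpħ := mul_pos hpi hħ
  have hħ' : (ħ : ℂ) ≠ 0 := by exact_mod_cast hħ.ne'
  have e0 : Real.pi * ħ * (1 / ħ) = Real.pi := by field_simp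
  refine opK_torusRep hħ hr hr₁ hr₂ (by field_simp) (fun w hw => ?_) hT hw
  have := expOp_opK hħ hr hr₁ hr₂ (t := 1 / ħ) (ζ := Complex.exp (Real.pi * I / ħ))
    (w := w) (v := repDual ħ (QTorus.flipY qVar) w)
    (by congr 1; push_cast; field_simp) (by rw [e0, abs_of_pos hpi]; linarith)
    (fun x => by
      rw [e0, qDilog_add_pi_I hħ hr hr₁ hr₂ x, Complex.ofReal_div, Complex.ofReal_one,
        one_div_mul_eq_div])
    (stripDecay_of_mem_gaussW hw)
    (stripDecay_of_mem_gaussW (repDual_mem_gaussW _ hw)) (fun u => by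
      rw [repDual, torusRep_flipY_apply, Complex.ofReal_div, Complex.ofReal_one,
        show 2 * Real.pi * I * ħ * (1 / ħ) = 2 * Real.pi * I by field_simp]; rfl)
  rwa [Complex.ofReal_div, Complex.ofReal_one] at this

/-! ### The algebra `𝐋` -/

theorem gamma_toFrac_laurent (F : Lq) :
    QTorus.gamma qVar (QTorus.toFrac qVar (QTorus.laurent qVar F))
      = QTorus.toFrac qVar (QTorus.laurent qVar (QTorus.gammaSpan qVar F)) := by
  rw [QTorus.toFrac_laurent, QTorus.toFrac_laurent]
  rfl

theorem hatOp_tmul (F G : Lq) : hatOp ħ (TensorProduct.tmul ℤ F G)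
    = rep ħ (QTorus.laurent qVar F) * repDual ħ (QTorus.laurent qVar G) := rfl

theorem hatStarOp_tmul (F G : Lq) : hatStarOp ħ (TensorProduct.tmul ℤ F G)
    = rep ħ (starLin (QTorus.laurent qVar F)) * repDual ħ (starLin (QTorus.laurent qVar G)) := rfl

theorem hatOp_add (A B : LL) : hatOp ħ (A + B) = hatOp ħ A + hatOp ħ B := by
  simp only [hatOp, map_add]

theorem hatStarOp_add (A B : LL) : hatStarOp ħ (A + B) = hatStarOp ħ A + hatStarOp ħ B := by
  simp only [hatStarOp, map_add]

theorem hatOp_mem_gaussW (A : LL) {w : ℂ → ℂ} (hw : w ∈ gaussW) : hatOp ħ A w ∈ gaussW := by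
  induction A using TensorProduct.induction_on with
  | zero => simp [hatOp]
  | tmul F G => exact rep_mem_gaussW _ (repDual_mem_gaussW _ hw)
  | add A B hA hB => rw [hatOp_add]; exact gaussW.add_mem hA hB

theorem hatStarOp_mem_gaussW (A : LL) {w : ℂ → ℂ} (hw : w ∈ gaussW) :
    hatStarOp ħ A w ∈ gaussW := by
  induction A using TensorProduct.induction_on with
  | zero => simp [hatStarOp]
  | tmul F G => exact rep_mem_gaussW _ (repDual_mem_gaussW _ hw)
  | add A B hA hB => rw [hatStarOp_add]; exact gaussW.add_mem hA hB

theorem StripGrowth.hatOp (A : LL) {f : ℂ → ℂ} (hf : StripGrowth f) :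
    StripGrowth (hatOp ħ A f) := by
  induction A using TensorProduct.induction_on with
  | zero => simpa [QuantumPentagon.hatOp] using! stripGrowth_const 0
  | tmul F G => exact (hf.torusRep (QTorus.laurent qVar G)).torusRep (QTorus.laurent qVar F)
  | add A B hA hB => rw [hatOp_add]; exact hA.add hB

theorem opK_hatOp (hħ : 0 < ħ) (hr : 0 < r) (hr₁ : r < 1) (hr₂ : ħ * r < 1) (A : LL)
    {w : ℂ → ℂ} (hw : w ∈ gaussW) :
    opK ħ r (hatOp ħ (gammaLL A) w) = hatOp ħ A (opK ħ r w) := by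
  induction A using TensorProduct.induction_on with
  | zero =>
    have := opK_smul (ħ := ħ) (r := r) 0 0
    simpa [hatOp] using this
  | tmul F G =>
    rw [gammaLL_tmul, hatOp_tmul, hatOp_tmul, Module.End.mul_apply, Module.End.mul_apply,
      ← opK_repDual hħ hr hr₁ hr₂ (gamma_toFrac_laurent G) hw,
      ← opK_rep hħ hr hr₁ hr₂ (gamma_toFrac_laurent F) (repDual_mem_gaussW _ hw)]
  | add A B hA hB =>
    rw [map_add, hatOp_add, hatOp_add, LinearMap.add_apply, LinearMap.add_apply, ← hA, ← hB,
      opK_add hħ hr hr₁ hr₂ (stripDecay_of_mem_gaussW (hatOp_mem_gaussW _ hw))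
      (stripDecay_of_mem_gaussW (hatOp_mem_gaussW _ hw))]

theorem integral_hatOp_mul_conj (hħ : 0 < ħ) (A : LL) {f v : ℂ → ℂ} (hf : StripGrowth f)
    (hv : v ∈ gaussW) :
    ∫ x : ℝ, hatOp ħ A f x * conj (v x) = ∫ x : ℝ, f x * conj (hatStarOp ħ A v x) := by
  induction A using TensorProduct.induction_on with
  | zero => simp [hatOp, hatStarOp]
  | tmul F G =>
    have hG : StripGrowth (repDual ħ (QTorus.laurent qVar G) f) := hf.torusRep _
    rw [hatOp_tmul, hatStarOp_tmul,
      (commute_rep_repDual hħ (starLin (QTorus.laurent qVar F)) (starLin (QTorus.laurent qVar G))).eq,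
      Module.End.mul_apply, Module.End.mul_apply, integral_rep_mul_conj _ hG hv,
      integral_repDual_mul_conj _ hf (rep_mem_gaussW _ hv)]
  | add A B hA hB =>
    simp only [hatOp_add, hatStarOp_add, LinearMap.add_apply, Pi.add_apply, map_add, add_mul,
      mul_add]
    rw [integral_add (integrable_mul_conj (hf.hatOp A) (stripDecay_of_mem_gaussW hv))
      (integrable_mul_conj (hf.hatOp B) (stripDecay_of_mem_gaussW hv)),
      integral_add (integrable_mul_conj hf (stripDecay_of_mem_gaussW (hatStarOp_mem_gaussW A hv)))
      (integrable_mul_conj hf (stripDecay_of_mem_gaussW (hatStarOp_mem_gaussW B hv))), hA, hB]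

end QuantumPentagon

theorem proposition2p5 (ħ : ℝ) (hħ : 0 < ħ) (r : ℝ) (hr : 0 < r) (hr₁ : r < 1) (hr₂ : r < 1 / ħ)
    (A : QuantumPentagon.LL) (w : ℂ → ℂ) (hw : w ∈ QuantumPentagon.gaussW) :
    -- the operator of `γ(A)` maps `w` to `W`
    QuantumPentagon.hatOp ħ (QuantumPentagon.gammaLL A) w ∈ QuantumPentagon.gaussW ∧
    -- `K w` is given by an absolutely convergent integral and is an entire function
    (∀ z : ℂ, MeasureTheory.Integrable (QuantumPentagon.kernelK ħ r w z)) ∧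
    Differentiable ℂ (QuantumPentagon.opK ħ r w) ∧
    -- the commutation relation, with the operator of `A` acting on the entire function `K w`
    QuantumPentagon.opK ħ r (QuantumPentagon.hatOp ħ (QuantumPentagon.gammaLL A) w)
      = QuantumPentagon.hatOp ħ A (QuantumPentagon.opK ħ r w) ∧
    -- the result is in `L²(ℝ)`
    MeasureTheory.MemLp
      (fun x : ℝ => QuantumPentagon.hatOp ħ A (QuantumPentagon.opK ħ r w) x) 2 ∧
    -- the relation also holds with the operator of `A` acting on `K w` by duality with `W`
    ∀ v ∈ QuantumPentagon.gaussW,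
      ∫ x : ℝ, QuantumPentagon.opK ħ r (QuantumPentagon.hatOp ħ (QuantumPentagon.gammaLL A) w) x
          * (starRingEnd ℂ) (v x)
        = ∫ x : ℝ, QuantumPentagon.opK ħ r w x
          * (starRingEnd ℂ) (QuantumPentagon.hatStarOp ħ A v x) := by
  have hr₂' : ħ * r < 1 := by rwa [lt_div_iff₀' hħ] at hr₂
  have hw' := QuantumPentagon.stripDecay_of_mem_gaussW hw
  have hγw := QuantumPentagon.hatOp_mem_gaussW (ħ := ħ) (QuantumPentagon.gammaLL A) hw
  have hK := QuantumPentagon.opK_hatOp hħ hr hr₁ hr₂' A hw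
  refine ⟨hγw, QuantumPentagon.integrable_kernelK hħ hr hr₁ hr₂' hw',
    QuantumPentagon.differentiable_opK hħ hr hr₁ hr₂' hw', hK, ?_, fun v hv => ?_⟩
  · rw [← hK]
    exact QuantumPentagon.memLp_opK hħ hr hr₁ hr₂' (QuantumPentagon.stripDecay_of_mem_gaussW hγw)
  · rw [hK]
    exact QuantumPentagon.integral_hatOp_mul_conj hħ A
      (QuantumPentagon.stripGrowth_opK hħ hr hr₁ hr₂' hw') hv
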